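/- **Setting.** Let $n\ge 0$, $d,m_1\ge 1$ be integers, $\mathbb B^n$ the closed Euclidean unit ball of $\mathbb R^n$, and $n_d=\sum_{i=0}^d n^i$. Let $\psi_d:\mathbb B^n\to\mathbb R^{n_d}$ have the coordinates $[\psi_d(x)]_{(k_1,\dots,k_i)}=\frac1{\sqrt{d+1}}\prod_{j=1}^i x_{k_j}$ for $0\le i\le d$ and $(k_1,\dots,k_i)\in[n]^i$, and let $\mathcal K_d(x,y)=\langle\psi_d(x),\psi_d(y)\rangle$. Let $B,L,\zeta,\epsilon>0$ and let $\mathcal D$ be a probability distribution on $\mathbb B^n\times[0,1]$ with $$\mathbb E[y\mid x]=c(x):=u(\langle v,\psi_d(x)\rangle+\xi(x)),$$ where $\|v\|_2\le B$, $u:\mathbb R\to[0,1]$ is a known non-decreasing $L$-Lipschitz function, and $\xi:\mathbb R^n\to[-\zeta,\zeta]$ is measurable with $\mathbb E[\xi(x)^2]\le\epsilon$. For $h:\mathbb B^n\to[0,1]$ put $\varepsilon(h)=\mathbb E_{(x,y)\sim\mathcal D}[(h(x)-c(x))^2]$. Let $0<\delta<1/3$, and with constants $C,C'>0$ put $$T=\Big\lceil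 CBL\sqrt{m_1/\log(1/\delta)}\Big\rceil,\quad m_2=\lceil C'm_1\log(T/\delta)\rceil,\quad m=m_1+m_2,$$ $$A_2=L\sqrt\epsilon+L\zeta\sqrt[4]{\frac{\log(1/\delta)}{m_1}}+BL\sqrt{\frac{\log(1/\delta)}{m_1}} .$$ The training data $(x_i,y_i)_{i=1}^{m_1}$ and the validation data $(a_i,b_i)_{i=1}^{m_2}$ are independent samples from $\mathcal D$. **Algorithm** (`Alphatron_with_Approx_Pre`), with parameters $\epsilon_K,\delta_K$ and learning rate $\lambda=1/L$. For each $x_i$, a data structure is built that samples an index $l$ with probability $x_{il}^2/\|x_i\|_2^2$. For all $i,j$, $z_{ij}$ is the median of $\lceil 6\log((m_1^2+m_1m_2)/\delta_K)\rceil$ means of $\lceil 9/(2e^2)\rceil$ samples each of $\|x_i\|_2^2\,x_{jl}/x_{il}$, where $e=\epsilon_K/(3d)$ (and $z_{ij}=0$ if $x_i=0$), and $\widetilde K_{ij}=\frac1{d+1}\sum_{k=0}^d z_{ij}^k$. In the same way $z'_{ij}$ and $\widetilde K'_{ij}$ are computed from $a_i$ and $x_j$. Starting from $\alpha^0=0\in\mathbb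 R^{m_1}$, put for $0\le t<T$ $$\alpha_i^{t+1}=\alpha_i^t+\frac{\lambda}{m_1}\Big(y_i-u\Big(\sum_{j=1}^{m_1}\alpha_j^t\widetilde K_{ij}\Big)\Big).$$ The output is $\alpha^{t_{\rm out}}$, where $t_{\rm out}$ is the first minimizer over $t\in\{0,\dots,T-1\}$ of $\frac1{m_2}\sum_{i=1}^{m_2}\big(u(\sum_j\alpha_j^t\widetilde K'_{ij})-b_i\big)^2$. It describes the hypothesis $h^{t_{\rm out}}(x)=u\big(\sum_{i=1}^{m_1}\alpha_i^{t_{\rm out}}\mathcal K_d(x,x_i)\big)$. Run time is the number of elementary steps of a randomized machine with exact real numbers, in which arithmetic operations, comparisons, evaluations of $u$, draws of uniform random numbers of $[0,1]$, and control and data movement steps have unit cost. The data structures are arrays of partial sums with binary search, and medians are found by merge sort. **Claim.** There are universal constants $C_0,C_0',c>0$ and $\kappa\in\mathbb N$ such that for all $C\ge C_0$ and $C'\ge C_0'$ there is a constant $C''>0$, depending only on $C$ and $C'$, such that the following holds in every setting as above with $L\sqrt\epsilon\le 1$, when $\epsilon_K=L\sqrt\epsilon/T$ and $\delta_K=\delta$.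 1. With probability at least $1-3\delta$ over the data and the randomness of the algorithm, $\varepsilon(h^{t_{\rm out}})\le C''A_2$. 2. On all training and validation data in $\mathbb B^n\times[0,1]$ and for all random choices, the algorithm makes at most $c\,g\,(\log(2+g))^{\kappa}$ steps, where $$g=mn+\frac{m^2d^2T^2}{L^2\epsilon}\log\frac1\delta+Tm^2;$$ that is, its run time is $\widetilde O\big(mn+\frac{m^2d^2T^2}{L^2\epsilon}\log\frac1\delta+Tm^2\big)$. -/

import Mathlib

open MeasureTheory

namespace Alphatron

noncomputable section

/-! ### A randomized real-number random access machine with a step count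

Real numbers are stored exactly and every elementary step has unit cost: an arithmetic operation
(with its reads and writes of memory), a comparison, an evaluation of the function `u` that is part
of the input, a draw of a uniformly random number of `[0, 1]`, and a step of integer index
arithmetic, loop control or data movement. -/

/-- The arithmetic operations of the machine. -/
inductive ArithOp : Type
  | plus
  | minus
  | times
  | divide

/-- The value of an arithmetic operation. -/
def ArithOp.eval : ArithOp → ℝ → ℝ → ℝ
  | .plus, x, y => x + y
  | .minus, x, y => x - y
  | .times, x, y => x * y
  | .divide, x, y => x / y

/-- Programs with result type `α`. Each constructor other than `ret` is one elementary step,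
followed by the continuation of the program on the result of the step. -/
inductive Prog (α : Type) : Type
  | ret (a : α) : Prog α
  | arith (o : ArithOp) (x y : ℝ) (next : ℝ → Prog α) : Prog α
  | compare (x y : ℝ) (next : Bool → Prog α) : Prog α
  | query (x : ℝ) (next : ℝ → Prog α) : Prog α
  | draw (next : unitInterval → Prog α) : Prog α
  | control (next : Prog α) : Prog α

namespace Prog

/-- Sequential composition. -/
def bind {α β : Type} : Prog α → (α → Prog β) → Prog β
  | ret a, f => f a
  | arith o x y next, f => arith o x y fun r => bind (next r) f
  | compare x y next, f => compare x y fun r => bind (next r) f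
  | query x next, f => query x fun r => bind (next r) f
  | draw next, f => draw fun r => bind (next r) f
  | control next, f => control (bind next f)

instance : Monad Prog where
  pure := ret
  bind := bind

/-- The outcome of a run: the result, the number of elementary steps, and the part of the random
tape that has not been read. -/
structure Outcome (α : Type) where
  value : α
  steps : ℕ
  tape : ℕ → unitInterval

/-- One more step. -/
def Outcome.charge {α : Type} (r : Outcome α) : Outcome α :=
  ⟨r.value, r.steps + 1, r.tape⟩

/-- Execution of a program with the function `u` on a random tape. A comparison of `x` with `y`
tests whether `x < y`; each draw reads the next cell of the tape. -/
def exec (u : ℝ → ℝ) {α : Type} : Prog α → (ℕ → unitInterval) → Outcome α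
  | ret a, ω => ⟨a, 0, ω⟩
  | arith o x y next, ω => (exec u (next (o.eval x y)) ω).charge
  | compare x y next, ω =>
      (exec u (next (@decide (x < y) (Classical.propDecidable _))) ω).charge
  | query x next, ω => (exec u (next (u x)) ω).charge
  | draw next, ω => (exec u (next (ω 0)) fun i => ω (i + 1)).charge
  | control next, ω => (exec u next ω).charge

def plus (x y : ℝ) : Prog ℝ := arith .plus x y ret
def minus (x y : ℝ) : Prog ℝ := arith .minus x y ret
def times (x y : ℝ) : Prog ℝ := arith .times x y ret
def divide (x y : ℝ) : Prog ℝ := arith .divide x y ret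
def less (x y : ℝ) : Prog Bool := compare x y ret
def apply (x : ℝ) : Prog ℝ := query x ret
def uniform : Prog unitInterval := draw ret

/-- `c` steps of loop control or data movement. -/
def spend : ℕ → Prog Unit
  | 0 => ret ()
  | c + 1 => control (spend c)

/-- Fill an array: run `f 0`, ..., `f (m - 1)` in this order and store the results. -/
def tabulate {α : Type} : (m : ℕ) → (Fin m → Prog α) → Prog (Fin m → α)
  | 0, _ => pure Fin.elim0
  | m + 1, f => do
      spend 1
      let a ← f 0
      let t ← tabulate m fun i => f i.succ
      pure (Fin.cons a t)

/-- Run the same program `k` times and list the results. -/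
def repeated {α : Type} : ℕ → Prog α → Prog (List α)
  | 0, _ => pure []
  | k + 1, p => do
      spend 1
      let a ← p
      let t ← repeated k p
      pure (a :: t)

/-- Run `f 0`, ..., `f (m - 1)` in this order and sum up the results. -/
def total : (m : ℕ) → (Fin m → Prog ℝ) → Prog ℝ
  | 0, _ => pure 0
  | m + 1, f => do
      spend 1
      let a ← f 0
      let t ← total m fun i => f i.succ
      plus a t

/-- The inner product of two arrays, computed exactly. -/
def dot {m : ℕ} (v w : Fin m → ℝ) : Prog ℝ := total m fun i => times (v i) (w i)

/-- Merge two sorted lists. -/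
def merge : List ℝ → List ℝ → Prog (List ℝ)
  | [], l => pure l
  | a :: s, [] => pure (a :: s)
  | a :: s, b :: t => do
      spend 1
      let c ← less b a
      if c then
        let r ← merge (a :: s) t
        pure (b :: r)
      else
        let r ← merge s (b :: t)
        pure (a :: r)
termination_by l l' => l.length + l'.length

/-- Merge sort. Splitting a list is charged with its length. -/
def sort (l : List ℝ) : Prog (List ℝ) :=
  if _h : l.length ≤ 1 then do
    spend 1
    pure l
  else do
    spend l.length
    let s ← sort (l.take (l.length / 2))
    let t ← sort (l.drop (l.length / 2))
    merge s t
termination_by l.length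
decreasing_by
  · simp only [List.length_take]; omega
  · simp only [List.length_drop]; omega

/-- The median of a list, by sorting. -/
def median (l : List ℝ) : Prog ℝ := do
  let s ← sort l
  spend 1
  pure (s.getD (l.length / 2) 0)

end Prog

open Prog

/-! ### Sampling an index with probability proportional to the squared entry -/

/-- The entry of an array at an index. -/
def entry {n : ℕ} (w : Fin n → ℝ) (j : ℕ) : ℝ := if h : j < n then w ⟨j, h⟩ else 0

/-- The sampling data structure of a vector: the vector `vec`, the sums `cum j` of the squares of
its entries up to the index `j`, and the squared norm `sqNorm`. -/
structure SQ2 (n : ℕ) where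
  vec : Fin n → ℝ
  cum : Fin n → ℝ
  sqNorm : ℝ

/-- The partial sums `acc + w 0 ^ 2 + ... + w j ^ 2` for all `j`, and the last of them. -/
def squareSums : (n : ℕ) → (Fin n → ℝ) → ℝ → Prog ((Fin n → ℝ) × ℝ)
  | 0, _, acc => pure (Fin.elim0, acc)
  | n + 1, w, acc => do
      spend 1
      let q ← times (w 0) (w 0)
      let s ← plus acc q
      let r ← squareSums n (fun i => w i.succ) s
      pure (Fin.cons s r.1, r.2)

/-- Construction of the sampling data structure. -/
def prepare {n : ℕ} (w : Fin n → ℝ) : Prog (SQ2 n) := do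
  let r ← squareSums n w 0
  pure ⟨w, r.1, r.2⟩

/-- Binary search for the least index `j` in `lo, ..., lo + len` with `x < cum j`, where
`lo + len` is returned if no earlier index has this property. -/
def bisect {n : ℕ} (cum : Fin n → ℝ) (x : ℝ) (len lo : ℕ) : Prog ℕ :=
  if _h : len = 0 then pure lo
  else do
    spend 1
    let c ← less x (entry cum (lo + len / 2))
    if c then bisect cum x (len / 2) lo
    else bisect cum x (len - len / 2 - 1) (lo + len / 2 + 1)
termination_by len
decreasing_by all_goals omega

/-- One sample of an index: `j` with probability `vec j ^ 2 / sqNorm`. -/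
def sampleIndex {n : ℕ} (S : SQ2 n) : Prog ℕ := do
  let r ← uniform
  let x ← times r S.sqNorm
  bisect S.cum x (n - 1) 0

/-- One sample of `‖w‖² v_j / w_j`, where `w` is the vector of the data structure. -/
def sampleProduct {n : ℕ} (S : SQ2 n) (v : Fin n → ℝ) : Prog ℝ := do
  let j ← sampleIndex S
  let p ← times S.sqNorm (entry v j)
  divide p (entry S.vec j)

/-- Estimate of the inner product of the vector of the data structure with `v`: the median of
`k` means of `N` samples. It is `0` if the vector of the data structure is zero. -/
def estimateInner {n : ℕ} (N k : ℕ) (S : SQ2 n) (v : Fin n → ℝ) : Prog ℝ := do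
  let c ← less 0 S.sqNorm
  if c then
    let l ← repeated k (do
      let s ← total N fun _ => sampleProduct S v
      divide s N)
    median l
  else pure 0

/-- For vectors of norm at most one: the number of samples in each mean for the accuracy `e`. -/
def meanSize (e : ℝ) : ℕ := ⌈9 / (2 * e ^ 2)⌉₊

/-- The number of means for the failure probability `p`. -/
def numMeans (p : ℝ) : ℕ := ⌈6 * Real.log (1 / p)⌉₊

/-! ### The algorithm -/

/-- `1 + z + ... + z ^ d` by Horner's rule. -/
def geomSum : ℕ → ℝ → Prog ℝ
  | 0, _ => pure 1
  | d + 1, z => do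
      spend 1
      let p ← geomSum d z
      let q ← times z p
      plus q 1

/-- `(1 + z + ... + z ^ d) / (d + 1)`. -/
def kernelOfInner (d : ℕ) (z : ℝ) : Prog ℝ := do
  let s ← geomSum d z
  divide s (d + 1)

/-- One update `α_i ← α_i + (lam / m₁) (y_i - u (∑ j, α_j K_ij))` of all coefficients. -/
def update {m₁ : ℕ} (lam : ℝ) (y : Fin m₁ → ℝ) (K : Fin m₁ → Fin m₁ → ℝ) (α : Fin m₁ → ℝ) :
    Prog (Fin m₁ → ℝ) :=
  tabulate m₁ fun i => do
    let s ← dot α (K i)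
    let g ← apply s
    let r ← minus (y i) g
    let c ← divide lam m₁
    let e ← times c r
    plus (α i) e

/-- The training loop: `T` updates from `α`; it returns the vectors before each of them. -/
def train {m₁ : ℕ} (lam : ℝ) (y : Fin m₁ → ℝ) (K : Fin m₁ → Fin m₁ → ℝ) :
    ℕ → (Fin m₁ → ℝ) → Prog (List (Fin m₁ → ℝ))
  | 0, _ => pure []
  | T + 1, α => do
      spend 1
      let β ← update lam y K α
      let l ← train lam y K T β
      pure (α :: l)

/-- The validation error `(1 / m₂) ∑ i, (u (∑ j, α_j K'_ij) - b_i) ^ 2`. -/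
def validationError {m₁ m₂ : ℕ} (b : Fin m₂ → ℝ) (K' : Fin m₂ → Fin m₁ → ℝ) (α : Fin m₁ → ℝ) :
    Prog ℝ := do
  let s ← total m₂ fun i => do
    let s ← dot α (K' i)
    let g ← apply s
    let r ← minus g (b i)
    times r r
  divide s m₂

/-- Search for the first vector of smallest validation error; `best` is the best one so far and
`err` is its error. -/
def selectFrom {m₁ m₂ : ℕ} (b : Fin m₂ → ℝ) (K' : Fin m₂ → Fin m₁ → ℝ) :
    (best : Fin m₁ → ℝ) → (err : ℝ) → List (Fin m₁ → ℝ) → Prog (Fin m₁ → ℝ)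
  | best, _, [] => pure best
  | best, err, α :: l => do
      spend 1
      let e ← validationError b K' α
      let c ← less e err
      if c then selectFrom b K' α e l else selectFrom b K' best err l

/-- The first vector of smallest validation error in a list. -/
def select {m₁ m₂ : ℕ} (b : Fin m₂ → ℝ) (K' : Fin m₂ → Fin m₁ → ℝ) :
    List (Fin m₁ → ℝ) → Prog (Fin m₁ → ℝ)
  | [] => pure 0
  | α :: l => do
      let e ← validationError b K' α
      selectFrom b K' α e l

/-- `Alphatron_with_Kernel`. -/
def alphatronWithKernel {m₁ m₂ : ℕ} (T : ℕ) (lam : ℝ) (y : Fin m₁ → ℝ) (b : Fin m₂ → ℝ)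
    (K : Fin m₁ → Fin m₁ → ℝ) (K' : Fin m₂ → Fin m₁ → ℝ) : Prog (Fin m₁ → ℝ) := do
  let l ← train lam y K T 0
  select b K' l

/-- `Alphatron_with_Approx_Pre`, with error tolerance `εK` and failure probability `δK`, on the
training data `(x, y)` and the validation data `(a, b)`. -/
def alphatronWithApproxPre {n m₁ m₂ : ℕ} (d T : ℕ) (lam εK δK : ℝ)
    (x : Fin m₁ → Fin n → ℝ) (y : Fin m₁ → ℝ) (a : Fin m₂ → Fin n → ℝ) (b : Fin m₂ → ℝ) :
    Prog (Fin m₁ → ℝ) := do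
  let N := meanSize (εK / (3 * d))
  let k := numMeans (δK / (m₁ ^ 2 + m₁ * m₂))
  let K ← tabulate m₁ fun i => do
    let S ← prepare (x i)
    tabulate m₁ fun j => do
      let z ← estimateInner N k S (x j)
      kernelOfInner d z
  let K' ← tabulate m₂ fun i => do
    let S ← prepare (a i)
    tabulate m₁ fun j => do
      let z ← estimateInner N k S (x j)
      kernelOfInner d z
  alphatronWithKernel T lam y b K K'

/-! ### The learning problem -/

/-- Labelled examples: points of the closed unit ball of `ℝⁿ` with a label in `[0, 1]`. -/
abbrev Example (n : ℕ) : Type :=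
  Metric.closedBall (0 : EuclideanSpace ℝ (Fin n)) 1 × unitInterval

/-- The normalized feature map of degree `d`: its coordinates are indexed by the tuples
`(k₁, ..., k_i)` of indices with `0 ≤ i ≤ d`. -/
def featureMap {n : ℕ} (d : ℕ) (x : EuclideanSpace ℝ (Fin n)) :
    EuclideanSpace ℝ (Σ i : Fin (d + 1), (Fin (i : ℕ) → Fin n)) :=
  WithLp.toLp 2 fun k => (1 / √((d : ℝ) + 1)) * ∏ j, x (k.2 j)

/-- The normalized multinomial kernel of degree `d`. -/
def kernel {n : ℕ} (d : ℕ) (x y : EuclideanSpace ℝ (Fin n)) : ℝ :=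
  inner ℝ (featureMap d x) (featureMap d y)

/-- The concept `x ↦ u (⟨v, ψ_d x⟩ + ξ x)`. -/
def concept {n d : ℕ} (u : ℝ → ℝ)
    (v : EuclideanSpace ℝ (Σ i : Fin (d + 1), (Fin (i : ℕ) → Fin n)))
    (ξ : EuclideanSpace ℝ (Fin n) → ℝ) (x : EuclideanSpace ℝ (Fin n)) : ℝ :=
  u (inner ℝ v (featureMap d x) + ξ x)

/-- The distribution `D` on the examples belongs to the concept class with the parameters
`B, L, ζ, ε`, by means of the `L`-Lipschitz non-decreasing function `u : ℝ → [0, 1]`, the vector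
`v` and the noise function `ξ`. -/
structure InConceptClass {n d : ℕ} (B L ζ ε : ℝ) (u : ℝ → ℝ)
    (v : EuclideanSpace ℝ (Σ i : Fin (d + 1), (Fin (i : ℕ) → Fin n)))
    (ξ : EuclideanSpace ℝ (Fin n) → ℝ) (D : Measure (Example n)) : Prop where
  range_u : ∀ s, u s ∈ Set.Icc (0 : ℝ) 1
  lipschitz_u : ∀ s t, |u s - u t| ≤ L * |s - t|
  monotone_u : Monotone u
  norm_v : ‖v‖ ≤ B
  measurable_noise : Measurable ξ
  noise_range : ∀ x, ξ x ∈ Set.Icc (-ζ) ζ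
  noise_sq : ∫ p, ξ p.1 ^ 2 ∂D ≤ ε
  regression : D[fun p => (p.2 : ℝ) | MeasurableSpace.comap Prod.fst inferInstance]
    =ᵐ[D] fun p => concept u v ξ p.1

/-- The generalization error of the hypothesis `h` for the concept `c`. -/
def generalizationError {n : ℕ} (D : Measure (Example n))
    (c h : EuclideanSpace ℝ (Fin n) → ℝ) : ℝ :=
  ∫ p, (h p.1 - c p.1) ^ 2 ∂D

/-- The hypothesis `x ↦ u (∑ i, α_i K_d(x, x_i))` described by the coefficients `α`, where the
`x_i` are the points of the training set `S`. -/
def hypothesis {n m₁ : ℕ} (u : ℝ → ℝ) (d : ℕ) (S : Fin m₁ → Example n) (α : Fin m₁ → ℝ)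
    (x : EuclideanSpace ℝ (Fin n)) : ℝ :=
  u (∑ i, α i * kernel d x (S i).1)

/-- The run of `Alphatron_with_Approx_Pre` on a training set `S`, a validation set `V` and a random
tape `ω`. -/
def runApproxPre {n m₁ m₂ : ℕ} (u : ℝ → ℝ) (d T : ℕ) (lam εK δK : ℝ)
    (S : Fin m₁ → Example n) (V : Fin m₂ → Example n) (ω : ℕ → unitInterval) :
    Outcome (Fin m₁ → ℝ) :=
  exec u
    (alphatronWithApproxPre d T lam εK δK
      (fun i k => (S i).1.1 k) (fun i => (S i).2) (fun i k => (V i).1.1 k) (fun i => (V i).2)) ω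

/-- Independent samples: `m₁` training examples and `m₂` validation examples from `D`, and a tape of
uniformly random numbers of `[0, 1]`. -/
def sampleLaw {n : ℕ} (D : Measure (Example n)) (m₁ m₂ : ℕ) :
    Measure ((Fin m₁ → Example n) × (Fin m₂ → Example n) × (ℕ → unitInterval)) :=
  (Measure.pi fun _ => D).prod
    ((Measure.pi fun _ => D).prod (Measure.infinitePi fun _ => (volume : Measure unitInterval)))

/-- The error bound `A₂`. -/
def errorBound (B L ζ ε δ : ℝ) (m₁ : ℕ) : ℝ :=
  L * √ε + L * ζ * (Real.log (1 / δ) / m₁) ^ (1 / 4 : ℝ) + B * L * √(Real.log (1 / δ) / m₁)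

/-- The expression `m n + (m² d² T² / (L² ε)) log (1 / δ) + T m²`. -/
def costBound (m n d T : ℕ) (L ε δ : ℝ) : ℝ :=
  m * n + (m : ℝ) ^ 2 * d ^ 2 * T ^ 2 / (L ^ 2 * ε) * Real.log (1 / δ) + T * (m : ℝ) ^ 2

end

end Alphatron

open Alphatron

/-! Training is a descent in feature space. Put `w t = ∑ i, α_i^t ψ_d(x_i)`. One update adds `1 / L`
times the average of `(y_i - u(s_i)) ψ_d(x_i)`, where `s_i` approximates `⟨w t, ψ_d(x_i)⟩`. As `u`
is monotone and `L`-Lipschitz, `(u a - u b)(a - b) ≥ (u a - u b)² / L`, so a large empirical error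
forces `‖w t - v‖²` to drop (`norm_step_sq_le`). This squared distance starts at most `B²`, so
within `T` steps some empirical error is of order `B² L² / T` plus perturbations
(`exists_training_error_le`). The perturbations come from the labels, from `ξ` and from the
approximate kernel. Since `|α_j^t| ≤ t / (L m₁)`, kernel accuracy `L √ε / T` moves the inner
products by at most `√ε`.

Three events, each failing with probability at most `δ`, suffice. (1) The training set is good: the
label noise averages out in feature space, the mean of `ξ²` is near its expectation, and empirical
and true errors are close uniformly on the ball of radius `B` around `v`
(`InConceptClass.measure_not_goodTraining_le`). Both vector statements are free of the dimension.
Sums of vectors are controlled through `cosh` of the norm (`cosh_norm_add_le`). For the ball,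
symmetrization and contraction are applied to the exponential moment of the supremum, which ends in
the same `cosh` estimate (`lintegral_supExp_pi_le`). (2) All kernel entries are accurate
(`tapeLaw_grams_le`): a sample has expectation `⟨x, y⟩` and second moment at most `1`, so Chebyshev
bounds the failure of a mean by `2 / 9`, a Chernoff bound for the median gives probability `q`, and
a union bound follows. (3) Validation ranks the iterates correctly. The excess square loss has
second moment at most four times its mean, so Bernstein gives an error of order `log(T / δ) / m₂`,
without a square root (`measure_excess_loss_le`). Here the iterates depend on the training set and
the tape but not on the validation set.

What remains of the error besides the terms of `A₂` is a multiple of `s²`, with `s = √(log(1 / δ) /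
m₁)`. If `T > 1`, then `s < C B L` absorbs it. If `T = 1`, then `B L ≤ s` and the constant initial
hypothesis is already good.

Programs are handled by three calculi: `Returns` for deterministic parts, `Costs` for worst-case
step counts and `wp` for expectations, tied to the tape by `tapeLaw_exec`. The run time is dominated
by `m₁ (m₁ + m₂)` entries, each the median of `O(log(m / δ))` means of `O(d² T² / (L² ε))` samples.
-/

namespace Alphatron

open Prog
open scoped ENNReal

noncomputable section

/-! ### Semantics of programs -/

section Semantics

variable {α β X : Type} (u : ℝ → ℝ)

/-- The law of the random tape. -/
def tapeLaw : Measure (ℕ → unitInterval) :=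
  Measure.infinitePi fun _ => (volume : Measure unitInterval)

instance : IsProbabilityMeasure tapeLaw := by unfold tapeLaw; infer_instance

/-- The continuation runs on the cells that the first program left unread. Cost bounds and
measurability of composite programs rest on this identity. -/
theorem exec_bind (p : Prog α) (f : α → Prog β) (ω : ℕ → unitInterval) :
    exec u (p >>= f) ω =
      ⟨(exec u (f (exec u p ω).value) (exec u p ω).tape).value,
        (exec u p ω).steps + (exec u (f (exec u p ω).value) (exec u p ω).tape).steps,
        (exec u (f (exec u p ω).value) (exec u p ω).tape).tape⟩ := by
  change exec u (Prog.bind p f) ω = _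
  induction p generalizing ω with
  | ret a => simp [Prog.bind, exec]
  | arith o x y next ih => simp [Prog.bind, exec, ih, Outcome.charge]; omega
  | compare x y next ih => simp [Prog.bind, exec, ih, Outcome.charge]; omega
  | query x next ih => simp [Prog.bind, exec, ih, Outcome.charge]; omega
  | draw next ih => simp [Prog.bind, exec, ih, Outcome.charge]; omega
  | control next ih => simp [Prog.bind, exec, ih, Outcome.charge]; omega

/-- `p` draws no random numbers and has the result `b`. -/
def Returns : Prog α → α → Prop
  | ret a, b => a = b
  | arith o x y next, b => Returns (next (o.eval x y)) b
  | .compare x y next, b => Returns (next (@decide (x < y) (Classical.propDecidable _))) b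
  | query x next, b => Returns (next (u x)) b
  | draw _, _ => False
  | .control next, b => Returns next b

variable {u}

theorem Returns.bind {p : Prog α} {f : α → Prog β} {a : α} {b : β} (hp : Returns u p a)
    (hf : Returns u (f a) b) : Returns u (p >>= f) b := by
  change Returns u (Prog.bind p f) b
  induction p with
  | ret a' => cases hp; exact hf
  | arith o x y next ih => exact ih _ hp
  | compare x y next ih => exact ih _ hp
  | query x next ih => exact ih _ hp
  | draw next ih => exact hp.elim
  | control next ih => exact ih hp

theorem Returns.value_tape {p : Prog α} {a : α} (hp : Returns u p a) (ω : ℕ → unitInterval) :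
    (exec u p ω).value = a ∧ (exec u p ω).tape = ω := by
  induction p generalizing ω with
  | ret a' => exact ⟨hp, rfl⟩
  | arith o x y next ih => exact ih _ hp ω
  | compare x y next ih => exact ih _ hp ω
  | query x next ih => exact ih _ hp ω
  | draw next ih => exact hp.elim
  | control next ih => exact ih hp ω

theorem returns_plus (x y : ℝ) : Returns u (plus x y) (x + y) := rfl
theorem returns_minus (x y : ℝ) : Returns u (minus x y) (x - y) := rfl
theorem returns_times (x y : ℝ) : Returns u (times x y) (x * y) := rfl
theorem returns_divide (x y : ℝ) : Returns u (divide x y) (x / y) := rfl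
theorem returns_less (x y : ℝ) :
    Returns u (less x y) (@decide (x < y) (Classical.propDecidable _)) := rfl
theorem returns_apply (x : ℝ) : Returns u (Prog.apply x) (u x) := rfl

theorem returns_spend (c : ℕ) : Returns u (spend c) () := by
  induction c with
  | zero => rfl
  | succ c ih => exact ih

theorem Returns.tabulate {m : ℕ} {f : Fin m → Prog α} {g : Fin m → α}
    (h : ∀ i, Returns u (f i) (g i)) : Returns u (tabulate m f) g := by
  induction m with
  | zero => exact Subsingleton.elim _ _
  | succ m ih =>
    refine (returns_spend 1).bind ((h 0).bind ((ih fun i => h i.succ).bind ?_))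
    exact Fin.cons_self_tail g

theorem Returns.total {m : ℕ} {f : Fin m → Prog ℝ} {g : Fin m → ℝ}
    (h : ∀ i, Returns u (f i) (g i)) : Returns u (total m f) (∑ i, g i) := by
  induction m with
  | zero => exact (Finset.sum_empty).symm
  | succ m ih =>
    refine (returns_spend 1).bind ((h 0).bind ((ih fun i => h i.succ).bind ?_))
    rw [Fin.sum_univ_succ]; exact returns_plus _ _

theorem returns_dot {m : ℕ} (v w : Fin m → ℝ) : Returns u (dot v w) (∑ i, v i * w i) :=
  Returns.total fun _ => returns_times _ _

/-! #### Step counts -/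

variable (u) in
/-- Every run of `p` takes at most `b` steps and its result satisfies `Q`. -/
def Costs (p : Prog α) (b : ℕ) (Q : α → Prop) : Prop :=
  ∀ ω, (exec u p ω).steps ≤ b ∧ Q (exec u p ω).value

theorem Costs.bind {p : Prog α} {f : α → Prog β} {b c : ℕ} {Q : α → Prop} {R : β → Prop}
    (hp : Costs u p b Q) (hf : ∀ a, Q a → Costs u (f a) c R) :
    Costs u (p >>= f) (b + c) R := by
  intro ω
  rw [exec_bind]
  have h1 := hp ω
  have h2 := hf _ h1.2 (exec u p ω).tape
  exact ⟨Nat.add_le_add h1.1 h2.1, h2.2⟩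

theorem Costs.mono {p : Prog α} {b c : ℕ} {Q : α → Prop} (hp : Costs u p b Q) (h : b ≤ c) :
    Costs u p c Q := fun ω => ⟨(hp ω).1.trans h, (hp ω).2⟩

/-- Hands the known result of a deterministic program to the continuation, whose cost bound may
depend on it, such as the lengths of the sorted halves. -/
theorem Costs.and_returns {p : Prog α} {b : ℕ} {Q : α → Prop} {a : α} (hp : Costs u p b Q)
    (h : Returns u p a) : Costs u p b (fun r => r = a) :=
  fun ω => ⟨(hp ω).1, (h.value_tape ω).1⟩

theorem costs_pure {a : α} {Q : α → Prop} (h : Q a) : Costs u (pure a : Prog α) 0 Q :=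
  fun _ => ⟨le_rfl, h⟩
theorem costs_plus (x y : ℝ) : Costs u (plus x y) 1 fun _ => True := fun _ => ⟨le_rfl, trivial⟩
theorem costs_minus (x y : ℝ) : Costs u (minus x y) 1 fun _ => True := fun _ => ⟨le_rfl, trivial⟩
theorem costs_times (x y : ℝ) : Costs u (times x y) 1 fun _ => True := fun _ => ⟨le_rfl, trivial⟩
theorem costs_divide (x y : ℝ) : Costs u (divide x y) 1 fun _ => True := fun _ => ⟨le_rfl, trivial⟩
theorem costs_less (x y : ℝ) : Costs u (less x y) 1 fun _ => True := fun _ => ⟨le_rfl, trivial⟩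
theorem costs_apply (x : ℝ) : Costs u (Prog.apply x) 1 fun _ => True := fun _ => ⟨le_rfl, trivial⟩
theorem costs_uniform : Costs u uniform 1 fun _ => True := fun _ => ⟨le_rfl, trivial⟩

theorem costs_spend (c : ℕ) : Costs u (spend c) c fun _ => True := by
  induction c with
  | zero => exact fun _ => ⟨le_rfl, trivial⟩
  | succ c ih => exact fun ω => ⟨Nat.succ_le_succ (ih ω).1, trivial⟩

theorem Costs.ite {p q : Prog α} {b : ℕ} {Q : α → Prop} {c : Bool} (hp : Costs u p b Q)
    (hq : Costs u q b Q) : Costs u (if c then p else q) b Q := by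
  cases c
  · exact hq
  · exact hp

theorem Costs.tabulate {m b : ℕ} {f : Fin m → Prog α}
    (h : ∀ i, Costs u (f i) b fun _ => True) :
    Costs u (tabulate m f) (m * (b + 1)) fun _ => True := by
  induction m with
  | zero => exact (costs_pure trivial).mono (Nat.zero_le _)
  | succ m ih =>
    refine Costs.mono ((costs_spend 1).bind fun _ _ => (h 0).bind fun _ _ =>
      (ih fun i => h i.succ).bind fun _ _ => costs_pure trivial) ?_
    rw [Nat.add_mul]; omega

theorem Costs.total {m b : ℕ} {f : Fin m → Prog ℝ} (h : ∀ i, Costs u (f i) b fun _ => True) :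
    Costs u (total m f) (m * (b + 2)) fun _ => True := by
  induction m with
  | zero => exact (costs_pure trivial).mono (Nat.zero_le _)
  | succ m ih =>
    refine Costs.mono ((costs_spend 1).bind fun _ _ => (h 0).bind fun _ _ =>
      (ih fun i => h i.succ).bind fun _ _ => costs_plus _ _) ?_
    rw [Nat.add_mul]; omega

theorem Costs.repeated {k b : ℕ} {p : Prog α} (h : Costs u p b fun _ => True) :
    Costs u (repeated k p) (k * (b + 1)) fun l => l.length = k := by
  induction k with
  | zero => exact (costs_pure (Q := fun l : List α => l.length = 0) rfl).mono (Nat.zero_le _)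
  | succ k ih =>
    refine Costs.mono ((costs_spend 1).bind fun _ _ => h.bind fun _ _ =>
      ih.bind fun _ hl => costs_pure (by simp [hl])) ?_
    rw [Nat.add_mul]; omega

/-! #### Expectations -/

variable (u) in
/-- The expectation of `F` at the result of a program. -/
def wp : Prog α → (α → ℝ≥0∞) → ℝ≥0∞
  | ret a, F => F a
  | arith o x y next, F => wp (next (o.eval x y)) F
  | .compare x y next, F => wp (next (@decide (x < y) (Classical.propDecidable _))) F
  | query x next, F => wp (next (u x)) F
  | draw next, F => ∫⁻ r, wp (next r) F
  | .control next, F => wp next F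

/-- `wp` integrates arbitrary functions, so composition needs no measurability. The rules below keep
to monotonicity, constant summands and finite constant factors, which remain valid for nonmeasurable
integrands. -/
theorem wp_bind (p : Prog α) (f : α → Prog β) (F : β → ℝ≥0∞) :
    wp u (p >>= f) F = wp u p fun a => wp u (f a) F := by
  change wp u (Prog.bind p f) F = _
  induction p with
  | ret a => rfl
  | arith o x y next ih => exact ih _
  | compare x y next ih => exact ih _
  | query x next ih => exact ih _
  | draw next ih => exact lintegral_congr fun r => ih r
  | control next ih => exact ih

theorem wp_pure (a : α) (F : α → ℝ≥0∞) : wp u (pure a) F = F a := rfl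

theorem Returns.wp {p : Prog α} {a : α} (hp : Returns u p a) (F : α → ℝ≥0∞) :
    wp u p F = F a := by
  induction p with
  | ret a' => cases hp; rfl
  | arith o x y next ih => exact ih _ hp
  | compare x y next ih => exact ih _ hp
  | query x next ih => exact ih _ hp
  | draw next ih => exact hp.elim
  | control next ih => exact ih hp

theorem Returns.wp_bind {p : Prog α} {a : α} (hp : Returns u p a) (f : α → Prog β)
    (F : β → ℝ≥0∞) : Alphatron.wp u (p >>= f) F = Alphatron.wp u (f a) F := by
  rw [Alphatron.wp_bind, hp.wp]

theorem wp_mono (p : Prog α) {F G : α → ℝ≥0∞} (h : ∀ a, F a ≤ G a) : wp u p F ≤ wp u p G := by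
  induction p with
  | ret a => exact h a
  | arith o x y next ih => exact ih _
  | compare x y next ih => exact ih _
  | query x next ih => exact ih _
  | draw next ih => exact lintegral_mono fun r => ih r
  | control next ih => exact ih

theorem wp_add_const (p : Prog α) (F : α → ℝ≥0∞) (c : ℝ≥0∞) :
    wp u p (fun a => F a + c) = wp u p F + c := by
  induction p with
  | ret a => rfl
  | arith o x y next ih => exact ih _
  | compare x y next ih => exact ih _
  | query x next ih => exact ih _
  | draw next ih => simp [wp, ih, lintegral_add_right _ measurable_const]
  | control next ih => exact ih

theorem wp_const_mul (p : Prog α) (F : α → ℝ≥0∞) {c : ℝ≥0∞} (hc : c ≠ ∞) :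
    wp u p (fun a => c * F a) = c * wp u p F := by
  induction p with
  | ret a => rfl
  | arith o x y next ih => exact ih _
  | compare x y next ih => exact ih _
  | query x next ih => exact ih _
  | draw next ih => simp [wp, ih, lintegral_const_mul' _ _ hc]
  | control next ih => exact ih

/-- The union bound for the entries of an array. -/
theorem wp_tabulate_le {m : ℕ} (f : Fin m → Prog α) (F : Fin m → α → ℝ≥0∞) :
    wp u (tabulate m f) (fun t => ∑ i, F i (t i)) ≤ ∑ i, wp u (f i) (F i) := by
  induction m with
  | zero => simp [Prog.tabulate, wp_pure]
  | succ m ih =>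
    unfold Prog.tabulate
    rw [(returns_spend 1).wp_bind, wp_bind, Fin.sum_univ_succ]
    rw [← wp_add_const]
    refine wp_mono _ fun a => ?_
    simp only [wp_bind, wp_pure, Fin.sum_univ_succ, Fin.cons_zero, Fin.cons_succ]
    -- Once the first entry `a` is known, `F 0 a` is constant for the rest of the run and comes out
    -- of `wp`.
    simp only [add_comm (F 0 a), wp_add_const]
    gcongr
    exact ih (fun i => f i.succ) fun i => F i.succ

/-! #### The random tape -/

/-- A number followed by a tape. -/
def tapeCons (q : unitInterval × (ℕ → unitInterval)) : ℕ → unitInterval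
  | 0 => q.1
  | i + 1 => q.2 i

theorem measurable_tapeCons : Measurable tapeCons := by
  refine measurable_pi_lambda _ fun i => ?_
  cases i with
  | zero => exact measurable_fst
  | succ i => exact (measurable_pi_apply i).comp measurable_snd

theorem measurable_tail : Measurable fun (ω : ℕ → unitInterval) (i : ℕ) => ω (i + 1) :=
  measurable_pi_lambda _ fun i => measurable_pi_apply (i + 1)

/-- A product measure is determined by its values on boxes over finitely many cells, and the
preimage of a box is the constraint on cell `0` times the box of the shifted constraints. Thus one
draw can be split off the tape. -/
theorem map_tapeCons :
    ((volume : Measure unitInterval).prod tapeLaw).map tapeCons = tapeLaw := by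
  refine Measure.eq_infinitePi _ fun s t ht => ?_
  rw [Measure.map_apply measurable_tapeCons (MeasurableSet.pi s.countable_toSet fun i _ => ht i)]
  classical
  let s' : Finset ℕ := s.preimage Nat.succ (Nat.succ_injective.injOn)
  have : tapeCons ⁻¹' Set.pi s t =
      (if 0 ∈ s then t 0 else Set.univ) ×ˢ Set.pi s' fun i => t (i + 1) := by
    ext ⟨r, ω⟩
    simp only [Set.mem_preimage, Set.mem_pi, Set.mem_prod, s', Finset.coe_preimage,
      Finset.mem_coe]
    constructor
    · intro h
      refine ⟨?_, fun i hi => h (i + 1) hi⟩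
      split_ifs with h0
      · exact h 0 h0
      · trivial
    · rintro ⟨h0, h1⟩ i hi
      cases i with
      | zero => simpa [hi, tapeCons] using h0
      | succ i => exact h1 i hi
  rw [this, Measure.prod_prod, tapeLaw, Measure.infinitePi_pi _ fun i _ => ht (i + 1)]
  have h2 : ∏ i ∈ s', volume (t (i + 1)) = ∏ i ∈ s.erase 0, volume (t i) := by
    refine Finset.prod_bij (fun i _ => i + 1) ?_ ?_ ?_ ?_
    · intro i hi; simpa [s'] using hi
    · intro i _ j _ h; omega
    · intro j hj
      obtain ⟨hj0, hj⟩ := Finset.mem_erase.1 hj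
      obtain ⟨i, rfl⟩ := Nat.exists_eq_succ_of_ne_zero hj0
      exact ⟨i, by simpa [s'] using hj, rfl⟩
    · intro i _; rfl
  rw [h2]
  split_ifs with h0
  · exact Finset.mul_prod_erase s (fun i => volume (t i)) h0
  · rw [measure_univ, one_mul, Finset.erase_eq_of_notMem h0]

/-- The probability of an event is the expectation of its indicator. -/
theorem tapeLaw_exec (p : Prog α) (φ : Set α)
    (h : MeasurableSet {ω | (exec u p ω).value ∈ φ}) :
    tapeLaw {ω | (exec u p ω).value ∈ φ} = wp u p (φ.indicator 1) := by
  induction p with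
  | ret a =>
    by_cases ha : a ∈ φ <;> simp [exec, wp, ha]
  | arith o x y next ih => exact ih _ h
  | compare x y next ih => exact ih _ h
  | query x next ih => exact ih _ h
  | control next ih => exact ih h
  | draw next ih =>
    -- The drawn cell is independent of the remaining tape, so Fubini produces the integral in the
    -- definition of `wp`. This is the only case where measurability of the event matters.
    rw [← map_tapeCons, Measure.map_apply measurable_tapeCons h,
      Measure.prod_apply (measurable_tapeCons h)]
    refine lintegral_congr fun r => ?_
    exact ih r (measurable_prodMk_left (measurable_tapeCons h))

/-! #### Measurable dependence on parameters -/

variable [MeasurableSpace α] [MeasurableSpace β] [MeasurableSpace X]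

variable (u) in
/-- The result and the remaining tape depend measurably on the parameter and the tape. -/
def MeasurableProg (p : X → Prog α) : Prop :=
  Measurable fun q : X × (ℕ → unitInterval) =>
    ((exec u (p q.1) q.2).value, (exec u (p q.1) q.2).tape)

theorem MeasurableProg.bind {p : X → Prog α} {f : X → α → Prog β} (hp : MeasurableProg u p)
    (hf : MeasurableProg u fun q : X × α => f q.1 q.2) :
    MeasurableProg u fun x => p x >>= f x := by
  unfold MeasurableProg at *
  simp only [exec_bind]
  exact hf.comp ((measurable_fst.prodMk (measurable_fst.comp hp)).prodMk (measurable_snd.comp hp))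

/-- A deterministic first part needs no σ-algebra on its result type; only its composition with the
continuation has to be measurable. This covers results of type `Unit`, `Bool` and `SQ2 n`. -/
theorem MeasurableProg.returns_bind {γ : Type} {p : X → Prog γ} {a : X → γ} {f : X → γ → Prog β}
    (hp : ∀ x, Returns u (p x) (a x)) (hf : MeasurableProg u fun x => f x (a x)) :
    MeasurableProg u fun x => p x >>= f x := by
  unfold MeasurableProg at *
  simp only [exec_bind, ((hp _).value_tape _).1, ((hp _).value_tape _).2]
  exact hf

theorem MeasurableProg.of_returns {p : X → Prog α} {a : X → α}
    (hp : ∀ x, Returns u (p x) (a x)) (ha : Measurable a) : MeasurableProg u p := by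
  unfold MeasurableProg
  simp only [((hp _).value_tape _).1, ((hp _).value_tape _).2]
  exact (ha.comp measurable_fst).prodMk measurable_snd

theorem MeasurableProg.comp {Y : Type} [MeasurableSpace Y] {p : X → Prog α} {g : Y → X}
    (hp : MeasurableProg u p) (hg : Measurable g) : MeasurableProg u fun y => p (g y) :=
  Measurable.comp hp ((hg.comp measurable_fst).prodMk measurable_snd)

theorem MeasurableProg.ite {p q : X → Prog α} {c : X → Bool} (hc : Measurable c)
    (hp : MeasurableProg u p) (hq : MeasurableProg u q) :
    MeasurableProg u fun x => if c x then p x else q x := by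
  have := @Measurable.ite _ _ _ _ _ _ (fun r : X × (ℕ → unitInterval) => c r.1 = true)
    (fun _ => instDecidableEqBool _ _)
    ((hc.comp measurable_fst) (measurableSet_singleton true)) hp hq
  unfold MeasurableProg
  convert this using 2 with r
  dsimp only
  cases c r.1 <;> rfl

theorem measurableProg_uniform : MeasurableProg u fun _ : X => uniform :=
  ((measurable_pi_apply 0).comp measurable_snd).prodMk (measurable_tail.comp measurable_snd)

theorem MeasurableProg.tabulate {m : ℕ} {f : X → Fin m → Prog α}
    (h : ∀ i, MeasurableProg u fun x => f x i) :
    MeasurableProg u fun x => tabulate m (f x) := by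
  induction m with
  | zero => exact .of_returns (a := fun _ => Fin.elim0) (fun _ => rfl) measurable_const
  | succ m ih =>
    refine .returns_bind (fun _ => returns_spend 1) ((h 0).bind (.bind
      ((ih fun i => h i.succ).comp measurable_fst) (.of_returns (fun _ => rfl) ?_)))
    refine measurable_pi_lambda _ fun i => ?_
    cases i using Fin.cases with
    | zero => exact measurable_snd.comp measurable_fst
    | succ i => exact (measurable_pi_apply i).comp measurable_snd

theorem MeasurableProg.total {m : ℕ} {f : X → Fin m → Prog ℝ}
    (h : ∀ i, MeasurableProg u fun x => f x i) :
    MeasurableProg u fun x => total m (f x) := by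
  induction m with
  | zero => exact .of_returns (a := fun _ => 0) (fun _ => rfl) measurable_const
  | succ m ih =>
    refine .returns_bind (fun _ => returns_spend 1) ((h 0).bind (.bind
      ((ih fun i => h i.succ).comp measurable_fst) (.of_returns (fun _ => returns_plus _ _) ?_)))
    fun_prop

theorem measurable_decide_lt {f g : X → ℝ} (hf : Measurable f) (hg : Measurable g) :
    Measurable fun x => @decide (f x < g x) (Classical.propDecidable _) := by
  refine measurable_to_bool ?_
  convert measurableSet_lt hf hg using 1
  ext x; simp

end Semantics

end

end Alphatron

namespace Alphatron

open Prog
open scoped ENNReal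

noncomputable section

variable {u : ℝ → ℝ}

/-! ### Sorting and medians -/

theorem merge_spec (s t : List ℝ) :
    ∃ r, Returns u (merge s t) r ∧ r.Perm (s ++ t) ∧
      (s.Pairwise (· ≤ ·) → t.Pairwise (· ≤ ·) → r.Pairwise (· ≤ ·)) := by
  induction s, t using merge.induct with
  | case1 l => exact ⟨l, by rw [merge]; rfl, .refl _, fun _ h => h⟩
  | case2 a s => exact ⟨a :: s, by rw [merge]; rfl, by simp, fun h _ => h⟩
  | case3 a s b t ih1 ih2 =>
    by_cases hba : b < a
    · obtain ⟨r, h1, h2, h3⟩ := ih1 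
      refine ⟨b :: r, ?_, ?_, fun hs ht => ?_⟩
      · rw [merge]
        refine (returns_spend 1).bind ((returns_less b a).bind ?_)
        simp only [hba, decide_true, if_true]
        exact h1.bind rfl
      · exact (h2.cons b).trans (List.perm_middle (l₁ := a :: s)).symm
      · refine List.pairwise_cons.2 ⟨fun x hx => ?_, h3 hs (List.pairwise_cons.1 ht).2⟩
        rcases List.mem_append.1 (h2.mem_iff.1 hx) with hx | hx
        · rcases List.mem_cons.1 hx with rfl | hx
          · exact hba.le
          · exact hba.le.trans ((List.pairwise_cons.1 hs).1 x hx)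
        · exact (List.pairwise_cons.1 ht).1 x hx
    · obtain ⟨r, h1, h2, h3⟩ := ih2 
      refine ⟨a :: r, ?_, ?_, fun hs ht => ?_⟩
      · rw [merge]
        refine (returns_spend 1).bind ((returns_less b a).bind ?_)
        simp only [hba, decide_false]
        exact h1.bind rfl
      · exact h2.cons a
      · refine List.pairwise_cons.2 ⟨fun x hx => ?_, h3 (List.pairwise_cons.1 hs).2 ht⟩
        rcases List.mem_append.1 (h2.mem_iff.1 hx) with hx | hx
        · exact (List.pairwise_cons.1 hs).1 x hx
        · rcases List.mem_cons.1 hx with rfl | hx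
          · exact not_lt.1 hba
          · exact (not_lt.1 hba).trans ((List.pairwise_cons.1 ht).1 x hx)

theorem costs_merge (s t : List ℝ) :
    Costs u (merge s t) (2 * (s.length + t.length)) fun _ => True := by
  induction s, t using merge.induct with
  | case1 l => rw [merge]; exact (costs_pure trivial).mono (Nat.zero_le _)
  | case2 a s => rw [merge]; exact (costs_pure trivial).mono (Nat.zero_le _)
  | case3 a s b t ih1 ih2 =>
    rw [merge]
    refine Costs.mono ((costs_spend 1).bind fun _ _ => (costs_less b a).bind fun c _ => Costs.ite
      ((ih1.bind fun _ _ => costs_pure trivial).mono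
        (c := 2 * ((a :: s).length + t.length)) (by simp))
      ((ih2.bind fun _ _ => costs_pure trivial).mono (by simp; omega))) ?_
    simp; omega

theorem sort_spec (l : List ℝ) :
    ∃ r, Returns u (sort l) r ∧ r.Perm l ∧ r.Pairwise (· ≤ ·) := by
  induction l using sort.induct with
  | case1 l h =>
    refine ⟨l, ?_, .refl _, ?_⟩
    · rw [sort, dif_pos h]; exact (returns_spend 1).bind rfl
    · match l, h with
      | [], _ => exact .nil
      | [a], _ => exact List.pairwise_singleton _ _
  | case2 l h ih1 ih2 =>
    obtain ⟨s, hs1, hs2, hs3⟩ := ih1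
    obtain ⟨t, ht1, ht2, ht3⟩ := ih2
    obtain ⟨r, hr1, hr2, hr3⟩ := merge_spec (u := u) s t
    refine ⟨r, ?_, ?_, hr3 hs3 ht3⟩
    · rw [sort, dif_neg h]
      exact (returns_spend _).bind (hs1.bind (ht1.bind hr1))
    · have := hr2.trans (hs2.append ht2)
      rwa [List.take_append_drop] at this

/-- A sorted rearrangement of a list is unique, so the result of merge sort can be replaced by a
known sorted list. -/
theorem returns_sort (l : List ℝ) : Returns u (sort l) (l.insertionSort (· ≤ ·)) := by
  obtain ⟨r, h1, h2, h3⟩ := sort_spec (u := u) l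
  have : r = l.insertionSort (· ≤ ·) :=
    (h2.trans (List.perm_insertionSort _ l).symm).eq_of_pairwise
      (fun a b _ _ => le_antisymm) h3 (List.pairwise_insertionSort _ l)
  exact this ▸ h1

/-- `n - n / 2` is the larger half, which governs the depth of merge sort and of binary search. -/
theorem clog_two_of_two_le {n : ℕ} (h : 2 ≤ n) : Nat.clog 2 n = Nat.clog 2 (n - n / 2) + 1 := by
  rw [Nat.clog_of_two_le one_lt_two h]
  congr 2; omega

theorem costs_sort (l : List ℝ) :
    Costs u (sort l) (3 * l.length * Nat.clog 2 l.length + l.length + 1) fun _ => True := by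
  -- A level of the recursion costs `n` for splitting and `2 n` for merging. The summand `max n 1`
  -- pays for the leaves: even an empty list costs one step, and the two halves of a list of length
  -- `n ≥ 2` add up to exactly `n`.
  suffices h : Costs u (sort l) (3 * l.length * Nat.clog 2 l.length + max l.length 1)
      fun _ => True from h.mono (by omega)
  induction l using sort.induct with
  | case1 l h =>
    rw [sort, dif_pos h]
    exact ((costs_spend 1).bind fun _ _ => costs_pure trivial).mono (by omega)
  | case2 l h ih1 ih2 =>
    rw [sort, dif_neg h]
    obtain ⟨s, hs1, hs2, -⟩ := sort_spec (u := u) (l.take (l.length / 2))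
    obtain ⟨t, ht1, ht2, -⟩ := sort_spec (u := u) (l.drop (l.length / 2))
    have hm := costs_merge (u := u) s t
    rw [hs2.length_eq, ht2.length_eq] at hm
    refine Costs.mono ((costs_spend l.length).bind fun _ _ => (ih1.and_returns hs1).bind
      fun a ha => (ih2.and_returns ht1).bind fun b hb => by subst ha hb; exact hm) ?_
    simp only [List.length_take, List.length_drop]
    generalize l.length = n at h
    have h1 : min (n / 2) n = n / 2 := by omega
    rw [h1, clog_two_of_two_le (by omega : 2 ≤ n)]
    have h2 : Nat.clog 2 (n / 2) ≤ Nat.clog 2 (n - n / 2) := Nat.clog_mono_right 2 (by omega)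
    generalize Nat.clog 2 (n / 2) = x at *
    generalize Nat.clog 2 (n - n / 2) = y at *
    have h3 : 3 * (n / 2) * x ≤ 3 * (n / 2) * y := Nat.mul_le_mul le_rfl h2
    have h4 : 3 * (n / 2) * y + 3 * (n - n / 2) * y = 3 * n * y := by
      rw [← Nat.add_mul, ← Nat.mul_add]; congr 2; omega
    have h5 : max (n / 2) 1 + max (n - n / 2) 1 = n := by omega
    have h6 : n / 2 + (n - n / 2) = n := by omega
    rw [h6, Nat.mul_add]
    omega

/-- The median of a list: the entry at the middle position after sorting. -/
def medianValue (l : List ℝ) : ℝ := (l.insertionSort (· ≤ ·)).getD (l.length / 2) 0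

theorem returns_median (l : List ℝ) : Returns u (median l) (medianValue l) :=
  (returns_sort l).bind ((returns_spend 1).bind rfl)

theorem costs_median (l : List ℝ) :
    Costs u (median l) (3 * l.length * Nat.clog 2 l.length + l.length + 2) fun _ => True :=
  ((costs_sort l).bind fun _ _ => (costs_spend 1).bind fun _ _ => costs_pure trivial).mono
    (by omega)

/-- In a sorted list the entries at most `c` form an initial segment. -/
theorem getD_le_iff_lt_countP {l : List ℝ} (hl : l.Pairwise (· ≤ ·)) {i : ℕ} (hi : i < l.length)
    (c : ℝ) : l.getD i 0 ≤ c ↔ i < l.countP fun x => decide (x ≤ c) := by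
  induction l generalizing i with
  | nil => simp at hi
  | cons a l ih =>
    obtain ⟨h1, h2⟩ := List.pairwise_cons.1 hl
    by_cases hac : a ≤ c
    · rw [List.countP_cons_of_pos (by simpa using hac)]
      cases i with
      | zero => simpa using hac
      | succ i => simpa using ih h2 (by simpa using hi)
    · rw [List.countP_cons_of_neg (by simpa using hac), (List.countP_eq_zero).2]
      · simp only [not_lt_zero, iff_false, not_le]
        cases i with
        | zero => simpa using hac
        | succ i =>
          have hi' : i < l.length := by simpa using hi
          refine (not_le.1 hac).trans_le ?_
          rw [List.getD_cons_succ, List.getD_eq_getElem _ _ hi']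
          exact h1 _ (List.getElem_mem hi')
      · intro x hx
        simpa using (not_le.1 hac).trans_le (h1 x hx)

/-- Turns statements about the median into counts, for the tail bound as well as for measurability.
-/
theorem medianValue_le_iff {l : List ℝ} (hl : l ≠ []) (c : ℝ) :
    medianValue l ≤ c ↔ l.length / 2 < l.countP fun x => decide (x ≤ c) := by
  have h0 := List.length_pos_iff.2 hl
  rw [medianValue, getD_le_iff_lt_countP (List.pairwise_insertionSort _ l),
    (List.perm_insertionSort _ l).countP_eq]
  rw [List.length_insertionSort]; omega

/-- If the median is far from `μ`, then so is at least half of the list. -/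
theorem length_le_two_mul_countP {l : List ℝ} (hl : l ≠ []) {μ e : ℝ}
    (h : e < |medianValue l - μ|) :
    l.length ≤ 2 * l.countP fun x => decide (e < |x - μ|) := by
  rcases lt_abs.1 h with h | h
  · have h1 := mt (medianValue_le_iff hl (μ + e)).2 (by linarith)
    have h2 := List.length_eq_countP_add_countP (fun x => decide (x ≤ μ + e)) (l := l)
    have h3 : (l.countP fun x => decide ¬ (decide (x ≤ μ + e) = true)) ≤
        l.countP fun x => decide (e < |x - μ|) := by
      refine List.countP_mono_left fun x _ hx => ?_
      simp only [decide_eq_true_eq, not_le] at hx ⊢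
      exact lt_abs.2 (Or.inl (by linarith))
    omega
  · have h1 := (medianValue_le_iff hl (medianValue l)).1 le_rfl
    have h3 : (l.countP fun x => decide (x ≤ medianValue l)) ≤
        l.countP fun x => decide (e < |x - μ|) := by
      refine List.countP_mono_left fun x _ hx => ?_
      simp only [decide_eq_true_eq] at hx ⊢
      exact lt_abs.2 (Or.inr (by linarith))
    omega

/-- A weight that is `15 / 8` for the numbers far from `μ` and `8 / 15` for the others. -/
def farWeight (μ e x : ℝ) : ℝ≥0∞ := if e < |x - μ| then 15 / 8 else 8 / 15

/-- The weights are inverse to each other, so the product is `(15 / 8)` to the power of far minus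
near entries. It is the Chernoff weight for the event that the median fails. -/
theorem one_le_prod_farWeight {l : List ℝ} {μ e : ℝ}
    (h : l.length ≤ 2 * l.countP fun x => decide (e < |x - μ|)) :
    1 ≤ (l.map (farWeight μ e)).prod := by
  have key : (l.map (farWeight μ e)).prod =
      (15 / 8) ^ (l.countP fun x => decide (e < |x - μ|)) *
        (8 / 15) ^ (l.length - l.countP fun x => decide (e < |x - μ|)) := by
    clear h
    induction l with
    | nil => simp
    | cons a l ih =>
      have hle := List.countP_le_length (p := fun x => decide (e < |x - μ|)) (l := l)
      rw [List.map_cons, List.prod_cons, ih, farWeight]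
      split_ifs with ha
      · rw [List.countP_cons_of_pos (by simpa using ha), List.length_cons, Nat.add_sub_add_right,
          pow_succ]
        ring
      · rw [List.countP_cons_of_neg (by simpa using ha), List.length_cons, Nat.succ_sub hle,
          pow_succ]
        ring
  rw [key]
  set c := l.countP fun x => decide (e < |x - μ|)
  have h1 : (1 : ℝ≥0∞) ≤ 15 / 8 := by
    rw [ENNReal.le_div_iff_mul_le (by simp) (by simp)]; norm_num
  have h2 : (15 / 8 : ℝ≥0∞) * (8 / 15) = 1 := by
    rw [ENNReal.div_eq_inv_mul, ENNReal.div_eq_inv_mul, mul_mul_mul_comm, mul_comm (15 : ℝ≥0∞),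
      mul_mul_mul_comm]
    rw [ENNReal.inv_mul_cancel (by simp) (by simp), ENNReal.inv_mul_cancel (by simp) (by simp),
      one_mul]
  calc (1 : ℝ≥0∞) = (15 / 8) ^ (l.length - c) * (8 / 15) ^ (l.length - c) := by
        rw [← mul_pow, h2, one_pow]
    _ ≤ _ := by gcongr ?_ * _; exact pow_le_pow_right₀ h1 (by omega)

/-- Independence of the repetitions. Finiteness allows the factors of earlier runs to be taken out
of `wp`. -/
theorem wp_repeated_prod {α : Type} (p : Prog α) (g : α → ℝ≥0∞) (hg : ∀ a, g a ≠ ∞)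
    (hp : wp u p g ≠ ∞) (k : ℕ) :
    wp u (repeated k p) (fun l => (l.map g).prod) = wp u p g ^ k := by
  induction k with
  | zero => simp [repeated, wp_pure]
  | succ k ih =>
    unfold repeated
    rw [(returns_spend 1).wp_bind, wp_bind]
    simp only [wp_bind, wp_pure, List.map_cons, List.prod_cons]
    simp only [wp_const_mul _ _ (hg _), ih]
    simp only [mul_comm (g _)]
    rw [wp_const_mul _ _ (ENNReal.pow_ne_top hp), pow_succ]

end

end Alphatron

namespace Alphatron

open Prog
open scoped ENNReal

noncomputable section

variable {u : ℝ → ℝ} {n : ℕ}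

/-! ### The sampling data structure -/

/-- The sum of the first `k` squared entries. -/
def sqSum (w : Fin n → ℝ) (k : ℕ) : ℝ := ∑ i ∈ Finset.range k, entry w i ^ 2

theorem sqSum_succ (w : Fin n → ℝ) (k : ℕ) : sqSum w (k + 1) = sqSum w k + entry w k ^ 2 :=
  Finset.sum_range_succ _ _

theorem sqSum_mono (w : Fin n → ℝ) : Monotone (sqSum w) :=
  monotone_nat_of_le_succ fun k => by rw [sqSum_succ]; nlinarith [sq_nonneg (entry w k)]

theorem sqSum_zero (w : Fin n → ℝ) : sqSum w 0 = 0 := rfl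

theorem entry_fin (w : Fin n → ℝ) (i : Fin n) : entry w i = w i := by simp [entry]

theorem sum_range_entry (w : Fin n → ℝ) (f : ℕ → ℝ → ℝ) :
    ∑ i ∈ Finset.range n, f i (entry w i) = ∑ i : Fin n, f i (w i) := by
  rw [Finset.sum_range]; simp [entry_fin]

theorem sqSum_eq (w : Fin n → ℝ) : sqSum w n = ∑ i, w i ^ 2 :=
  sum_range_entry w fun _ x => x ^ 2

/-- The result of `prepare`. -/
def prepared (w : Fin n → ℝ) : SQ2 n := ⟨w, fun j => sqSum w (j + 1), sqSum w n⟩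

theorem returns_squareSums (w : Fin n → ℝ) (acc : ℝ) :
    Returns u (squareSums n w acc) (fun j => acc + sqSum w (j + 1), acc + sqSum w n) := by
  induction n generalizing acc with
  | zero => exact Prod.ext (Subsingleton.elim _ _) (by simp [sqSum])
  | succ n ih =>
    refine (returns_spend 1).bind ((returns_times _ _).bind ((returns_plus _ _).bind
      ((ih (fun i => w i.succ) _).bind ?_)))
    have h : ∀ k, acc + w 0 * w 0 + sqSum (fun i => w i.succ) k = acc + sqSum w (k + 1) := by
      intro k
      rw [sqSum, sqSum, Finset.sum_range_succ', add_assoc, add_comm (w 0 * w 0)]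
      congr 2
      · refine Finset.sum_congr rfl fun i _ => ?_
        simp only [entry, Nat.add_lt_add_iff_right]
        rfl
      · simp [entry, sq]
    refine Prod.ext (funext fun j => ?_) (h n)
    cases j using Fin.cases with
    | zero => simpa [sqSum_zero] using h 0
    | succ j => exact h (j + 1)

theorem costs_squareSums (w : Fin n → ℝ) (acc : ℝ) :
    Costs u (squareSums n w acc) (3 * n) fun _ => True := by
  induction n generalizing acc with
  | zero => exact costs_pure trivial
  | succ n ih =>
    exact ((costs_spend 1).bind fun _ _ => (costs_times _ _).bind fun _ _ =>
      (costs_plus _ _).bind fun _ _ => (ih _ _).bind fun _ _ => costs_pure trivial).mono (by omega)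

theorem returns_prepare (w : Fin n → ℝ) : Returns u (prepare w) (prepared w) := by
  have := returns_squareSums (u := u) w 0
  simp only [zero_add] at this
  exact this.bind rfl

theorem costs_prepare (w : Fin n → ℝ) : Costs u (prepare w) (3 * n) fun r => r = prepared w :=
  Costs.and_returns (((costs_squareSums w 0).bind fun _ _ => costs_pure trivial) :
    Costs u _ _ fun _ => True) (returns_prepare w)

/-- A failed comparison settles all smaller indices by monotonicity. The right end `lo + len` is
returned by default and never probed, whence the guard in the last conclusion. -/
theorem bisect_spec {cum : Fin n → ℝ} (x : ℝ)
    (hmono : ∀ i j, i ≤ j → j < n → entry cum i ≤ entry cum j) (len lo : ℕ) (h : lo + len ≤ n) :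
    ∃ j, Returns u (bisect cum x len lo) j ∧ lo ≤ j ∧ j ≤ lo + len ∧
      (∀ i, lo ≤ i → i < j → entry cum i ≤ x) ∧ (j < lo + len → x < entry cum j) := by
  induction len using Nat.strong_induction_on generalizing lo with
  | _ len ih =>
    by_cases h0 : len = 0
    · refine ⟨lo, ?_, le_rfl, by omega, fun i h1 h2 => by omega, fun h => by omega⟩
      rw [bisect, dif_pos h0]; rfl
    · by_cases hx : x < entry cum (lo + len / 2)
      · obtain ⟨j, h1, h2, h3, h4, h5⟩ := ih (len / 2) (by omega) lo (by omega)
        refine ⟨j, ?_, h2, by omega, h4, fun _ => ?_⟩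
        · rw [bisect, dif_neg h0]
          refine (returns_spend 1).bind ((returns_less _ _).bind ?_)
          simpa [hx] using h1
        · rcases h3.lt_or_eq with h | rfl
          · exact h5 h
          · exact hx
      · obtain ⟨j, h1, h2, h3, h4, h5⟩ :=
          ih (len - len / 2 - 1) (by omega) (lo + len / 2 + 1) (by omega)
        refine ⟨j, ?_, by omega, by omega, fun i hi hij => ?_, fun hj => h5 (by omega)⟩
        · rw [bisect, dif_neg h0]
          refine (returns_spend 1).bind ((returns_less _ _).bind ?_)
          simpa [hx] using h1
        · by_cases hi' : lo + len / 2 + 1 ≤ i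
          · exact h4 i hi' hij
          · exact (hmono i (lo + len / 2) (by omega) (by omega)).trans (not_lt.1 hx)

theorem costs_bisect (cum : Fin n → ℝ) (x : ℝ) (len lo : ℕ) :
    Costs u (bisect cum x len lo) (2 * Nat.clog 2 (len + 1)) fun _ => True := by
  induction len using Nat.strong_induction_on generalizing lo with
  | _ len ih =>
    by_cases h0 : len = 0
    · rw [bisect, dif_pos h0]; exact (costs_pure trivial).mono (Nat.zero_le _)
    · rw [bisect, dif_neg h0]
      have h1 := ih (len / 2) (by omega) lo
      have h2 := (ih (len - len / 2 - 1) (by omega) (lo + len / 2 + 1)).mono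
        (c := 2 * Nat.clog 2 (len / 2 + 1))
        (Nat.mul_le_mul le_rfl (Nat.clog_mono_right 2 (by omega)))
      refine Costs.mono ((costs_spend 1).bind fun _ _ => (costs_less _ _).bind fun _ _ =>
        h1.ite h2) ?_
      rw [clog_two_of_two_le (by omega : 2 ≤ len + 1)]
      have : len + 1 - (len + 1) / 2 = len / 2 + 1 := by omega
      rw [this]; omega

/-- The index that is found for the number `x` by binary search. -/
def sampledIndex (w : Fin n → ℝ) (x : ℝ) : ℕ :=
  ((Finset.range (n - 1)).filter fun i => sqSum w (i + 1) ≤ x).card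

theorem bisect_prepared (w : Fin n → ℝ) (x : ℝ) :
    Returns u (bisect (prepared w).cum x (n - 1) 0) (sampledIndex w x) ∧
      sampledIndex w x ≤ n - 1 ∧ (∀ i < sampledIndex w x, sqSum w (i + 1) ≤ x) ∧
      (sampledIndex w x < n - 1 → x < sqSum w (sampledIndex w x + 1)) := by
  have he : ∀ i < n, entry (prepared w).cum i = sqSum w (i + 1) := fun i hi => by
    simp [entry, prepared, hi]
  obtain ⟨j, h1, -, h3, h4, h5⟩ := bisect_spec (u := u) (cum := (prepared w).cum) x
    (fun i j hij hj => by
      rw [he i (by omega), he j hj]; exact sqSum_mono w (by omega)) (n - 1) 0 (by omega)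
  rw [zero_add] at h3 h5
  have h4' : ∀ i < j, sqSum w (i + 1) ≤ x := fun i hi => by
    rw [← he i (by omega)]; exact h4 i (Nat.zero_le _) hi
  have h5' : j < n - 1 → x < sqSum w (j + 1) := fun hj => by
    rw [← he j (by omega)]; exact h5 hj
  have hj : sampledIndex w x = j := by
    rw [sampledIndex]
    convert Finset.card_range j using 2
    ext i
    simp only [Finset.mem_filter, Finset.mem_range]
    refine ⟨fun ⟨hi, hx⟩ => ?_, fun hi => ⟨by omega, h4' i hi⟩⟩
    by_contra hij
    have := h5' (by omega)
    exact absurd (sqSum_mono w (show j + 1 ≤ i + 1 by omega)) (by linarith)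
  rw [hj]
  exact ⟨h1, h3, h4', h5'⟩

/-- The value of one sample when the random number is `r`. -/
def sampleValue (w v : Fin n → ℝ) (r : ℝ) : ℝ :=
  sqSum w n * entry v (sampledIndex w (r * sqSum w n)) /
    entry w (sampledIndex w (r * sqSum w n))

theorem wp_sampleProduct (w v : Fin n → ℝ) (F : ℝ → ℝ≥0∞) :
    wp u (sampleProduct (prepared w) v) F = ∫⁻ r : unitInterval, F (sampleValue w v r) := by
  unfold sampleProduct sampleIndex
  simp only [wp_bind]
  refine lintegral_congr fun r => ?_
  have h := (bisect_prepared (u := u) w (r * sqSum w n)).1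
  exact (h.wp _)

theorem measurable_entry : Measurable fun q : (Fin n → ℝ) × ℕ => entry q.1 q.2 := by
  refine measurable_from_prod_countable_left fun j => ?_
  unfold entry
  by_cases h : j < n
  · simp only [h, dif_pos]; exact measurable_pi_apply (⟨j, h⟩ : Fin n)
  · simp only [h, dif_neg, not_false_eq_true]; exact measurable_const

theorem measurable_sqSum (k : ℕ) : Measurable fun w : Fin n → ℝ => sqSum w k := by
  unfold sqSum
  exact Finset.measurable_sum _ fun i _ =>
    (measurable_entry.comp (measurable_id.prodMk measurable_const)).pow_const 2

/-- Described as a count of partial sums, the index is a finite sum of indicators, and the course of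
the search plays no role. -/
theorem measurable_sampledIndex {X : Type} [MeasurableSpace X] {f : X → Fin n → ℝ} {g : X → ℝ}
    (hf : Measurable f) (hg : Measurable g) : Measurable fun x => sampledIndex (f x) (g x) := by
  unfold sampledIndex
  simp only [Finset.card_filter]
  refine Finset.measurable_sum _ fun i _ => Measurable.ite ?_ measurable_const measurable_const
  exact measurableSet_le ((measurable_sqSum _).comp hf) hg

theorem measurableProg_sampleProduct {X : Type} [MeasurableSpace X] {w v : X → Fin n → ℝ}
    (hw : Measurable w) (hv : Measurable v) :
    MeasurableProg u fun x => sampleProduct (prepared (w x)) (v x) := by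
  have hs : Measurable fun x => sqSum (w x) n := (measurable_sqSum n).comp hw
  have hx : Measurable fun q : X × unitInterval => (q.2 : ℝ) * sqSum (w q.1) n :=
    (measurable_subtype_coe.comp measurable_snd).mul (hs.comp measurable_fst)
  refine MeasurableProg.bind (p := fun x => sampleIndex (prepared (w x)))
    (f := fun x j => do
      let p ← times (sqSum (w x) n) (entry (v x) j)
      divide p (entry (w x) j)) ?_ ?_
  · refine MeasurableProg.bind (p := fun _ => uniform) (f := fun x r => do
      let y ← times (r : ℝ) (sqSum (w x) n)
      bisect (prepared (w x)).cum y (n - 1) 0) measurableProg_uniform ?_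
    refine MeasurableProg.returns_bind
      (p := fun q : X × unitInterval => times (q.2 : ℝ) (sqSum (w q.1) n))
      (f := fun q y => bisect (prepared (w q.1)).cum y (n - 1) 0) (fun _ => returns_times _ _) ?_
    exact MeasurableProg.of_returns
      (a := fun q : X × unitInterval => sampledIndex (w q.1) ((q.2 : ℝ) * sqSum (w q.1) n))
      (fun q => (bisect_prepared (w q.1) _).1) (measurable_sampledIndex (hw.comp measurable_fst) hx)
  · refine MeasurableProg.returns_bind
      (p := fun q : X × ℕ => times (sqSum (w q.1) n) (entry (v q.1) q.2))
      (f := fun q y => divide y (entry (w q.1) q.2)) (fun _ => returns_times _ _) ?_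
    refine MeasurableProg.of_returns (fun _ => returns_divide _ _) ?_
    exact ((hs.comp measurable_fst).mul (measurable_entry.comp
      ((hv.comp measurable_fst).prodMk measurable_snd))).div
      (measurable_entry.comp ((hw.comp measurable_fst).prodMk measurable_snd))

theorem costs_sampleProduct (w v : Fin n → ℝ) :
    Costs u (sampleProduct (prepared w) v) (4 + 2 * Nat.clog 2 (n - 1 + 1)) fun _ => True := by
  refine Costs.mono (Costs.bind (Q := fun _ => True) (costs_uniform.bind fun _ _ =>
    (costs_times _ _).bind fun _ _ => costs_bisect _ _ _ _) fun _ _ =>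
      (costs_times _ _).bind fun _ _ => costs_divide _ _) ?_
  omega

/-- The law of one sample. -/
theorem wp_sampleProduct_eq_sum (w v : Fin n → ℝ) (hw : 0 < sqSum w n) (F : ℝ → ℝ≥0∞) :
    wp u (sampleProduct (prepared w) v) F =
      ∑ j : Fin n, ENNReal.ofReal (w j ^ 2 / sqSum w n) * F (sqSum w n * v j / w j) := by
  rw [wp_sampleProduct]
  set q := sqSum w n
  have hc : ∀ k ≤ n, sqSum w k / q ∈ unitInterval := fun k hk =>
    ⟨div_nonneg (by rw [← sqSum_zero w]; exact sqSum_mono w (Nat.zero_le _)) hw.le,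
      (div_le_one hw).2 (sqSum_mono w hk)⟩
  let I : Fin n → Set unitInterval := fun j =>
    Set.Ico ⟨sqSum w j / q, hc j j.2.le⟩ ⟨sqSum w (j + 1) / q, hc (j + 1) j.2⟩
  have hI : ∀ (j : Fin n) (r : unitInterval),
      r ∈ I j ↔ sqSum w j ≤ r * q ∧ r * q < sqSum w (j + 1) := fun j r => by
    rw [Set.mem_Ico, ← Subtype.coe_le_coe, ← Subtype.coe_lt_coe, div_le_iff₀ hw, lt_div_iff₀ hw]
  have hae : ∀ᵐ r : unitInterval, F (sampleValue w v r) =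
      ∑ j, (I j).indicator (fun _ => F (q * v j / w j)) r := by
    -- The intervals `I j` are disjoint and cover `[0, 1)`, and the search returns the `j` whose
    -- interval contains `r`. The point `1` lies in none of them and is a null set.
    filter_upwards [compl_mem_ae_iff.2 (measure_singleton (1 : unitInterval))] with r hr
    have hr1 : (r : ℝ) < 1 := lt_of_le_of_ne r.2.2 fun h => hr (Subtype.ext h)
    obtain ⟨-, h2, h3, h4⟩ := bisect_prepared (u := u) w (r * q)
    set j := sampledIndex w (r * q) with hj
    have hn : 0 < n := by
      rcases Nat.eq_zero_or_pos n with h | h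
      · subst h; exact absurd hw (by simp [q, sqSum])
      · exact h
    have hjn : j < n := by omega
    have hup : r * q < sqSum w (j + 1) := by
      rcases h2.lt_or_eq with h | h
      · exact h4 h
      · rw [h, Nat.sub_add_cancel hn]; nlinarith
    have hlo : sqSum w j ≤ r * q := by
      rcases Nat.eq_zero_or_pos j with h | h
      · rw [h, sqSum_zero]; exact mul_nonneg r.2.1 hw.le
      · have := h3 (j - 1) (by omega)
        rwa [Nat.sub_add_cancel h] at this
    rw [Finset.sum_eq_single (⟨j, hjn⟩ : Fin n), Set.indicator_of_mem ((hI _ _).2 ⟨hlo, hup⟩)]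
    · rw [sampleValue, ← hj]
      simp [entry, hjn, q]
    · intro i _ hi
      refine Set.indicator_of_notMem (fun hmem => hi (Fin.ext ?_)) _
      obtain ⟨h5, h6⟩ := (hI _ _).1 hmem
      rcases lt_trichotomy (i : ℕ) j with h | h | h
      · exact absurd (sqSum_mono w (show (i : ℕ) + 1 ≤ j from h)) (by linarith)
      · exact h
      · exact absurd (sqSum_mono w (show j + 1 ≤ (i : ℕ) from h)) (by linarith)
    · simp
  rw [lintegral_congr_ae hae, lintegral_finsetSum]
  · refine Finset.sum_congr rfl fun j _ => ?_
    rw [lintegral_indicator_const measurableSet_Ico, unitInterval.volume_Ico, mul_comm]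
    congr 2
    simp only [sqSum_succ, entry_fin]
    ring
  · exact fun j _ => measurable_const.indicator measurableSet_Ico

/-! ### Means and medians of means -/

/-- The second moment of a sum of independent variables with finitely many values. -/
theorem wp_total_sq_le {ι : Type} [Fintype ι] {p : Prog ℝ} {π a : ι → ℝ} {μ M : ℝ}
    (hp : ∀ F : ℝ → ℝ≥0∞, wp u p F = ∑ j, ENNReal.ofReal (π j) * F (a j)) (hπ : ∀ j, 0 ≤ π j)
    (hsum : ∑ j, π j = 1) (hμ : ∑ j, π j * a j = μ) (hM : ∑ j, π j * a j ^ 2 ≤ M) (N : ℕ) (c : ℝ) :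
    wp u (total N fun _ => p) (fun s => ENNReal.ofReal ((s + c) ^ 2)) ≤
      ENNReal.ofReal (N * M + (N * μ + c) ^ 2) := by
  have hM0 : 0 ≤ M := (Finset.sum_nonneg fun j _ => mul_nonneg (hπ j) (sq_nonneg _)).trans hM
  -- The shift `c` carries the induction: after a first sample `x`, the remaining sum is shifted by
  -- `x + c`.
  induction N generalizing c with
  | zero => simp [total, wp_pure]
  | succ N ih =>
    unfold total
    rw [(returns_spend 1).wp_bind, wp_bind]
    simp only [wp_bind, (returns_plus _ _).wp]
    calc wp u p (fun x => wp u (total N fun _ => p) fun s => ENNReal.ofReal ((x + s + c) ^ 2))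
        ≤ wp u p (fun x => ENNReal.ofReal (N * M + (N * μ + (x + c)) ^ 2)) := by
          refine wp_mono _ fun x => ?_
          simpa only [add_assoc, add_left_comm x] using ih (x + c)
      _ = ENNReal.ofReal (∑ j, π j * (N * M + (N * μ + (a j + c)) ^ 2)) := by
          rw [hp, ENNReal.ofReal_sum_of_nonneg fun j _ => mul_nonneg (hπ j) (by positivity)]
          exact Finset.sum_congr rfl fun j _ => (ENNReal.ofReal_mul (hπ j)).symm
      _ ≤ _ := by
          refine ENNReal.ofReal_le_ofReal ?_
          have h1 : ∑ j, π j * (N * M + (N * μ + (a j + c)) ^ 2) =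
              (N * M + (N * μ + c) ^ 2) * ∑ j, π j + 2 * (N * μ + c) * ∑ j, π j * a j +
                ∑ j, π j * a j ^ 2 := by
            simp only [Finset.mul_sum, ← Finset.sum_add_distrib]
            exact Finset.sum_congr rfl fun j _ => by ring
          rw [h1, hsum, hμ]
          push_cast
          -- The right side exceeds the left by `μ ^ 2` plus the slack in `hM`: the second moment
          -- stands in for the variance.
          nlinarith [sq_nonneg μ]

/-- Chebyshev's inequality: the mean has variance at most `1 / N`, so it fails with probability at
most `1 / (N e²) ≤ 2 / 9`. -/
theorem wp_mean_far_le {ι : Type} [Fintype ι] {p : Prog ℝ} {π a : ι → ℝ} {μ : ℝ}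
    (hp : ∀ F : ℝ → ℝ≥0∞, wp u p F = ∑ j, ENNReal.ofReal (π j) * F (a j)) (hπ : ∀ j, 0 ≤ π j)
    (hsum : ∑ j, π j = 1) (hμ : ∑ j, π j * a j = μ) (hM : ∑ j, π j * a j ^ 2 ≤ 1) {N : ℕ} {e : ℝ}
    (he : 0 < e) (hN : 9 / (2 * e ^ 2) ≤ N) :
    wp u (do let s ← total N fun _ => p; divide s N) ({x | e < |x - μ|}.indicator 1) ≤ 2 / 9 := by
  have hN0 : (0 : ℝ) < N := lt_of_lt_of_le (by positivity) hN
  rw [wp_bind]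
  calc _ ≤ wp u (total N fun _ => p) (fun s => ENNReal.ofReal (1 / (N * e) ^ 2) *
        ENNReal.ofReal ((s + (-(N * μ))) ^ 2)) := by
        refine wp_mono _ fun s => ?_
        rw [(returns_divide _ _).wp, Set.indicator_apply]
        split_ifs with h
        · rw [← ENNReal.ofReal_mul (by positivity), Pi.one_apply, ENNReal.one_le_ofReal,
            one_div_mul_eq_div, one_le_div (by positivity), sq_le_sq, abs_of_pos (by positivity)]
          have h1 : s / N - μ = (s + (-(N * μ))) / N := by field_simp; ring
          rw [Set.mem_ofPred_eq, h1, abs_div, abs_of_pos hN0, lt_div_iff₀ hN0] at h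
          linarith
        · exact bot_le
    _ ≤ ENNReal.ofReal (1 / (N * e) ^ 2) * ENNReal.ofReal (N * 1 + (N * μ + (-(N * μ))) ^ 2) := by
        rw [wp_const_mul _ _ ENNReal.ofReal_ne_top]
        gcongr
        exact wp_total_sq_le hp hπ hsum hμ hM N _
    _ ≤ ENNReal.ofReal (2 / 9) := by
        rw [← ENNReal.ofReal_mul (by positivity)]
        refine ENNReal.ofReal_le_ofReal ?_
        rw [div_le_iff₀ (by positivity)] at hN
        rw [add_neg_cancel, div_mul_eq_mul_div, div_le_div_iff₀ (by positivity) (by norm_num)]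
        nlinarith
    _ = 2 / 9 := by
        rw [ENNReal.ofReal_div_of_pos (by norm_num)]; norm_num

/-- Knowing the length excludes the empty list, whose median says nothing about the samples. -/
theorem wp_repeated_mono {α : Type} (p : Prog α) {k : ℕ} {F G : List α → ℝ≥0∞}
    (h : ∀ l, l.length = k → F l ≤ G l) : wp u (repeated k p) F ≤ wp u (repeated k p) G := by
  induction k generalizing F G with
  | zero => exact h [] rfl
  | succ k ih =>
    unfold repeated
    rw [(returns_spend 1).wp_bind, (returns_spend 1).wp_bind, wp_bind, wp_bind]
    refine wp_mono _ fun a => ?_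
    rw [wp_bind, wp_bind]
    exact ih fun l hl => h (a :: l) (by simp [hl])

/-- The median of independent means is rarely far from the expectation. -/
theorem wp_median_far_le {p : Prog ℝ} {μ e q : ℝ}
    (hp : wp u p ({x | e < |x - μ|}.indicator 1) ≤ 2 / 9) (hq : 0 < q) (hq1 : q < 1) :
    wp u (do let l ← repeated (numMeans q) p; median l) ({x | e < |x - μ|}.indicator 1) ≤
      ENNReal.ofReal q := by
  set k := numMeans q
  have hlog : 0 < Real.log (1 / q) := Real.log_pos ((one_lt_div hq).2 hq1)
  have hk : 6 * Real.log (1 / q) ≤ k := Nat.le_ceil _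
  have hk0 : 0 < k := Nat.ceil_pos.2 (by positivity)
  have hg : ∀ x, farWeight μ e x ≠ ∞ := fun x => by
    unfold farWeight; split_ifs <;> exact ENNReal.div_ne_top (by simp) (by simp)
  -- `449 / 540 = (2 / 9)(15 / 8) + (7 / 9)(8 / 15)`. The best weight would be `√(7 / 2) ≈ 1.871`,
  -- and `15 / 8` is a rational number close to it.
  have hr : wp u p (farWeight μ e) ≤ ENNReal.ofReal (449 / 540) := by
    have h1 : ∀ x, farWeight μ e x ≤ ENNReal.ofReal (161 / 120) *
        ({x | e < |x - μ|}.indicator 1 x) + ENNReal.ofReal (8 / 15) := by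
      intro x
      unfold farWeight
      by_cases hx : e < |x - μ|
      · rw [if_pos hx, Set.indicator_of_mem (by exact hx), Pi.one_apply, mul_one,
          ← ENNReal.ofReal_add (by norm_num) (by norm_num),
          show (161 / 120 + 8 / 15 : ℝ) = 15 / 8 by norm_num,
          ENNReal.ofReal_div_of_pos (by norm_num)]
        norm_num
      · rw [if_neg hx]
        refine le_trans (le_of_eq ?_) le_add_self
        rw [ENNReal.ofReal_div_of_pos (by norm_num), ENNReal.ofReal_ofNat, ENNReal.ofReal_ofNat]
    calc wp u p (farWeight μ e) ≤ _ := wp_mono _ h1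
      _ = ENNReal.ofReal (161 / 120) * wp u p ({x | e < |x - μ|}.indicator 1) +
          ENNReal.ofReal (8 / 15) := by
          rw [wp_add_const, wp_const_mul _ _ ENNReal.ofReal_ne_top]
      _ ≤ ENNReal.ofReal (161 / 120) * ENNReal.ofReal (2 / 9) + ENNReal.ofReal (8 / 15) := by
          gcongr
          rwa [ENNReal.ofReal_div_of_pos (by norm_num), ENNReal.ofReal_ofNat, ENNReal.ofReal_ofNat]
      _ = _ := by
          rw [← ENNReal.ofReal_mul (by norm_num), ← ENNReal.ofReal_add (by norm_num) (by norm_num)]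
          norm_num
  -- `(449 / 540) ^ 6 ≤ exp (-1)`, which is why `6 log(1 / q)` means suffice.
  have hexp : (449 / 540 : ℝ) ^ k ≤ q := by
    have h1 : Real.log (449 / 540) ≤ -(1 / 6) := by
      have h2 : (449 / 540 : ℝ) ^ 6 ≤ Real.exp (-1) := by
        rw [Real.exp_neg, le_inv_comm₀ (by norm_num) (Real.exp_pos 1)]
        exact Real.exp_one_lt_d9.le.trans (by norm_num)
      have h3 := Real.log_le_log (by norm_num) h2
      rw [Real.log_exp, Real.log_pow] at h3
      push_cast at h3; linarith
    rw [← Real.log_le_log_iff (by positivity) hq, Real.log_pow]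
    rw [one_div, Real.log_inv] at hk
    nlinarith [hk0, (Nat.cast_nonneg k : (0 : ℝ) ≤ k)]
  calc _ ≤ wp u (repeated k p) (fun l => (l.map (farWeight μ e)).prod) := by
        rw [wp_bind]
        refine wp_repeated_mono _ fun l hl => ?_
        rw [(returns_median l).wp, Set.indicator_apply]
        split_ifs with h1
        · exact one_le_prod_farWeight (length_le_two_mul_countP
            (List.length_pos_iff.1 (by omega)) h1)
        · exact bot_le
    _ = wp u p (farWeight μ e) ^ k :=
        wp_repeated_prod _ _ hg (ne_top_of_le_ne_top ENNReal.ofReal_ne_top hr) _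
    _ ≤ ENNReal.ofReal (449 / 540) ^ k := by gcongr
    _ = ENNReal.ofReal ((449 / 540) ^ k) := (ENNReal.ofReal_pow (by norm_num) k).symm
    _ ≤ ENNReal.ofReal q := ENNReal.ofReal_le_ofReal hexp

/-- The estimate of an inner product of vectors of norm at most one is accurate. -/
theorem wp_estimateInner_far_le (w v : Fin n → ℝ) (hw : ∑ i, w i ^ 2 ≤ 1) (hv : ∑ i, v i ^ 2 ≤ 1)
    {e q : ℝ} (he : 0 < e) (hq : 0 < q) (hq1 : q < 1) :
    wp u (estimateInner (meanSize e) (numMeans q) (prepared w) v)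
      ({x | e < |x - ∑ i, w i * v i|}.indicator 1) ≤ ENNReal.ofReal q := by
  unfold estimateInner
  rw [(returns_less _ _).wp_bind]
  by_cases h0 : 0 < sqSum w n
  · have h0' : 0 < (prepared w).sqNorm := h0
    simp only [h0', decide_true, if_true]
    refine wp_median_far_le (wp_mean_far_le (wp_sampleProduct_eq_sum w v h0)
      (fun j => by positivity) ?_ ?_ ?_ he (Nat.le_ceil _)) hq hq1
    · rw [← Finset.sum_div, ← sqSum_eq, div_self h0.ne']
    -- The sample is unbiased: the entries `w j` cancel, and an index with `w j = 0` contributes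
    -- zero on both sides.
    · refine Finset.sum_congr rfl fun j _ => ?_
      by_cases hj : w j = 0
      · simp [hj]
      · field_simp
    -- The second moment is at most `‖w‖² ‖v‖² ≤ 1`. The first comparison is only an inequality
    -- because indices with `w j = 0` are never sampled.
    · refine le_trans (Finset.sum_le_sum (g := fun j => sqSum w n * v j ^ 2) fun j _ => ?_) ?_
      · by_cases hj : w j = 0
        · simp only [hj]; simp; positivity
        · refine le_of_eq ?_
          field_simp
      · rw [← Finset.mul_sum, sqSum_eq]
        exact mul_le_one₀ hw (Finset.sum_nonneg fun _ _ => sq_nonneg _) hv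
  · have h0' : ¬ 0 < (prepared w).sqNorm := h0
    simp only [h0', decide_false]
    rw [sqSum_eq, not_lt] at h0
    have hz : ∀ i, w i = 0 := fun i => by
      have := (Finset.sum_eq_zero_iff_of_nonneg fun i _ => sq_nonneg (w i)).1
        (le_antisymm h0 (Finset.sum_nonneg fun _ _ => sq_nonneg _)) i (Finset.mem_univ i)
      exact pow_eq_zero_iff two_ne_zero |>.1 this
    have : (0 : ℝ) ∉ {x | e < |x - ∑ i, w i * v i|} := by simp [hz, he.le]
    simp [wp_pure, this]

end

end Alphatron

namespace Alphatron

open Prog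
open scoped ENNReal

noncomputable section

variable {u : ℝ → ℝ} {n : ℕ}

/-! ### Measurability of the estimates -/

/-- A list is encoded by its length and its entries, continued by zeros. This σ-algebra makes
prepending and counting measurable, as needed for the list of means. -/
instance : MeasurableSpace (List ℝ) :=
  MeasurableSpace.comap (fun l => (l.length, fun i : ℕ => l.getD i 0)) inferInstance

theorem measurable_length_getD :
    Measurable fun l : List ℝ => (l.length, fun i : ℕ => l.getD i 0) :=
  comap_measurable _

theorem measurable_cons : Measurable fun q : ℝ × List ℝ => q.1 :: q.2 := by
  refine measurable_comap_iff.2 (Measurable.prodMk ?_ (measurable_pi_lambda _ fun i => ?_))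
  · exact (measurable_fst.comp (measurable_length_getD.comp measurable_snd)).add_const 1
  · cases i with
    | zero => exact measurable_fst
    | succ i =>
      exact (measurable_pi_apply i).comp
        (measurable_snd.comp (measurable_length_getD.comp measurable_snd))

theorem countP_eq_sum (p : ℝ → Prop) [DecidablePred p] (l : List ℝ) :
    (l.countP fun x => decide (p x)) =
      ∑ i ∈ Finset.range l.length, if p (l.getD i 0) then 1 else 0 := by
  induction l with
  | nil => rfl
  | cons a l ih =>
    rw [List.countP_cons, ih, List.length_cons, Finset.sum_range_succ']
    simp

theorem measurable_countP (c : ℝ) :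
    Measurable fun l : List ℝ => l.countP fun x => decide (x ≤ c) := by
  have h : Measurable fun q : ℕ × (ℕ → ℝ) =>
      ∑ i ∈ Finset.range q.1, if q.2 i ≤ c then (1 : ℕ) else 0 := by
    refine measurable_from_prod_countable_right fun m => ?_
    exact Finset.measurable_sum (f := fun i (s : ℕ → ℝ) => if s i ≤ c then (1 : ℕ) else 0)
      (Finset.range m) fun i _ => Measurable.ite
      (measurableSet_le (measurable_pi_apply (X := fun _ : ℕ => ℝ) i) measurable_const)
      measurable_const measurable_const
  have := h.comp measurable_length_getD
  simp only [countP_eq_sum]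
  exact this

theorem measurable_medianValue : Measurable medianValue := by
  refine measurable_of_Iic fun c => ?_
  have hlen : Measurable fun l : List ℝ => l.length := measurable_fst.comp measurable_length_getD
  -- The empty list is treated separately: its median is the default value `0`.
  have : medianValue ⁻¹' Set.Iic c =
      ({l | l.length = 0} ∩ {_l | 0 ≤ c}) ∪ ({l | l.length = 0}ᶜ ∩
        {l | l.length / 2 < l.countP fun x => decide (x ≤ c)}) := by
    ext l
    by_cases hl : l = []
    · subst hl; simp [medianValue]
    · simp [hl, medianValue_le_iff hl]
  rw [this]
  have h0 : MeasurableSet {l : List ℝ | l.length = 0} := hlen (measurableSet_singleton 0)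
  refine (h0.inter (MeasurableSet.const _)).union (h0.compl.inter ?_)
  exact measurableSet_lt ((measurable_of_countable fun k : ℕ => k / 2).comp hlen)
    (measurable_countP c)

theorem MeasurableProg.repeated {X : Type} [MeasurableSpace X] {p : X → Prog ℝ}
    (h : MeasurableProg u p) (k : ℕ) : MeasurableProg u fun x => repeated k (p x) := by
  induction k with
  | zero => exact .of_returns (a := fun _ => []) (fun _ => rfl) measurable_const
  | succ k ih =>
    refine .returns_bind (fun _ => returns_spend 1) (h.bind (.bind
      (p := fun q : X × ℝ => Prog.repeated k (p q.1)) (f := fun q l => pure (q.2 :: l))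
      (ih.comp measurable_fst) (.of_returns (fun _ => rfl) ?_)))
    exact measurable_cons.comp
      ((measurable_snd.comp measurable_fst).prodMk measurable_snd)

theorem measurableProg_estimateInner {X : Type} [MeasurableSpace X] {w v : X → Fin n → ℝ}
    (hw : Measurable w) (hv : Measurable v) (N k : ℕ) :
    MeasurableProg u fun x => estimateInner N k (prepared (w x)) (v x) := by
  unfold estimateInner
  refine .returns_bind (fun _ => returns_less _ _) (.ite
    (measurable_decide_lt measurable_const ((measurable_sqSum n).comp hw)) ?_
    (.of_returns (a := fun _ => 0) (fun _ => rfl) measurable_const))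
  refine .bind (.repeated (.bind (.total fun _ => measurableProg_sampleProduct hw hv)
    (.of_returns (fun _ => returns_divide _ _) ?_)) k)
    (.of_returns (fun _ => returns_median _) ?_)
  · exact measurable_snd.div_const _
  · exact measurable_medianValue.comp measurable_snd

theorem costs_estimateInner (w v : Fin n → ℝ) (N k : ℕ) :
    Costs u (estimateInner N k (prepared w) v)
      (k * (N * (6 + 2 * Nat.clog 2 (n - 1 + 1)) + 2) + (3 * k * Nat.clog 2 k + k) + 3)
      fun _ => True := by
  unfold estimateInner
  refine Costs.mono ((costs_less _ _).bind fun c _ => Costs.ite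
    (b := k * (N * (6 + 2 * Nat.clog 2 (n - 1 + 1)) + 2) + (3 * k * Nat.clog 2 k + k) + 2)
    ?_ ((costs_pure trivial).mono (Nat.zero_le _))) (by omega)
  refine Costs.mono ((Costs.repeated ((Costs.total fun _ => costs_sampleProduct w v).bind
    fun _ _ => costs_divide _ _)).bind fun l hl => hl ▸ costs_median l) ?_
  have : N * (4 + 2 * Nat.clog 2 (n - 1 + 1) + 2) = N * (6 + 2 * Nat.clog 2 (n - 1 + 1)) := by
    congr 1; omega
  rw [this, Nat.add_assoc _ 1 1]
  omega

/-! ### The approximate kernel matrices -/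

/-- `(1 + z + ... + z ^ d) / (d + 1)`. -/
def kernelValue (d : ℕ) (z : ℝ) : ℝ := (∑ k ∈ Finset.range (d + 1), z ^ k) / (d + 1)

theorem returns_kernelOfInner (d : ℕ) (z : ℝ) :
    Returns u (kernelOfInner d z) (kernelValue d z) := by
  have h : ∀ d, Returns u (geomSum d z) (∑ k ∈ Finset.range (d + 1), z ^ k) := by
    intro d
    induction d with
    | zero => rw [zero_add, Finset.sum_range_one, pow_zero]; rfl
    | succ d ih =>
      refine (returns_spend 1).bind (ih.bind ((returns_times _ _).bind ?_))
      have : ∑ k ∈ Finset.range (d + 1 + 1), z ^ k =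
          z * ∑ k ∈ Finset.range (d + 1), z ^ k + 1 := by
        rw [Finset.sum_range_succ', pow_zero, Finset.mul_sum]
        simp only [pow_succ']
      rw [this]
      exact returns_plus _ _
  exact (h d).bind (returns_divide _ _)

theorem costs_kernelOfInner (d : ℕ) (z : ℝ) :
    Costs u (kernelOfInner d z) (3 * d + 1) fun _ => True := by
  have h : ∀ d, Costs u (geomSum d z) (3 * d) fun _ => True := by
    intro d
    induction d with
    | zero => exact costs_pure trivial
    | succ d ih =>
      exact ((costs_spend 1).bind fun _ _ => ih.bind fun _ _ => (costs_times _ _).bind fun _ _ =>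
        costs_plus _ _).mono (by omega)
  exact (h d).bind fun _ _ => costs_divide _ _

theorem measurable_kernelValue (d : ℕ) : Measurable (kernelValue d) := by
  unfold kernelValue; fun_prop

/-- Induction on `z^(k+1) - t^(k+1) = z (z^k - t^k) + (z - t) t^k` with `|z| ≤ 1 + e`. -/
theorem abs_pow_sub_pow_le {z t e : ℝ} (ht : |t| ≤ 1) (hz : |z - t| ≤ e) (k : ℕ) :
    |z ^ k - t ^ k| ≤ (1 + e) ^ k - 1 := by
  have he : 0 ≤ e := (abs_nonneg _).trans hz
  induction k with
  | zero => simp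
  | succ k ih =>
    have hz1 : |z| ≤ 1 + e := by
      calc |z| = |t + (z - t)| := by ring_nf
        _ ≤ _ := (abs_add_le _ _).trans (add_le_add ht hz)
    have htk : |t ^ k| ≤ 1 := by rw [abs_pow]; exact pow_le_one₀ (abs_nonneg _) ht
    have : z ^ (k + 1) - t ^ (k + 1) = z * (z ^ k - t ^ k) + (z - t) * t ^ k := by ring
    rw [this]
    refine (abs_add_le _ _).trans ?_
    rw [abs_mul, abs_mul]
    calc _ ≤ (1 + e) * ((1 + e) ^ k - 1) + e * 1 := by gcongr
      _ = _ := by ring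

/-- Every power up to `d` is off by at most `exp(d e) - 1 ≤ 3 d e`, and the kernel is an average of
powers. This explains the accuracy `ε_K / (3 d)` for the inner products. -/
theorem abs_kernelValue_sub_le {d : ℕ} {z t e : ℝ} (ht : |t| ≤ 1) (hz : |z - t| ≤ e)
    (hde : 3 * d * e ≤ 1) : |kernelValue d z - kernelValue d t| ≤ 3 * d * e := by
  have he : 0 ≤ e := (abs_nonneg _).trans hz
  have hpow : ∀ k ∈ Finset.range (d + 1), |z ^ k - t ^ k| ≤ 3 * d * e := fun k hk => by
    have hkd : k ≤ d := Nat.lt_succ_iff.1 (Finset.mem_range.1 hk)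
    have h1 : (1 + e) ^ k ≤ Real.exp (d * e) := by
      calc (1 + e) ^ k ≤ (1 + e) ^ d := pow_le_pow_right₀ (by linarith) hkd
        _ ≤ Real.exp e ^ d := by gcongr; linarith [Real.add_one_le_exp e]
        _ = _ := (Real.exp_nat_mul e d).symm
    -- With `x = d e ≤ 1 / 3`: `exp x ≤ 1 / (1 - x)` and `(1 + 3 x)(1 - x) ≥ 1`.
    have h2 : Real.exp (d * e) ≤ 1 + 3 * d * e := by
      have h3 : 1 - d * e ≤ Real.exp (-(d * e)) := by linarith [Real.add_one_le_exp (-(d * e))]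
      rw [Real.exp_neg] at h3
      have h4 : 0 < Real.exp (d * e) := Real.exp_pos _
      have h5 : (1 - d * e) * Real.exp (d * e) ≤ 1 := by
        calc _ ≤ (Real.exp (d * e))⁻¹ * Real.exp (d * e) := by gcongr
          _ = 1 := inv_mul_cancel₀ h4.ne'
      have h6 : 0 ≤ (d : ℝ) * e := by positivity
      have h7 : 1 ≤ (1 + 3 * d * e) * (1 - d * e) := by nlinarith
      have h8 : 0 < 1 - d * e := by linarith
      by_contra hcon
      push Not at hcon
      nlinarith
    linarith [abs_pow_sub_pow_le ht hz k]
  rw [kernelValue, kernelValue, ← sub_div, ← Finset.sum_sub_distrib, abs_div,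
    abs_of_pos (by positivity : (0 : ℝ) < d + 1), div_le_iff₀ (by positivity)]
  calc _ ≤ ∑ k ∈ Finset.range (d + 1), |z ^ k - t ^ k| := Finset.abs_sum_le_sum_abs _ _
    _ ≤ ∑ k ∈ Finset.range (d + 1), 3 * d * e := Finset.sum_le_sum hpow
    _ = _ := by rw [Finset.sum_const, Finset.card_range, nsmul_eq_mul]; push_cast; ring

/-- The computation of all approximate kernel values of the rows of `a` and `x`. -/
def gram {m₁ m₂ : ℕ} (N k d : ℕ) (a : Fin m₂ → Fin n → ℝ) (x : Fin m₁ → Fin n → ℝ) :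
    Prog (Fin m₂ → Fin m₁ → ℝ) :=
  tabulate m₂ fun i => do
    let S ← prepare (a i)
    tabulate m₁ fun j => do
      let z ← estimateInner N k S (x j)
      kernelOfInner d z

variable {m₁ m₂ : ℕ}

theorem measurableProg_gram {X : Type} [MeasurableSpace X] {a : X → Fin m₂ → Fin n → ℝ}
    {x : X → Fin m₁ → Fin n → ℝ} (ha : Measurable a) (hx : Measurable x) (N k d : ℕ) :
    MeasurableProg u fun q => gram N k d (a q) (x q) := by
  refine .tabulate fun i => .returns_bind (fun q => returns_prepare (a q i)) (.tabulate fun j =>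
    .bind (measurableProg_estimateInner ((measurable_pi_apply i).comp ha)
      ((measurable_pi_apply j).comp hx) N k) (.of_returns (fun _ => returns_kernelOfInner d _) ?_))
  exact (measurable_kernelValue d).comp measurable_snd

theorem costs_gram (N k d : ℕ) (a : Fin m₂ → Fin n → ℝ) (x : Fin m₁ → Fin n → ℝ) :
    Costs u (gram N k d a x) (m₂ * (3 * n + m₁ * (k * (N * (6 + 2 * Nat.clog 2 (n - 1 + 1)) + 2) +
      (3 * k * Nat.clog 2 k + k) + 3 + (3 * d + 1) + 1) + 1)) fun _ => True := by
  refine Costs.tabulate fun i => (costs_prepare (a i)).bind fun S hS => ?_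
  subst hS
  exact Costs.tabulate fun j => (costs_estimateInner _ _ N k).bind fun z _ =>
    costs_kernelOfInner d z

theorem wp_gram_sum_le (N k d : ℕ) (a : Fin m₂ → Fin n → ℝ) (x : Fin m₁ → Fin n → ℝ)
    (F : Fin m₂ → Fin m₁ → ℝ → ℝ≥0∞) :
    wp u (gram N k d a x) (fun K => ∑ i, ∑ j, F i j (K i j)) ≤
      ∑ i, ∑ j, wp u (do
        let z ← estimateInner N k (prepared (a i)) (x j)
        kernelOfInner d z) (F i j) := by
  refine (wp_tabulate_le _ (fun i (K : Fin m₁ → ℝ) => ∑ j, F i j (K j))).trans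
    (Finset.sum_le_sum fun i _ => ?_)
  rw [(returns_prepare (a i)).wp_bind]
  exact wp_tabulate_le _ (F i)

/-- The expected number of inaccurate kernel values. -/
theorem wp_gram_le (d : ℕ) {a : Fin m₂ → Fin n → ℝ} {x : Fin m₁ → Fin n → ℝ}
    (ha : ∀ i, ∑ l, a i l ^ 2 ≤ 1) (hx : ∀ j, ∑ l, x j l ^ 2 ≤ 1) {e q : ℝ} (he : 0 < e)
    (hde : 3 * d * e ≤ 1) (hq : 0 < q) (hq1 : q < 1) :
    wp u (gram (meanSize e) (numMeans q) d a x) (fun K => ∑ i, ∑ j,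
      {z | 3 * d * e < |z - kernelValue d (∑ l, a i l * x j l)|}.indicator 1 (K i j)) ≤
      m₂ * m₁ * ENNReal.ofReal q := by
  have hentry : ∀ i j, wp u (do
      let z ← estimateInner (meanSize e) (numMeans q) (prepared (a i)) (x j)
      kernelOfInner d z)
      ({z | 3 * d * e < |z - kernelValue d (∑ l, a i l * x j l)|}.indicator 1) ≤
      ENNReal.ofReal q := fun i j => by
    refine le_trans ?_ (wp_estimateInner_far_le (u := u) (a i) (x j) (ha i) (hx j) he hq hq1)
    rw [wp_bind]
    refine wp_mono _ fun z => ?_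
    rw [(returns_kernelOfInner d z).wp]
    have ht : |∑ l, a i l * x j l| ≤ 1 := by
      rw [← sq_le_one_iff_abs_le_one]
      refine (Finset.sum_mul_sq_le_sq_mul_sq _ _ _).trans ?_
      exact mul_le_one₀ (ha i) (Finset.sum_nonneg fun _ _ => sq_nonneg _) (hx j)
    by_cases hz : |z - ∑ l, a i l * x j l| ≤ e
    · rw [Set.indicator_of_notMem]
      · exact bot_le
      · exact not_lt.2 (abs_kernelValue_sub_le ht hz hde)
    · rw [Set.indicator_of_mem (show z ∈ {z | e < |z - ∑ l, a i l * x j l|} from not_le.1 hz)]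
      exact Set.indicator_le_self' (fun _ _ => bot_le) _
  refine (wp_gram_sum_le _ _ d a x fun i j =>
    {z | 3 * d * e < |z - kernelValue d (∑ l, a i l * x j l)|}.indicator 1).trans ?_
  refine (Finset.sum_le_sum fun i _ => Finset.sum_le_sum fun j _ => hentry i j).trans ?_
  simp [mul_assoc]

/-! ### Training and validation -/

/-- One update of the coefficients. -/
def updateValue (u : ℝ → ℝ) (lam : ℝ) (y : Fin m₁ → ℝ) (K : Fin m₁ → Fin m₁ → ℝ)
    (α : Fin m₁ → ℝ) : Fin m₁ → ℝ :=
  fun i => α i + lam / m₁ * (y i - u (∑ j, α j * K i j))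

/-- The coefficients after `t` updates from `0`. -/
def coeff (u : ℝ → ℝ) (lam : ℝ) (y : Fin m₁ → ℝ) (K : Fin m₁ → Fin m₁ → ℝ) (t : ℕ) :
    Fin m₁ → ℝ := (updateValue u lam y K)^[t] 0

theorem returns_update (lam : ℝ) (y : Fin m₁ → ℝ) (K : Fin m₁ → Fin m₁ → ℝ) (α : Fin m₁ → ℝ) :
    Returns u (update lam y K α) (updateValue u lam y K α) :=
  Returns.tabulate fun _ => (returns_dot _ _).bind ((returns_apply _).bind
    ((returns_minus _ _).bind ((returns_divide _ _).bind ((returns_times _ _).bind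
      (returns_plus _ _)))))

theorem returns_train (lam : ℝ) (y : Fin m₁ → ℝ) (K : Fin m₁ → Fin m₁ → ℝ) (T : ℕ)
    (α : Fin m₁ → ℝ) : Returns u (train lam y K T α)
      ((List.range T).map fun t => (updateValue u lam y K)^[t] α) := by
  induction T generalizing α with
  | zero => rfl
  | succ T ih =>
    refine (returns_spend 1).bind ((returns_update lam y K α).bind ((ih _).bind ?_))
    rw [List.range_succ_eq_map, List.map_cons, List.map_map]
    rfl

theorem costs_dot {m : ℕ} (v w : Fin m → ℝ) : Costs u (dot v w) (m * 3) fun _ => True :=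
  Costs.total fun _ => costs_times _ _

theorem costs_train (lam : ℝ) (y : Fin m₁ → ℝ) (K : Fin m₁ → Fin m₁ → ℝ) (T : ℕ)
    (α : Fin m₁ → ℝ) : Costs u (train lam y K T α) (T * (m₁ * (m₁ * 3 + 6) + 1))
      fun l => l.length = T := by
  induction T generalizing α with
  | zero => exact (costs_pure (Q := fun l : List (Fin m₁ → ℝ) => l.length = 0) rfl).mono (by simp)
  | succ T ih =>
    refine Costs.mono ((costs_spend 1).bind fun _ _ => Costs.bind (Q := fun _ => True)
      (Costs.tabulate fun _ => (costs_dot _ _).bind fun _ _ => (costs_apply _).bind fun _ _ =>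
        (costs_minus _ _).bind fun _ _ => (costs_divide _ _).bind fun _ _ =>
          (costs_times _ _).bind fun _ _ => costs_plus _ _) fun β _ => (ih β).bind fun l hl =>
            costs_pure (by simp [hl])) ?_
    rw [Nat.add_mul T 1]
    have : m₁ * (m₁ * 3 + (1 + (1 + (1 + (1 + 1)))) + 1) = m₁ * (m₁ * 3 + 6) := by
      congr 1
    omega

/-- The empirical validation error of the coefficients `α`. -/
def validationValue (u : ℝ → ℝ) (b : Fin m₂ → ℝ) (K' : Fin m₂ → Fin m₁ → ℝ) (α : Fin m₁ → ℝ) :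
    ℝ := (∑ i, (u (∑ j, α j * K' i j) - b i) * (u (∑ j, α j * K' i j) - b i)) / m₂

theorem returns_validationError (b : Fin m₂ → ℝ) (K' : Fin m₂ → Fin m₁ → ℝ) (α : Fin m₁ → ℝ) :
    Returns u (validationError b K' α) (validationValue u b K' α) :=
  (Returns.total fun _ => (returns_dot _ _).bind ((returns_apply _).bind
    ((returns_minus _ _).bind (returns_times _ _)))).bind (returns_divide _ _)

theorem costs_validationError (b : Fin m₂ → ℝ) (K' : Fin m₂ → Fin m₁ → ℝ) (α : Fin m₁ → ℝ) :
    Costs u (validationError b K' α) (m₂ * (m₁ * 3 + 5) + 1) fun _ => True :=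
  ((Costs.total fun _ => (costs_dot _ _).bind fun _ _ => (costs_apply _).bind fun _ _ =>
    (costs_minus _ _).bind fun _ _ => costs_times _ _).bind fun _ _ => costs_divide _ _)

/-- The invariant is that the stored error is the validation error of the stored vector. Only
minimality is recorded; that the first minimizer is chosen plays no role for the error bound. -/
theorem selectFrom_spec (b : Fin m₂ → ℝ) (K' : Fin m₂ → Fin m₁ → ℝ) (best : Fin m₁ → ℝ)
    (l : List (Fin m₁ → ℝ)) :
    ∃ β ∈ best :: l, Returns u (selectFrom b K' best (validationValue u b K' best) l) β ∧
      ∀ γ ∈ best :: l, validationValue u b K' β ≤ validationValue u b K' γ := by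
  induction l generalizing best with
  | nil => exact ⟨best, by simp, rfl, by simp⟩
  | cons α l ih =>
    by_cases h : validationValue u b K' α < validationValue u b K' best
    · obtain ⟨β, h1, h2, h3⟩ := ih α
      refine ⟨β, List.mem_cons_of_mem _ h1, ?_, fun γ hγ => ?_⟩
      · refine (returns_spend 1).bind ((returns_validationError b K' α).bind
          ((returns_less _ _).bind ?_))
        simpa [h] using h2
      · rcases List.mem_cons.1 hγ with rfl | hγ
        · exact (h3 α (by simp)).trans h.le
        · exact h3 γ hγ
    · obtain ⟨β, h1, h2, h3⟩ := ih best
      refine ⟨β, ?_, ?_, fun γ hγ => ?_⟩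
      · simp only [List.mem_cons] at h1 ⊢; tauto
      · refine (returns_spend 1).bind ((returns_validationError b K' α).bind
          ((returns_less _ _).bind ?_))
        simpa [h] using h2
      · rcases List.mem_cons.1 hγ with rfl | hγ
        · exact h3 _ (by simp)
        · rcases List.mem_cons.1 hγ with rfl | hγ
          · exact (h3 best (by simp)).trans (not_lt.1 h)
          · exact h3 γ (List.mem_cons_of_mem _ hγ)

theorem costs_select (b : Fin m₂ → ℝ) (K' : Fin m₂ → Fin m₁ → ℝ) (l : List (Fin m₁ → ℝ)) :
    Costs u (select b K' l) (l.length * (m₂ * (m₁ * 3 + 5) + 3)) fun _ => True := by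
  have h : ∀ (l : List (Fin m₁ → ℝ)) best err, Costs u (selectFrom b K' best err l)
      (l.length * (m₂ * (m₁ * 3 + 5) + 3)) fun _ => True := by
    intro l
    induction l with
    | nil => exact fun _ _ => (costs_pure trivial).mono (Nat.zero_le _)
    | cons α l ih =>
      intro best err
      refine Costs.mono ((costs_spend 1).bind fun _ _ => (costs_validationError b K' α).bind
        fun e _ => (costs_less _ _).bind fun c _ => (ih _ _).ite (ih _ _)) ?_
      rw [List.length_cons, Nat.add_mul _ 1]; omega
  cases l with
  | nil => exact (costs_pure trivial).mono (Nat.zero_le _)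
  | cons α l =>
    refine Costs.mono ((costs_validationError b K' α).bind fun e _ => h l α e) ?_
    rw [List.length_cons, Nat.add_mul _ 1]; omega

/-- The output is the vector of coefficients of smallest validation error. -/
theorem alphatronWithKernel_spec {T : ℕ} (hT : 0 < T) (lam : ℝ) (y : Fin m₁ → ℝ)
    (b : Fin m₂ → ℝ) (K : Fin m₁ → Fin m₁ → ℝ) (K' : Fin m₂ → Fin m₁ → ℝ) :
    ∃ t < T, Returns u (alphatronWithKernel T lam y b K K') (coeff u lam y K t) ∧
      ∀ s < T, validationValue u b K' (coeff u lam y K t) ≤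
        validationValue u b K' (coeff u lam y K s) := by
  have ht := returns_train (u := u) lam y K T 0
  obtain ⟨T, rfl⟩ := Nat.exists_eq_succ_of_ne_zero hT.ne'
  have hl : ((List.range (T + 1)).map fun t => (updateValue u lam y K)^[t] 0) =
      coeff u lam y K 0 :: ((List.range T).map fun t => coeff u lam y K (t + 1)) := by
    rw [List.range_succ_eq_map, List.map_cons, List.map_map]; rfl
  obtain ⟨β, h1, h2, h3⟩ := selectFrom_spec (u := u) b K' (coeff u lam y K 0)
    ((List.range T).map fun t => coeff u lam y K (t + 1))
  rw [← hl] at h1 h3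
  obtain ⟨t, ht', rfl⟩ := List.mem_map.1 h1
  refine ⟨t, List.mem_range.1 ht', ht.bind ?_, fun s hs =>
    h3 _ (List.mem_map_of_mem (List.mem_range.2 hs))⟩
  rw [hl]
  exact (returns_validationError _ _ _).bind h2

theorem costs_alphatronWithKernel (T : ℕ) (lam : ℝ) (y : Fin m₁ → ℝ)
    (b : Fin m₂ → ℝ) (K : Fin m₁ → Fin m₁ → ℝ) (K' : Fin m₂ → Fin m₁ → ℝ) :
    Costs u (alphatronWithKernel T lam y b K K')
      (T * (m₁ * (m₁ * 3 + 6) + 1) + T * (m₂ * (m₁ * 3 + 5) + 3)) fun _ => True :=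
  (costs_train lam y K T 0).bind fun l hl => hl ▸ costs_select b K' l

end

end Alphatron

namespace Alphatron

open Prog
open scoped ENNReal

noncomputable section

variable {u : ℝ → ℝ} {n m₁ m₂ : ℕ}

/-! ### The number of steps -/

theorem alphatronWithApproxPre_eq (d T : ℕ) (lam εK δK : ℝ) (x : Fin m₁ → Fin n → ℝ)
    (y : Fin m₁ → ℝ) (a : Fin m₂ → Fin n → ℝ) (b : Fin m₂ → ℝ) :
    alphatronWithApproxPre d T lam εK δK x y a b =
      gram (meanSize (εK / (3 * d))) (numMeans (δK / (m₁ ^ 2 + m₁ * m₂))) d x x >>= fun K =>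
        gram (meanSize (εK / (3 * d))) (numMeans (δK / (m₁ ^ 2 + m₁ * m₂))) d a x >>= fun K' =>
          alphatronWithKernel T lam y b K K' := rfl

/-- `2 ^ (clog k - 1) < k`, and `log 2 > 1 / 2`. -/
theorem clog_two_le {k : ℕ} (hk : 1 ≤ k) : (Nat.clog 2 k : ℝ) ≤ 2 * Real.log k + 1 := by
  rcases hk.eq_or_lt with rfl | hk
  · simp
  · have h1 : (2 : ℝ) ^ (Nat.clog 2 k).pred < k := by
      exact_mod_cast Nat.pow_pred_clog_lt_self one_lt_two hk
    have h2 := Real.log_lt_log (by positivity) h1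
    rw [Real.log_pow] at h2
    have h3 : ((Nat.clog 2 k).pred : ℝ) = Nat.clog 2 k - 1 := by
      rw [Nat.pred_eq_sub_one, Nat.cast_sub (Nat.clog_pos one_lt_two hk)]; simp
    rw [h3] at h2
    have h4 : (1 : ℝ) ≤ Nat.clog 2 k := by exact_mod_cast Nat.clog_pos one_lt_two hk
    have h5 := Real.log_two_gt_d9
    nlinarith

theorem one_le_log {x : ℝ} (hx : 3 ≤ x) : 1 ≤ Real.log x := by
  rw [Real.le_log_iff_exp_le (by linarith)]
  linarith [Real.exp_one_lt_d9]

/-- The parts of the step count in terms of the quantities that bound them. -/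
theorem step_count_le {m a₁ a₂ n d T k N c ck X l G g : ℝ} (hm : m = a₁ + a₂) (ha₁ : 1 ≤ a₁)
    (ha₂ : 0 ≤ a₂) (hn : 0 ≤ n) (hT : 1 ≤ T) (hX : 1 ≤ X) (hd : d ≤ X) (hl : 1 ≤ l)
    (hG : 1 ≤ G) (hk0 : 0 ≤ k) (hN0 : 0 ≤ N) (hN : N ≤ 42 * X) (hk : k ≤ 19 * (G * l))
    (hc0 : 0 ≤ c) (hc : c ≤ 3 * G) (hck : ck ≤ 11 * G) (hg : g = m * n + m ^ 2 * X * l + T * m ^ 2) :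
    a₁ * (3 * n + a₁ * (k * (N * (6 + 2 * c) + 2) + (3 * k * ck + k) + 3 + (3 * d + 1) + 1) + 1) +
      (a₂ * (3 * n + a₁ * (k * (N * (6 + 2 * c) + 2) + (3 * k * ck + k) + 3 + (3 * d + 1) + 1) + 1)
        + (T * (a₁ * (a₁ * 3 + 6) + 1) + T * (a₂ * (a₁ * 3 + 5) + 3))) ≤ 10500 * g * G ^ 2 := by
  have hGl : 1 ≤ G * l := one_le_mul_of_one_le_of_one_le hG hl
  have hm1 : 1 ≤ m := by linarith
  have hN' : N * (6 + 2 * c) ≤ 42 * X * (12 * G) := by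
    calc N * (6 + 2 * c) ≤ N * (12 * G) := by gcongr; linarith
      _ ≤ _ := by gcongr
  have hXG : 1 ≤ X * G := one_le_mul_of_one_le_of_one_le hX hG
  -- `506 = 42 · 12 + 2`.
  have h1 : k * (N * (6 + 2 * c) + 2) ≤ 19 * (G * l) * (506 * (X * G)) := by
    have : 0 ≤ N * (6 + 2 * c) := by positivity
    gcongr ?_ * ?_
    linarith
  have h2 : 3 * k * ck ≤ 3 * (19 * (G * l)) * (11 * G) := by
    calc 3 * k * ck ≤ 3 * k * (11 * G) := by gcongr
      _ ≤ _ := by gcongr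
  -- `U` dominates every part of the cost of one kernel entry: sampling, sorting, and evaluation of
  -- the polynomial.
  set U := X * l * G ^ 2 with hU
  have hlU : G * l * G ≤ U := by
    rw [hU]; nlinarith [mul_nonneg (sub_nonneg.2 hX) (by positivity : 0 ≤ l * G ^ 2)]
  have hGlU : G * l ≤ U := (le_mul_of_one_le_right (by positivity) hG).trans hlU
  have hXU : X ≤ U := by nlinarith [mul_le_mul_of_nonneg_left hGl (by linarith : 0 ≤ X)]
  -- `9614` for sampling, `627 + 19` for the median and `8` for the rest, rounded up.
  have hP : k * (N * (6 + 2 * c) + 2) + (3 * k * ck + k) + 3 + (3 * d + 1) + 1 ≤ 10400 * U := by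
    have : 19 * (G * l) * (506 * (X * G)) = 9614 * U := by rw [hU]; ring
    have : 3 * (19 * (G * l)) * (11 * G) = 627 * (G * l * G) := by ring
    linarith
  set P := k * (N * (6 + 2 * c) + 2) + (3 * k * ck + k) + 3 + (3 * d + 1) + 1
  have ha₁m : a₁ ≤ m := by linarith
  have hU0 : 0 ≤ U := by linarith
  have h3 : m * (a₁ * P) ≤ 10400 * (m ^ 2 * U) := by
    calc m * (a₁ * P) ≤ m * (m * (10400 * U)) := by
          refine mul_le_mul_of_nonneg_left ?_ (by linarith)
          exact (mul_le_mul_of_nonneg_left hP (by linarith)).trans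
            (mul_le_mul_of_nonneg_right ha₁m (by positivity))
      _ = _ := by ring
  have hmm : m ≤ m ^ 2 := by nlinarith
  have h4 : a₁ * (a₁ * 3 + 6) + 1 + (a₂ * (a₁ * 3 + 5) + 3) ≤ 13 * m ^ 2 := by
    have : a₁ * a₁ + a₂ * a₁ ≤ m ^ 2 := by rw [hm]; nlinarith
    nlinarith
  have h5 : T * (a₁ * (a₁ * 3 + 6) + 1) + T * (a₂ * (a₁ * 3 + 5) + 3) ≤ 13 * (T * m ^ 2) := by
    calc _ = T * (a₁ * (a₁ * 3 + 6) + 1 + (a₂ * (a₁ * 3 + 5) + 3)) := by ring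
      _ ≤ T * (13 * m ^ 2) := by gcongr
      _ = _ := by ring
  have h6 : m ≤ T * m ^ 2 := by nlinarith
  have h7 : (1 : ℝ) ≤ G ^ 2 := one_le_pow₀ hG
  have h8 : m * n ≤ m * n * G ^ 2 := le_mul_of_one_le_right (by positivity) h7
  have h9 : T * m ^ 2 ≤ T * m ^ 2 * G ^ 2 := le_mul_of_one_le_right (by positivity) h7
  have h10 : 10500 * g * G ^ 2 =
      10500 * (m * n * G ^ 2) + 10500 * (m ^ 2 * U) + 10500 * (T * m ^ 2 * G ^ 2) := by
    rw [hg, hU]; ring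
  have h11 : 0 ≤ m ^ 2 * U := by positivity
  have h12 : 0 ≤ m * n := by positivity
  rw [h10]
  have h13 : a₁ * (3 * n + a₁ * P + 1) + a₂ * (3 * n + a₁ * P + 1) =
      3 * (m * n) + m * (a₁ * P) + m := by rw [hm]; ring
  linarith

/-- The numbers of examples, the dimension and `log(1 / δ)` are all at most `g`, so `G = log(2 + g)`
absorbs all logarithms. The assumption `L √ε ≤ 1` yields `d ≤ X`, hence `X ≥ 1`, which absorbs
rounding and the cost of the polynomial. -/
theorem steps_le (d T : ℕ) (L ε δ : ℝ) (x : Fin m₁ → Fin n → ℝ) (y : Fin m₁ → ℝ)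
    (a : Fin m₂ → Fin n → ℝ) (b : Fin m₂ → ℝ) (hd : 1 ≤ d) (hm₁ : 1 ≤ m₁) (hT : 1 ≤ T)
    (hL : 0 < L) (hε : 0 < ε) (hδ : 0 < δ) (hδ' : δ < 1 / 3) (hLε : L * √ε ≤ 1)
    (ω : ℕ → unitInterval) :
    ((exec u (alphatronWithApproxPre d T (1 / L) (L * √ε / T) δ x y a b) ω).steps : ℝ) ≤
      10500 * costBound (m₁ + m₂) n d T L ε δ *
        Real.log (2 + costBound (m₁ + m₂) n d T L ε δ) ^ 2 := by
  set N := meanSize (L * √ε / T / (3 * d)) with hN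
  set k := numMeans (δ / (m₁ ^ 2 + m₁ * m₂)) with hk
  set g := costBound (m₁ + m₂) n d T L ε δ with hg
  set X : ℝ := (d : ℝ) ^ 2 * T ^ 2 / (L ^ 2 * ε) with hX
  set l := Real.log (1 / δ) with hl
  have hm₁' : (1 : ℝ) ≤ m₁ := by exact_mod_cast hm₁
  have hd' : (1 : ℝ) ≤ d := by exact_mod_cast hd
  have hT' : (1 : ℝ) ≤ T := by exact_mod_cast hT
  have hm : (1 : ℝ) ≤ (m₁ : ℝ) + m₂ := by linarith [(Nat.cast_nonneg m₂ : (0 : ℝ) ≤ m₂)]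
  have hLε2 : L ^ 2 * ε ≤ 1 := by
    have : (L * √ε) ^ 2 ≤ 1 := pow_le_one₀ (by positivity) hLε
    rwa [mul_pow, Real.sq_sqrt hε.le] at this
  have hdT : (d : ℝ) ≤ d ^ 2 * T ^ 2 := by
    have : (1 : ℝ) ≤ T ^ 2 := one_le_pow₀ hT'
    nlinarith
  have hdX : (d : ℝ) ≤ X := by
    rw [hX, le_div_iff₀ (by positivity)]
    calc (d : ℝ) * (L ^ 2 * ε) ≤ d * 1 := by gcongr
      _ ≤ _ := by linarith
  have hX1 : 1 ≤ X := hd'.trans hdX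
  have h1δ : 3 ≤ 1 / δ := by rw [le_div_iff₀ hδ]; linarith
  have hl1 : 1 ≤ l := one_le_log h1δ
  have hgeq : g = ((m₁ : ℝ) + m₂) * n + ((m₁ : ℝ) + m₂) ^ 2 * X * l + T * ((m₁ : ℝ) + m₂) ^ 2 := by
    rw [hg, costBound, hX]; push_cast; ring
  have hmm : (m₁ : ℝ) + m₂ ≤ ((m₁ : ℝ) + m₂) ^ 2 := by nlinarith
  have hmg : (m₁ : ℝ) + m₂ ≤ g := by
    have h1 : 0 ≤ ((m₁ : ℝ) + m₂) * n := by positivity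
    have h2 : 0 ≤ ((m₁ : ℝ) + m₂) ^ 2 * X * l := by positivity
    have h3 : ((m₁ : ℝ) + m₂) ^ 2 ≤ T * ((m₁ : ℝ) + m₂) ^ 2 :=
      le_mul_of_one_le_left (by positivity) hT'
    linarith
  have hlg : l ≤ g := by
    have h1 : 0 ≤ ((m₁ : ℝ) + m₂) * n := by positivity
    have h2 : l ≤ ((m₁ : ℝ) + m₂) ^ 2 * X * l :=
      le_mul_of_one_le_left (by linarith)
        (one_le_mul_of_one_le_of_one_le (hm.trans hmm) hX1)
    have h3 : 0 ≤ T * ((m₁ : ℝ) + m₂) ^ 2 := by positivity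
    linarith
  have hng : (n : ℝ) ≤ g := by
    have h1 : (n : ℝ) ≤ ((m₁ : ℝ) + m₂) * n := le_mul_of_one_le_left (by positivity) hm
    have h2 : 0 ≤ ((m₁ : ℝ) + m₂) ^ 2 * X * l := by positivity
    have h3 : 0 ≤ T * ((m₁ : ℝ) + m₂) ^ 2 := by positivity
    linarith
  set G := Real.log (2 + g) with hG
  have hG1 : 1 ≤ G := one_le_log (by linarith)
  -- `9 / (2 e²)` with `e = L √ε / (3 d T)` is `81 / 2` times `X`; rounding up adds at most `X`.
  have hN' : (N : ℝ) ≤ 42 * X := by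
    have h1 : 9 / (2 * (L * √ε / T / (3 * d)) ^ 2) = 40.5 * X := by
      rw [hX, div_pow, div_pow, mul_pow, Real.sq_sqrt hε.le]
      field_simp; norm_num
    have h2 := (Nat.ceil_lt_add_one (by positivity :
      0 ≤ 9 / (2 * (L * √ε / T / (3 * d)) ^ 2))).le
    rw [hN, meanSize]
    linarith
  have hlogm : Real.log ((m₁ : ℝ) + m₂) ≤ G := Real.log_le_log (by linarith) (by linarith)
  have hGl : G ≤ G * l := le_mul_of_one_le_right (by linarith) hl1
  have hGl' : l ≤ G * l := le_mul_of_one_le_left (by linarith) hG1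
  -- The logarithm splits into those of `m₁`, `m₁ + m₂` and `1 / δ`, each at most `G l`; then `6 · 3
  -- + 1 = 19`.
  have hk' : (k : ℝ) ≤ 19 * (G * l) := by
    have h1 : Real.log (1 / (δ / ((m₁ : ℝ) ^ 2 + m₁ * m₂))) =
        Real.log m₁ + Real.log ((m₁ : ℝ) + m₂) + l := by
      rw [hl, ← Real.log_mul (by positivity) (by positivity),
        ← Real.log_mul (by positivity) (by positivity)]
      congr 1; field_simp
    have h2 : Real.log m₁ ≤ G := Real.log_le_log (by linarith)
      (by linarith [(Nat.cast_nonneg m₂ : (0 : ℝ) ≤ m₂)])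
    have h0 : 0 ≤ Real.log m₁ := Real.log_nonneg hm₁'
    have h0' : 0 ≤ Real.log ((m₁ : ℝ) + m₂) := Real.log_nonneg hm
    have h3 := (Nat.ceil_lt_add_one (by rw [h1]; positivity :
      0 ≤ 6 * Real.log (1 / (δ / ((m₁ : ℝ) ^ 2 + m₁ * m₂))))).le
    rw [hk, numMeans]
    rw [h1] at h3 ⊢
    linarith
  have hc : (Nat.clog 2 (n - 1 + 1) : ℝ) ≤ 3 * G := by
    refine (clog_two_le (by omega)).trans ?_
    have : Real.log ((n - 1 + 1 : ℕ) : ℝ) ≤ G := by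
      refine Real.log_le_log (by positivity) ?_
      have : n - 1 + 1 ≤ n + 1 := by omega
      have : ((n - 1 + 1 : ℕ) : ℝ) ≤ n + 1 := by exact_mod_cast this
      linarith
    linarith
  -- `log k ≤ log 19 + log G + log l ≤ 3 + 2 G`, so the ceiling is at most `2 (3 + 2 G) + 1 ≤ 11 G`.
  have hck : (Nat.clog 2 k : ℝ) ≤ 11 * G := by
    rcases Nat.eq_zero_or_pos k with h0 | h0
    · rw [h0]; simp; linarith
    · refine (clog_two_le h0).trans ?_
      have h1 : Real.log k ≤ Real.log (19 * (G * l)) :=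
        Real.log_le_log (by exact_mod_cast h0) hk'
      rw [Real.log_mul (by norm_num) (by positivity), Real.log_mul (by positivity) (by positivity)]
        at h1
      have h2 : Real.log 19 ≤ 3 := by
        rw [Real.log_le_iff_le_exp (by norm_num), show (3 : ℝ) = (3 : ℕ) * 1 by norm_num,
          Real.exp_nat_mul]
        calc (19 : ℝ) ≤ 2.7182818283 ^ 3 := by norm_num
          _ ≤ _ := by gcongr; exact Real.exp_one_gt_d9.le
      have h3 : Real.log G ≤ G := (Real.log_le_sub_one_of_pos (by linarith)).trans (by linarith)
      have h4 : Real.log l ≤ G := Real.log_le_log (by linarith) (by linarith)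
      linarith
  have hcost := (((costs_gram (u := u) N k d x x).bind fun K _ => (costs_gram N k d a x).bind
    fun K' _ => costs_alphatronWithKernel T (1 / L) y b K K') ω).1
  rw [alphatronWithApproxPre_eq]
  refine (Nat.cast_le.2 hcost).trans ?_
  push_cast
  exact step_count_le (m := (m₁ : ℝ) + m₂) rfl hm₁' (Nat.cast_nonneg _) (Nat.cast_nonneg _) hT' hX1
    hdX hl1 hG1 (Nat.cast_nonneg _) (Nat.cast_nonneg _) hN' hk' (Nat.cast_nonneg _) hc hck hgeq

end

end Alphatron

namespace Alphatron

open scoped ENNReal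

noncomputable section

/-! ### Sums of independent bounded vectors -/

section Concentration

variable {Ω : Type*} [MeasurableSpace Ω]

theorem lintegral_pi_succ (D : Measure Ω) [IsProbabilityMeasure D] {m : ℕ}
    {f : (Fin (m + 1) → Ω) → ℝ≥0∞} (hf : Measurable f) :
    ∫⁻ x, f x ∂(Measure.pi fun _ => D) =
      ∫⁻ a, ∫⁻ x, f (Fin.cons a x) ∂(Measure.pi fun _ => D) ∂D := by
  have h := (measurePreserving_piFinSuccAbove (fun _ : Fin (m + 1) => D) 0).symm
  rw [← h.lintegral_comp hf, lintegral_prod]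
  · simp [MeasurableEquiv.piFinSuccAbove, Fin.insertNthEquiv]
  · exact (hf.comp h.measurable).aemeasurable

/-- `cosh √r = ∑ r^k / (2k)!` is a series of functions that are convex on `[0, ∞)`. -/
theorem cosh_sqrt_convex {p s t : ℝ} (hp : 0 ≤ p) (hp1 : p ≤ 1) (hs : 0 ≤ s) (ht : 0 ≤ t) :
    Real.cosh √(p * s + (1 - p) * t) ≤ p * Real.cosh √s + (1 - p) * Real.cosh √t := by
  have h : ∀ r : ℝ, 0 ≤ r →
      HasSum (fun k : ℕ => r ^ k / ((2 * k).factorial : ℝ)) (Real.cosh √r) := fun r hr => by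
    have := Real.hasSum_cosh √r
    simpa only [pow_mul, Real.sq_sqrt hr] using this
  refine hasSum_le (fun k => ?_) (h _ (add_nonneg (mul_nonneg hp hs)
    (mul_nonneg (sub_nonneg.2 hp1) ht))) (((h s hs).mul_left p).add ((h t ht).mul_left (1 - p)))
  rw [← mul_div_assoc, ← mul_div_assoc, ← add_div]
  gcongr
  exact (convexOn_pow k).2 hs ht hp (sub_nonneg.2 hp1) (by ring)

variable {E : Type*} [NormedAddCommGroup E] [InnerProductSpace ℝ E]

/-- With `a = ‖x‖`, the bound `a² + c² + 2⟨x, z⟩` for `‖x + z‖²` is a convex combination of `(a +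
c)²` and `(a - c)²`. Convexity of `cosh √` and the addition formulas give a bound that is affine in
`z`, so for centred `z` only the factor `cosh c` survives in expectation. -/
theorem cosh_norm_add_le (x z : E) {c : ℝ} (hc : 0 < c) (hz : ‖z‖ ≤ c) :
    Real.cosh ‖x + z‖ ≤ Real.cosh ‖x‖ * Real.cosh c +
      Real.sinh ‖x‖ * Real.sinh c / (‖x‖ * c) * inner ℝ x z := by
  by_cases hx : x = 0
  -- Division by zero makes the linear term vanish here, and `cosh ‖z‖ ≤ cosh c` remains.
  · subst hx
    simpa using hz.trans (le_abs_self c)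
  have ha : 0 < ‖x‖ := norm_pos_iff.2 hx
  set a := ‖x‖
  have hp : |inner ℝ x z| ≤ a * c := (abs_real_inner_le_norm x z).trans (by gcongr)
  set p := (1 + inner ℝ x z / (a * c)) / 2 with hp_def
  have hpp := abs_le.1 hp
  have hac : 0 < a * c := by positivity
  have h1 : inner ℝ x z / (a * c) ≤ 1 := (div_le_one hac).2 hpp.2
  have h2 : -1 ≤ inner ℝ x z / (a * c) := (le_div_iff₀ hac).2 (by linarith)
  have hsq : ‖x + z‖ ≤ √(p * (a + c) ^ 2 + (1 - p) * (a - c) ^ 2) := by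
    refine Real.le_sqrt_of_sq_le ?_
    rw [norm_add_sq_real]
    have h3 : p * (a + c) ^ 2 + (1 - p) * (a - c) ^ 2 = a ^ 2 + c ^ 2 + 2 * inner ℝ x z := by
      rw [hp_def]; field_simp; ring
    rw [h3]
    have : ‖z‖ ^ 2 ≤ c ^ 2 := by gcongr
    linarith
  calc Real.cosh ‖x + z‖ ≤ Real.cosh √(p * (a + c) ^ 2 + (1 - p) * (a - c) ^ 2) := by
        rw [Real.cosh_le_cosh, abs_of_nonneg (norm_nonneg _), abs_of_nonneg (Real.sqrt_nonneg _)]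
        exact hsq
    _ ≤ p * Real.cosh √((a + c) ^ 2) + (1 - p) * Real.cosh √((a - c) ^ 2) :=
        cosh_sqrt_convex (by linarith) (by linarith) (sq_nonneg _) (sq_nonneg _)
    _ = _ := by
        rw [Real.sqrt_sq_eq_abs, Real.sqrt_sq_eq_abs, Real.cosh_abs, Real.cosh_abs, Real.cosh_add,
          Real.cosh_sub, hp_def]
        field_simp; ring

variable [MeasurableSpace E] [BorelSpace E] [FiniteDimensional ℝ E]

/-- Conditioning on one summand after the other: the linear correction has mean zero, so each
summand costs a factor `cosh c`, in any dimension. -/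
theorem lintegral_cosh_sum_le (D : Measure Ω) [IsProbabilityMeasure D] {Z : Ω → E}
    (hZ : Measurable Z) {c : ℝ} (hc : 0 < c) (hZc : ∀ p, ‖Z p‖ ≤ c)
    (hmean : ∀ x, ∫ p, inner ℝ x (Z p) ∂D = 0) (m : ℕ) (x : E) :
    ∫⁻ S : Fin m → Ω, ENNReal.ofReal (Real.cosh ‖x + ∑ i, Z (S i)‖) ∂(Measure.pi fun _ => D) ≤
      ENNReal.ofReal (Real.cosh ‖x‖ * Real.cosh c ^ m) := by
  induction m generalizing x with
  | zero => simp
  | succ m ih =>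
    rw [lintegral_pi_succ]
    · calc _ ≤ ∫⁻ p, ENNReal.ofReal (Real.cosh ‖x + Z p‖ * Real.cosh c ^ m) ∂D := by
            refine lintegral_mono fun p => ?_
            simpa only [Fin.sum_univ_succ, Fin.cons_zero, Fin.cons_succ, ← add_assoc] using
              ih (x + Z p)
        _ ≤ ∫⁻ p, ENNReal.ofReal ((Real.cosh ‖x‖ * Real.cosh c +
              Real.sinh ‖x‖ * Real.sinh c / (‖x‖ * c) * inner ℝ x (Z p)) * Real.cosh c ^ m) ∂D := by
            gcongr with p
            exact cosh_norm_add_le x (Z p) hc (hZc p)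
        _ = _ := by
            have hi : Integrable (fun p => inner ℝ x (Z p)) D := by
              refine Integrable.of_bound (C := ‖x‖ * c) (by fun_prop) (.of_forall fun p => ?_)
              exact (norm_inner_le_norm x (Z p)).trans (by gcongr; exact hZc p)
            rw [← ofReal_integral_eq_lintegral_ofReal]
            · rw [integral_mul_const, integral_add (integrable_const _) (hi.const_mul _),
                integral_const, integral_const_mul, hmean]
              simp only [probReal_univ, smul_eq_mul, one_mul, mul_zero, add_zero]
              congr 1; ring
            · exact ((integrable_const _).add (hi.const_mul _)).mul_const _
            · refine .of_forall fun p => mul_nonneg ?_ (pow_nonneg (Real.cosh_pos c).le m)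
              exact (Real.cosh_pos _).le.trans (cosh_norm_add_le x (Z p) hc (hZc p))
    · fun_prop

/-- Markov's inequality for `cosh (s ‖·‖) ≥ exp (s ‖·‖) / 2`; the `2` in the logarithm comes from
this half. -/
theorem measure_norm_sum_gt_le (D : Measure Ω) [IsProbabilityMeasure D] {Z : Ω → E}
    (hZ : Measurable Z) {c : ℝ} (hc : 0 < c) (hZc : ∀ p, ‖Z p‖ ≤ c)
    (hmean : ∀ x, ∫ p, inner ℝ x (Z p) ∂D = 0) {m : ℕ} (hm : 1 ≤ m) {q : ℝ} (hq : 0 < q)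
    (hq1 : q ≤ 1) :
    Measure.pi (fun _ : Fin m => D) {S | c * √(2 * m * Real.log (2 / q)) < ‖∑ i, Z (S i)‖} ≤
      ENNReal.ofReal q := by
  have hl : 0 < Real.log (2 / q) := Real.log_pos (by rw [lt_div_iff₀ hq]; linarith)
  have hm' : (0 : ℝ) < m := by exact_mod_cast hm
  set l := Real.log (2 / q)
  set r := c * √(2 * m * l) with hr
  have hr0 : 0 < r := by positivity
  have hr2 : r ^ 2 = c ^ 2 * (2 * m * l) := by
    rw [hr, mul_pow, Real.sq_sqrt (by positivity)]
  -- This `s` minimizes the exponent `m (s c)² / 2 - s r`, with minimum `-l`.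
  set s := r / (m * c ^ 2) with hs
  have hs0 : 0 < s := by positivity
  have hE := lintegral_cosh_sum_le D (Z := fun p => s • Z p) (by fun_prop) (c := s * c) (by positivity)
    (fun p => by rw [norm_smul, Real.norm_of_nonneg hs0.le]; gcongr; exact hZc p)
    (fun x => by simp only [inner_smul_right, integral_const_mul, hmean, mul_zero]) m 0
  simp only [zero_add, norm_zero, Real.cosh_zero, one_mul, ← Finset.smul_sum,
    norm_smul, Real.norm_of_nonneg hs0.le] at hE
  have hsub : {S : Fin m → Ω | r < ‖∑ i, Z (S i)‖} ⊆
      {S | ENNReal.ofReal (Real.exp (s * r) / 2) ≤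
        ENNReal.ofReal (Real.cosh (s * ‖∑ i, Z (S i)‖))} := fun S hS => by
    refine ENNReal.ofReal_le_ofReal ?_
    have h1 : Real.exp (s * r) ≤ Real.exp (s * ‖∑ i, Z (S i)‖) := by
      gcongr; exact le_of_lt hS
    rw [Real.cosh_eq]
    linarith [Real.exp_pos (-(s * ‖∑ i, Z (S i)‖))]
  have hpos : ENNReal.ofReal (Real.exp (s * r) / 2) ≠ 0 := by
    simp [Real.exp_pos]
  have hmeas : Measurable fun S : Fin m → Ω =>
      ENNReal.ofReal (Real.cosh (s * ‖∑ i, Z (S i)‖)) := by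
    clear_value s; fun_prop
  refine (measure_mono hsub).trans ((meas_ge_le_lintegral_div hmeas.aemeasurable hpos
    ENNReal.ofReal_ne_top).trans ((ENNReal.div_le_div_right hE _).trans ?_))
  rw [← ENNReal.ofReal_div_of_pos (by positivity)]
  refine ENNReal.ofReal_le_ofReal ?_
  rw [div_le_iff₀ (by positivity)]
  calc Real.cosh (s * c) ^ m ≤ Real.exp ((s * c) ^ 2 / 2) ^ m := by
        gcongr
        exact Real.cosh_le_exp_half_sq _
    _ = Real.exp (s * r - l) := by
        rw [← Real.exp_nat_mul]
        congr 1
        have h1 : s * r = 2 * l := by rw [hs, div_mul_eq_mul_div, ← sq, hr2]; field_simp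
        have h2 : (s * c) ^ 2 = 2 * l / m := by
          rw [mul_pow, hs, div_pow, hr2]; field_simp
        rw [h1, h2]; field_simp; ring
    _ = q * (Real.exp (s * r) / 2) := by
        rw [Real.exp_sub, Real.exp_log (by positivity)]; field_simp

end Concentration

end

end Alphatron

namespace Alphatron

open scoped ENNReal

noncomputable section

/-! ### Uniform convergence over a ball -/

section Uniform

variable {Ω ι : Type*} [MeasurableSpace Ω]

/-- The maximum of the exponentials of finitely many numbers. -/
def supExp (W : Finset ι) (hW : W.Nonempty) (b : ι → ℝ) : ℝ := W.sup' hW fun w => Real.exp (b w)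

variable {W : Finset ι} {hW : W.Nonempty}

theorem supExp_le {b : ι → ℝ} {r : ℝ} (h : ∀ w ∈ W, Real.exp (b w) ≤ r) : supExp W hW b ≤ r :=
  Finset.sup'_le _ _ h

theorem exp_le_supExp (b : ι → ℝ) {w : ι} (h : w ∈ W) : Real.exp (b w) ≤ supExp W hW b :=
  Finset.le_sup' (fun w => Real.exp (b w)) h

theorem supExp_pos (b : ι → ℝ) : 0 < supExp W hW b := by
  obtain ⟨w, hw⟩ := hW
  exact (Real.exp_pos _).trans_le (exp_le_supExp b hw)

theorem measurable_supExp {f : ι → Ω → ℝ} (hf : ∀ w, Measurable (f w)) :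
    Measurable fun x => supExp W hW fun w => f w x := by
  have := Finset.measurable_sup' hW (f := fun w x => Real.exp (f w x))
    fun w _ => (hf w).exp
  convert this using 1
  ext x
  rw [Finset.sup'_apply]; rfl

/-- By convexity, `exp` grows more over a longer interval that starts further to the right. -/
theorem exp_sub_exp_le {a b a' b' : ℝ} (h1 : b ≤ a) (h2 : a - b ≤ a' - b') (h3 : b ≤ b') :
    Real.exp a - Real.exp b ≤ Real.exp a' - Real.exp b' := by
  have e1 : Real.exp a - Real.exp b = Real.exp b * (Real.exp (a - b) - 1) := by
    rw [mul_sub, ← Real.exp_add]; ring_nf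
  have e2 : Real.exp a' - Real.exp b' = Real.exp b' * (Real.exp (a' - b') - 1) := by
    rw [mul_sub, ← Real.exp_add]; ring_nf
  rw [e1, e2]
  have h4 : 0 ≤ Real.exp (a - b) - 1 := by
    linarith [Real.add_one_le_exp (a - b)]
  gcongr

/-- The contraction principle for two points, of which the first maximizes `a + φ` (`h4`) and the
second `a - φ` (`h5`). The larger of `s`, `s'` receives the plus sign; the gain there exceeds the
loss at the other point because it occurs over a longer interval further to the right. -/
theorem exp_contraction_nonneg {A A' φ φ' s s' : ℝ} (h1 : |φ - φ'| ≤ |s - s'|) (h2 : |φ| ≤ |s|)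
    (h3 : |φ'| ≤ |s'|) (h4 : A' + φ' ≤ A + φ) (h5 : A - φ ≤ A' - φ') (hs : 0 ≤ s) (hs' : 0 ≤ s') :
    Real.exp (A + φ) + Real.exp (A' - φ') ≤ Real.exp (A + s) + Real.exp (A' - s') ∨
      Real.exp (A + φ) + Real.exp (A' - φ') ≤ Real.exp (A - s) + Real.exp (A' + s') := by
  rw [abs_of_nonneg hs] at h2
  rw [abs_of_nonneg hs'] at h3
  have h2' := abs_le.1 h2
  have h3' := abs_le.1 h3
  rcases le_total s' s with h | h
  · left
    rw [abs_of_nonneg (sub_nonneg.2 h)] at h1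
    have h1' := abs_le.1 h1
    have := exp_sub_exp_le (a := A' - φ') (b := A' - s') (a' := A + s) (b' := A + φ)
      (by linarith) (by linarith) (by linarith)
    linarith
  · right
    rw [abs_of_nonpos (sub_nonpos.2 h)] at h1
    have h1' := abs_le.1 h1
    have := exp_sub_exp_le (a := A + φ) (b := A - s) (a' := A' + s') (b' := A' - φ')
      (by linarith) (by linarith) (by linarith)
    linarith

/-- For `s`, `s'` of opposite signs each exponential increases separately; two nonpositive numbers
are reflected. -/
theorem exp_contraction {A A' φ φ' s s' : ℝ} (h1 : |φ - φ'| ≤ |s - s'|) (h2 : |φ| ≤ |s|)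
    (h3 : |φ'| ≤ |s'|) (h4 : A' + φ' ≤ A + φ) (h5 : A - φ ≤ A' - φ') :
    Real.exp (A + φ) + Real.exp (A' - φ') ≤ Real.exp (A + s) + Real.exp (A' - s') ∨
      Real.exp (A + φ) + Real.exp (A' - φ') ≤ Real.exp (A - s) + Real.exp (A' + s') := by
  have h2' := abs_le.1 h2
  have h3' := abs_le.1 h3
  rcases le_total 0 s with hs | hs <;> rcases le_total 0 s' with hs' | hs'
  · exact exp_contraction_nonneg h1 h2 h3 h4 h5 hs hs'
  · left
    rw [abs_of_nonneg hs] at h2'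
    rw [abs_of_nonpos hs'] at h3'
    gcongr <;> linarith
  · right
    rw [abs_of_nonpos hs] at h2'
    rw [abs_of_nonneg hs'] at h3'
    gcongr <;> linarith
  · have := exp_contraction_nonneg (s := -s) (s' := -s') (A := A) (A' := A') (φ := φ) (φ' := φ')
      (by rwa [← abs_neg (-s - -s'), neg_sub, sub_neg_eq_add, neg_add_eq_sub])
      (by rwa [abs_neg]) (by rwa [abs_neg]) h4 h5 (by linarith) (by linarith)
    simp only [← sub_eq_add_neg, sub_neg_eq_add] at this
    exact this.symm

/-- The contraction principle for one sign. -/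
theorem supExp_contraction {a φ s : ι → ℝ} (h1 : ∀ w w', |φ w - φ w'| ≤ |s w - s w'|)
    (h2 : ∀ w, |φ w| ≤ |s w|) :
    supExp W hW (fun w => a w + φ w) + supExp W hW (fun w => a w - φ w) ≤
      supExp W hW (fun w => a w + s w) + supExp W hW (fun w => a w - s w) := by
  -- The suprema on the left are attained at `w` and `z`, and both sign patterns of the two-point
  -- inequality are bounded by the same sum of suprema on the right.
  obtain ⟨w, hw, hw'⟩ := W.exists_mem_eq_sup' hW fun w => Real.exp (a w + φ w)
  obtain ⟨z, hz, hz'⟩ := W.exists_mem_eq_sup' hW fun w => Real.exp (a w - φ w)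
  have h4 : a z + φ z ≤ a w + φ w := by
    rw [← Real.exp_le_exp, ← hw']
    exact Finset.le_sup' (fun w => Real.exp (a w + φ w)) hz
  have h5 : a w - φ w ≤ a z - φ z := by
    rw [← Real.exp_le_exp, ← hz']
    exact Finset.le_sup' (fun w => Real.exp (a w - φ w)) hw
  have e1 : supExp W hW (fun w => a w + φ w) = Real.exp (a w + φ w) := hw'
  have e2 : supExp W hW (fun w => a w - φ w) = Real.exp (a z - φ z) := hz'
  rw [e1, e2]
  rcases exp_contraction (h1 w z) (h2 w) (h2 z) h4 h5 with h | h
  · exact h.trans (add_le_add (exp_le_supExp (fun w => a w + s w) hw)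
      (exp_le_supExp (fun w => a w - s w) hz))
  · rw [add_comm (Real.exp (a w - s w))] at h
    exact h.trans (add_le_add (exp_le_supExp (fun w => a w + s w) hz)
      (exp_le_supExp (fun w => a w - s w) hw))

variable (D : Measure Ω) [IsProbabilityMeasure D]

/-- Symmetrization of one summand. -/
theorem lintegral_supExp_le {g : ι → Ω → ℝ} (hg : ∀ w, Measurable (g w))
    (hg0 : ∀ w p, |g w p| ≤ 1) (a : ι → ℝ) (lam : ℝ) :
    ∫⁻ p, ENNReal.ofReal (supExp W hW fun w => a w + lam * (∫ x, g w x ∂D - g w p)) ∂D ≤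
      ∫⁻ p, ENNReal.ofReal ((supExp W hW (fun w => a w + 2 * lam * g w p) +
        supExp W hW (fun w => a w - 2 * lam * g w p)) / 2) ∂D := by
  have hint : ∀ c : ℝ, Integrable (fun p => supExp W hW fun w => a w + c * g w p) D := fun c => by
    refine Integrable.of_bound (C := supExp W hW fun w => a w + |c|)
      (measurable_supExp fun w => ((hg w).const_mul c).const_add _).aestronglyMeasurable
      (.of_forall fun p => ?_)
    rw [Real.norm_of_nonneg (supExp_pos _).le]
    refine supExp_le fun w hw => le_trans ?_ (exp_le_supExp (fun w => a w + |c|) hw)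
    gcongr
    calc c * g w p ≤ |c * g w p| := le_abs_self _
      _ ≤ |c| * 1 := by rw [abs_mul]; gcongr; exact hg0 w p
      _ = _ := mul_one _
  have hgi : ∀ w, Integrable (g w) D := fun w =>
    Integrable.of_bound (C := 1) (hg w).aestronglyMeasurable (.of_forall fun p => hg0 w p)
  have hsub : ∀ p, (supExp W hW fun w => a w - 2 * lam * g w p) =
      supExp W hW fun w => a w + -(2 * lam) * g w p := fun p => by
    congr 1; ext w; ring
  set A := ∫ p, supExp W hW (fun w => a w + 2 * lam * g w p) ∂D
  -- Jensen's inequality replaces the expectation by an independent copy of the example.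
  have hJ : ∀ w ∈ W, Real.exp (a w + 2 * lam * ∫ x, g w x ∂D) ≤ A := fun w hw => by
    have hexp : Integrable (fun p => Real.exp (a w + 2 * lam * g w p)) D := by
      refine (hint (2 * lam)).mono' ((((hg w).const_mul _).const_add _).exp).aestronglyMeasurable
        (.of_forall fun p => ?_)
      rw [Real.norm_of_nonneg (Real.exp_pos _).le]
      exact exp_le_supExp (fun w => a w + 2 * lam * g w p) hw
    have h1 := convexOn_exp.map_integral_le (μ := D) (f := fun p => a w + 2 * lam * g w p)
      Real.continuous_exp.continuousOn isClosed_univ (.of_forall fun _ => trivial)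
      ((integrable_const _).add ((hgi w).const_mul _)) hexp
    rw [integral_add (integrable_const _) ((hgi w).const_mul _), integral_const,
      integral_const_mul] at h1
    simp only [probReal_univ, one_smul] at h1
    exact h1.trans (integral_mono hexp (hint _) fun p =>
      exp_le_supExp (fun w => a w + 2 * lam * g w p) hw)
  -- The exponential is the geometric mean of one factor with the expectation and one with the
  -- sample, both at twice the parameter. The inequality between geometric and arithmetic means
  -- separates the two suprema.
  have hpt : ∀ p, (supExp W hW fun w => a w + lam * (∫ x, g w x ∂D - g w p)) ≤
      (A + supExp W hW fun w => a w - 2 * lam * g w p) / 2 := fun p => by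
    refine supExp_le fun w hw => ?_
    have h1 := hJ w hw
    have h2 := exp_le_supExp (hW := hW) (fun w => a w - 2 * lam * g w p) hw
    have h3 : Real.exp (a w + lam * (∫ x, g w x ∂D - g w p)) =
        Real.exp ((a w + 2 * lam * ∫ x, g w x ∂D) / 2) *
          Real.exp ((a w - 2 * lam * g w p) / 2) := by
      rw [← Real.exp_add]; ring_nf
    have h4 : ∀ x : ℝ, Real.exp x = Real.exp (x / 2) ^ 2 := fun x => by
      rw [← Real.exp_nat_mul]; ring_nf
    rw [h3]
    rw [h4] at h1
    rw [h4] at h2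
    nlinarith [sq_nonneg (Real.exp ((a w + 2 * lam * ∫ x, g w x ∂D) / 2) -
      Real.exp ((a w - 2 * lam * g w p) / 2))]
  calc _ ≤ ∫⁻ p, ENNReal.ofReal ((A + supExp W hW fun w => a w - 2 * lam * g w p) / 2) ∂D :=
        lintegral_mono fun p => ENNReal.ofReal_le_ofReal (hpt p)
    _ = _ := by
        simp only [hsub]
        rw [← ofReal_integral_eq_lintegral_ofReal, ← ofReal_integral_eq_lintegral_ofReal,
          integral_div, integral_div, integral_add (integrable_const _) (hint _),
          integral_add (hint _) (hint _), integral_const]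
        · simp [A]
        · exact ((hint _).add (hint _)).div_const _
        · exact .of_forall fun p => div_nonneg (add_nonneg (supExp_pos _).le (supExp_pos _).le)
            (by norm_num)
        · exact ((integrable_const _).add (hint _)).div_const _
        · refine .of_forall fun p => ?_
          have := (supExp_pos (W := W) (hW := hW) _).trans_le (hpt p)
          simp only [hsub] at this
          exact this.le

variable {E : Type*} [NormedAddCommGroup E] [InnerProductSpace ℝ E]

/-- The linear terms of `cosh_norm_add_le` for the two signs cancel. -/
theorem cosh_add_cosh_le (Z : E) {ψ : E} (hψ : ‖ψ‖ ≤ 1) {t B : ℝ} (hB : 0 < B) (ht : 0 < t) :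
    Real.cosh (B * ‖Z + t • ψ‖) + Real.cosh (B * ‖Z + (-t) • ψ‖) ≤
      2 * (Real.cosh (B * ‖Z‖) * Real.cosh (t * B)) := by
  have hn : ∀ τ : ℝ, |τ| = t → ‖τ • (B • ψ)‖ ≤ t * B := fun τ hτ => by
    rw [norm_smul, norm_smul, Real.norm_eq_abs, hτ, Real.norm_of_nonneg hB.le]
    calc t * (B * ‖ψ‖) ≤ t * (B * 1) := by gcongr
      _ = _ := by ring
  have h3 := cosh_norm_add_le (B • Z) (t • (B • ψ)) (c := t * B) (by positivity)
    (hn t (abs_of_pos ht))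
  have h4 := cosh_norm_add_le (B • Z) ((-t) • (B • ψ)) (c := t * B) (by positivity)
    (hn (-t) (by rw [abs_neg, abs_of_pos ht]))
  have e : ∀ τ : ℝ, B * ‖Z + τ • ψ‖ = ‖B • Z + τ • (B • ψ)‖ := fun τ => by
    rw [smul_comm τ B, ← smul_add, norm_smul, Real.norm_of_nonneg hB.le]
  have eZ : ‖B • Z‖ = B * ‖Z‖ := by rw [norm_smul, Real.norm_of_nonneg hB.le]
  rw [inner_smul_right _ _ t] at h3
  rw [inner_smul_right _ _ (-t)] at h4
  rw [e t, e (-t)]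
  rw [eZ] at h3 h4
  linarith

theorem ofReal_half_add {a b : ℝ} (ha : 0 ≤ a) (hb : 0 ≤ b) :
    ENNReal.ofReal ((a + b) / 2) =
      ENNReal.ofReal (1 / 2) * (ENNReal.ofReal a + ENNReal.ofReal b) := by
  rw [← ENNReal.ofReal_add ha hb, ← ENNReal.ofReal_mul (by norm_num)]
  congr 1; ring

variable [MeasurableSpace E] [BorelSpace E] [FiniteDimensional ℝ E]

/-- One example at a time, symmetrization and contraction turn its deviation into `± t ⟨w - v, ψ⟩`,
which is absorbed into `Z`. At the end the supremum is at most `exp (B ‖Z‖)`, and the averages over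
signs cost one factor `cosh (2 λ Λ B)` per example. Neither the size of `W` nor the dimension
enters. -/
theorem lintegral_supExp_pi_le {W : Finset E} {hW : W.Nonempty} {v : E} {B : ℝ} (hB : 0 < B)
    (hWB : ∀ w ∈ W, ‖w - v‖ ≤ B) {ψ : Ω → E} (hψ : Measurable ψ) (hψ1 : ∀ p, ‖ψ p‖ ≤ 1)
    {g : E → Ω → ℝ} (hg : ∀ w, Measurable (g w)) (hg0 : ∀ w p, |g w p| ≤ 1) {Λ lam : ℝ}
    (hΛ : 0 < Λ) (hlam : 0 < lam)
    (hlip : ∀ w w' p, |g w p - g w' p| ≤ Λ * |inner ℝ (w - w') (ψ p)|) (hv : ∀ p, g v p = 0)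
    (m : ℕ) (Z : E) :
    ∫⁻ S : Fin m → Ω, ENNReal.ofReal (supExp W hW fun w =>
        inner ℝ (w - v) Z + lam * ∑ i, (∫ x, g w x ∂D - g w (S i))) ∂(Measure.pi fun _ => D) ≤
      ENNReal.ofReal (2 * Real.cosh (B * ‖Z‖) * Real.cosh (2 * lam * Λ * B) ^ m) := by
  induction m generalizing Z with
  | zero =>
    simp only [Finset.univ_eq_empty, Finset.sum_empty, mul_zero, add_zero, pow_zero, mul_one,
      lintegral_const, measure_univ]
    refine ENNReal.ofReal_le_ofReal (supExp_le fun w hw => ?_)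
    calc Real.exp (inner ℝ (w - v) Z) ≤ Real.exp (B * ‖Z‖) := by
          gcongr
          exact (real_inner_le_norm _ _).trans (by gcongr; exact hWB w hw)
      _ ≤ _ := by rw [Real.cosh_eq]; linarith [Real.exp_pos (-(B * ‖Z‖))]
  | succ m ih =>
    set t := 2 * lam * Λ with ht
    have ht0 : 0 < t := by positivity
    have hmeas : Measurable fun q : Ω × (Fin m → Ω) => ENNReal.ofReal (supExp W hW fun w =>
        inner ℝ (w - v) Z + lam * ∑ i, (∫ x, g w x ∂D - g w (q.2 i)) +
          lam * (∫ x, g w x ∂D - g w q.1)) := by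
      refine (measurable_supExp fun w => ?_).ennreal_ofReal
      have := hg w
      fun_prop
    -- `Q τ p S` is the supremum for the other `m` examples after the first has been absorbed into
    -- `Z` with coefficient `τ`.
    obtain ⟨Q, hQ⟩ : ∃ Q : ℝ → Ω → (Fin m → Ω) → ℝ, Q = fun τ p S => supExp W hW fun w =>
        inner ℝ (w - v) (Z + τ • ψ p) + lam * ∑ i, (∫ x, g w x ∂D - g w (S i)) := ⟨_, rfl⟩
    have hQm : ∀ τ : ℝ, Measurable fun q : (Fin m → Ω) × Ω => Q τ q.2 q.1 := by
      intro τ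
      rw [hQ]
      refine measurable_supExp fun w => ?_
      have := hg w
      fun_prop
    have hQ0 : ∀ τ p S, 0 ≤ Q τ p S := fun τ p S => by rw [hQ]; exact (supExp_pos _).le
    have hQih : ∀ τ p, ∫⁻ S, ENNReal.ofReal (Q τ p S) ∂(Measure.pi fun _ => D) ≤
        ENNReal.ofReal (2 * Real.cosh (B * ‖Z + τ • ψ p‖) * Real.cosh (t * B) ^ m) :=
      fun τ p => by rw [hQ]; exact ih _
    have hsign : ∀ (τ : ℝ) (p : Ω) (S : Fin m → Ω), (supExp W hW fun w => inner ℝ (w - v) Z +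
        lam * ∑ i, (∫ x, g w x ∂D - g w (S i)) + τ * inner ℝ (w - v) (ψ p)) = Q τ p S := by
      intro τ p S
      rw [hQ]
      congr 1; ext w
      rw [inner_add_right, inner_smul_right]; ring
    have hpt : ∀ p S, (supExp W hW fun w => inner ℝ (w - v) Z +
          lam * ∑ i, (∫ x, g w x ∂D - g w (S i)) + 2 * lam * g w p) +
        (supExp W hW fun w => inner ℝ (w - v) Z +
          lam * ∑ i, (∫ x, g w x ∂D - g w (S i)) - 2 * lam * g w p) ≤
        Q t p S + Q (-t) p S := by
      intro p S
      rw [← hsign t, ← hsign (-t)]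
      simp only [neg_mul, ← sub_eq_add_neg]
      refine supExp_contraction (φ := fun w => 2 * lam * g w p)
        (s := fun w => t * inner ℝ (w - v) (ψ p)) (fun w w' => ?_) fun w => ?_
      · rw [← mul_sub, ← mul_sub, ← inner_sub_left, sub_sub_sub_cancel_right,
          abs_mul (2 * lam), abs_mul t, abs_of_pos (by positivity : 0 < 2 * lam),
          abs_of_pos ht0, ht, mul_assoc (2 * lam)]
        exact mul_le_mul_of_nonneg_left (hlip w w' p) (by positivity)
      · rw [abs_mul (2 * lam), abs_mul t, abs_of_pos (by positivity : 0 < 2 * lam),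
          abs_of_pos ht0, ht, mul_assoc (2 * lam)]
        refine mul_le_mul_of_nonneg_left ?_ (by positivity)
        simpa [hv] using hlip w v p
    calc _ = ∫⁻ p, ∫⁻ S : Fin m → Ω, ENNReal.ofReal (supExp W hW fun w =>
            inner ℝ (w - v) Z + lam * ∑ i, (∫ x, g w x ∂D - g w (S i)) +
              lam * (∫ x, g w x ∂D - g w p)) ∂(Measure.pi fun _ => D) ∂D := by
          rw [lintegral_pi_succ]
          · refine lintegral_congr fun p => lintegral_congr fun S => ?_
            congr 2; ext w
            rw [Fin.sum_univ_succ, Fin.cons_zero]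
            simp only [Fin.cons_succ]
            ring
          · refine (measurable_supExp fun w => ?_).ennreal_ofReal
            have := hg w
            fun_prop
      _ = ∫⁻ S : Fin m → Ω, ∫⁻ p, ENNReal.ofReal (supExp W hW fun w =>
            inner ℝ (w - v) Z + lam * ∑ i, (∫ x, g w x ∂D - g w (S i)) +
              lam * (∫ x, g w x ∂D - g w p)) ∂D ∂(Measure.pi fun _ => D) :=
          -- Symmetrization averages over `p` with `S` fixed, whereas the induction hypothesis
          -- averages over `S` with `p` fixed; hence this exchange and the later one back.
          lintegral_lintegral_swap hmeas.aemeasurable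
      _ ≤ ∫⁻ S : Fin m → Ω, ∫⁻ p, ENNReal.ofReal ((Q t p S + Q (-t) p S) / 2) ∂D
            ∂(Measure.pi fun _ => D) := by
          refine lintegral_mono fun S => (lintegral_supExp_le D hg hg0 _ lam).trans
            (lintegral_mono fun p => ENNReal.ofReal_le_ofReal ?_)
          exact div_le_div_of_nonneg_right (hpt p S) (by norm_num)
      _ = ∫⁻ p, ∫⁻ S : Fin m → Ω, ENNReal.ofReal ((Q t p S + Q (-t) p S) / 2)
            ∂(Measure.pi fun _ => D) ∂D :=
          lintegral_lintegral_swap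
            (((hQm t).add (hQm (-t))).div_const 2).ennreal_ofReal.aemeasurable
      _ ≤ ∫⁻ p, ENNReal.ofReal (2 * Real.cosh (B * ‖Z‖) * Real.cosh (t * B) ^ (m + 1)) ∂D := by
          refine lintegral_mono fun p => ?_
          have hS : ∀ τ : ℝ, Measurable fun S : Fin m → Ω => ENNReal.ofReal (Q τ p S) :=
            fun τ => ((hQm τ).comp (measurable_id.prodMk measurable_const)).ennreal_ofReal
          simp only [ofReal_half_add (hQ0 _ _ _) (hQ0 _ _ _)]
          rw [lintegral_const_mul' _ _ ENNReal.ofReal_ne_top, lintegral_add_left (hS t)]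
          refine (mul_le_mul_right (add_le_add (hQih t p) (hQih (-t) p)) _).trans ?_
          have hcm : 0 ≤ Real.cosh (t * B) ^ m := pow_nonneg (Real.cosh_pos _).le _
          rw [← ENNReal.ofReal_add (by positivity) (by positivity),
            ← ENNReal.ofReal_mul (by norm_num)]
          refine ENNReal.ofReal_le_ofReal ?_
          calc _ = (Real.cosh (B * ‖Z + t • ψ p‖) + Real.cosh (B * ‖Z + (-t) • ψ p‖)) *
                Real.cosh (t * B) ^ m := by ring
            _ ≤ 2 * (Real.cosh (B * ‖Z‖) * Real.cosh (t * B)) * Real.cosh (t * B) ^ m :=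
                mul_le_mul_of_nonneg_right (cosh_add_cosh_le Z (hψ1 p) hB ht0) hcm
            _ = _ := by ring
      _ = _ := by simp

/-- Uniform convergence over a ball: the sum of the deviations of all functions `g w` with
`‖w - v‖ ≤ B` is small simultaneously. -/
theorem measure_exists_deviation_le {v : E} {B : ℝ} (hB : 0 < B) {ψ : Ω → E} (hψ : Measurable ψ)
    (hψ1 : ∀ p, ‖ψ p‖ ≤ 1) {g : E → Ω → ℝ} (hg : ∀ w, Measurable (g w))
    (hg0 : ∀ w p, |g w p| ≤ 1) {Λ : ℝ} (hΛ : 0 < Λ)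
    (hlip : ∀ w w' p, |g w p - g w' p| ≤ Λ * |inner ℝ (w - w') (ψ p)|) (hv : ∀ p, g v p = 0)
    {m : ℕ} (hm : 1 ≤ m) {q : ℝ} (hq : 0 < q) (hq1 : q ≤ 1) :
    Measure.pi (fun _ : Fin m => D) {S | ∃ w ∈ Metric.closedBall v B,
      2 * (Λ * B * √(8 * m * Real.log (2 / q))) < ∑ i, (∫ x, g w x ∂D - g w (S i))} ≤
      ENNReal.ofReal q := by
  have hl : 0 < Real.log (2 / q) := Real.log_pos (by rw [lt_div_iff₀ hq]; linarith)
  have hm' : (0 : ℝ) < m := by exact_mod_cast hm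
  set l := Real.log (2 / q) with hl_def
  set r := Λ * B * √(8 * m * l) with hr
  have hr0 : 0 < r := by positivity
  have hr2 : r ^ 2 = Λ ^ 2 * B ^ 2 * (8 * m * l) := by
    rw [hr, mul_pow, mul_pow, Real.sq_sqrt (by positivity)]
  -- Passing to the net changes each value and each expectation by at most `r / (2 m)`, hence the
  -- sum by at most `r`. This explains the threshold `2 r`; the net only serves to have a finite
  -- supremum.
  obtain ⟨W₀, hW₀, hW₀f, hcov⟩ := (isCompact_closedBall v B).finite_cover_balls
    (show 0 < r / (2 * Λ * m) by positivity)
  obtain ⟨W, rfl⟩ := hW₀f.exists_finset_coe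
  have hW : W.Nonempty := by
    have := hcov (Metric.mem_closedBall_self hB.le)
    simp only [Set.mem_iUnion] at this
    obtain ⟨w, hw, -⟩ := this
    exact ⟨w, hw⟩
  have hWB : ∀ w ∈ W, ‖w - v‖ ≤ B := fun w hw => by
    have := hW₀ hw
    rwa [mem_closedBall_iff_norm] at this
  -- Minimizes the exponent `m (2 λ Λ B)² / 2 - λ r`; the minimum is `-l`.
  set lam := r / (4 * m * Λ ^ 2 * B ^ 2) with hlam
  have hlam0 : 0 < lam := by positivity
  have hgi : ∀ w, Integrable (g w) D := fun w =>
    Integrable.of_bound (C := 1) (hg w).aestronglyMeasurable (.of_forall fun p => hg0 w p)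
  have hI := lintegral_supExp_pi_le D (hW := hW) hB hWB hψ hψ1 hg hg0 hΛ hlam0 hlip hv m 0
  simp only [inner_zero_right, zero_add, norm_zero, mul_zero, Real.cosh_zero, mul_one] at hI
  have hsub : {S : Fin m → Ω | ∃ w ∈ Metric.closedBall v B,
      2 * r < ∑ i, (∫ x, g w x ∂D - g w (S i))} ⊆
      {S | ENNReal.ofReal (Real.exp (lam * r)) ≤ ENNReal.ofReal (supExp W hW fun w =>
        lam * ∑ i, (∫ x, g w x ∂D - g w (S i)))} := by
    rintro S ⟨w, hw, hwr⟩
    refine ENNReal.ofReal_le_ofReal ?_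
    have := hcov hw
    simp only [Set.mem_iUnion] at this
    obtain ⟨z, hz, hwz⟩ := this
    have hd : ∀ p, |g w p - g z p| ≤ r / (2 * m) := fun p => by
      refine (hlip w z p).trans ?_
      have h1 : |inner ℝ (w - z) (ψ p)| ≤ r / (2 * Λ * m) * 1 := by
        refine (abs_real_inner_le_norm _ _).trans ?_
        gcongr
        · rw [← dist_eq_norm]; exact (Metric.mem_ball.1 hwz).le
        · exact hψ1 p
      calc Λ * |inner ℝ (w - z) (ψ p)| ≤ Λ * (r / (2 * Λ * m) * 1) := by gcongr
        _ = _ := by field_simp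
    have hE : ∫ x, g w x ∂D ≤ ∫ x, g z x ∂D + r / (2 * m) := by
      calc ∫ x, g w x ∂D ≤ ∫ x, (g z x + r / (2 * m)) ∂D :=
            integral_mono (hgi w) ((hgi z).add (integrable_const _)) fun p => by
              linarith [(abs_le.1 (hd p)).2]
        _ = _ := by rw [integral_add (hgi z) (integrable_const _)]; simp
    have hsum : ∑ i, (∫ x, g w x ∂D - g w (S i)) ≤ ∑ i, (∫ x, g z x ∂D - g z (S i)) + r := by
      calc ∑ i, (∫ x, g w x ∂D - g w (S i)) ≤
            ∑ i : Fin m, ((∫ x, g z x ∂D - g z (S i)) + r / m) := by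
            refine Finset.sum_le_sum fun i _ => ?_
            have h1 := (abs_le.1 (hd (S i))).1
            have h2 : r / m = r / (2 * m) + r / (2 * m) := by field_simp; ring
            linarith
        _ = _ := by
            rw [Finset.sum_add_distrib, Finset.sum_const, Finset.card_univ, Fintype.card_fin,
              nsmul_eq_mul, mul_div_cancel₀ _ hm'.ne']
    refine le_trans ?_ (exp_le_supExp (hW := hW)
      (fun w => lam * ∑ i, (∫ x, g w x ∂D - g w (S i))) hz)
    gcongr
    linarith
  have hmeas : Measurable fun S : Fin m → Ω => ENNReal.ofReal (supExp W hW fun w =>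
      lam * ∑ i, (∫ x, g w x ∂D - g w (S i))) := by
    clear_value lam
    refine (measurable_supExp fun w => ?_).ennreal_ofReal
    have := hg w
    fun_prop
  refine (measure_mono hsub).trans ((meas_ge_le_lintegral_div hmeas.aemeasurable
    (by simp [Real.exp_pos]) ENNReal.ofReal_ne_top).trans
      ((ENNReal.div_le_div_right hI _).trans ?_))
  rw [← ENNReal.ofReal_div_of_pos (Real.exp_pos _)]
  refine ENNReal.ofReal_le_ofReal ?_
  rw [div_le_iff₀ (Real.exp_pos _)]
  calc 2 * Real.cosh (2 * lam * Λ * B) ^ m ≤ 2 * Real.exp ((2 * lam * Λ * B) ^ 2 / 2) ^ m := by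
        gcongr
        exact Real.cosh_le_exp_half_sq _
    _ = 2 * Real.exp (lam * r - l) := by
        rw [← Real.exp_nat_mul]
        congr 2
        have h1 : lam * r = 2 * l := by rw [hlam, div_mul_eq_mul_div, ← sq, hr2]; field_simp; ring
        have h2 : (2 * lam * Λ * B) ^ 2 = 2 * l / m := by
          rw [mul_pow, mul_pow, mul_pow, hlam, div_pow, hr2]; field_simp; ring
        rw [h1, h2]; field_simp; ring
    _ = q * Real.exp (lam * r) := by
        rw [Real.exp_sub, hl_def, Real.exp_log (by positivity)]; field_simp

end Uniform

end

end Alphatron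

namespace Alphatron

noncomputable section

/-! ### Convergence of the training loop -/

section Training

variable {E : Type*} [NormedAddCommGroup E] [InnerProductSpace ℝ E] {m : ℕ} {u : ℝ → ℝ}
  {L : ℝ} {y : Fin m → ℝ} {K : Fin m → Fin m → ℝ} {ψ : Fin m → E}

theorem coeff_zero (lam : ℝ) : coeff u lam y K 0 = 0 := rfl

theorem coeff_succ (lam : ℝ) (t : ℕ) :
    coeff u lam y K (t + 1) = updateValue u lam y K (coeff u lam y K t) :=
  Function.iterate_succ_apply' _ _ _

/-- The vector with the coefficients `α` with respect to the vectors `ψ i`. -/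
def combination (ψ : Fin m → E) (α : Fin m → ℝ) : E := ∑ i, α i • ψ i

/-- Labels and values of `u` lie in `[0, 1]`, so one update moves a coefficient by at most `1 / (L
m)`. -/
theorem abs_coeff_le (hL : 0 < L) (hu : ∀ s, u s ∈ Set.Icc (0 : ℝ) 1)
    (hy : ∀ i, y i ∈ Set.Icc (0 : ℝ) 1) (t : ℕ) (i : Fin m) :
    |coeff u (1 / L) y K t i| ≤ t / (L * m) := by
  induction t with
  | zero => simp [coeff_zero]
  | succ t ih =>
    rw [coeff_succ]
    unfold updateValue
    refine (abs_add_le _ _).trans ?_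
    have h1 : |y i - u (∑ j, coeff u (1 / L) y K t j * K i j)| ≤ 1 := by
      rw [abs_le]
      constructor <;> linarith [(hu (∑ j, coeff u (1 / L) y K t j * K i j)).1, (hy i).1,
        (hu (∑ j, coeff u (1 / L) y K t j * K i j)).2, (hy i).2]
    have h2 : |1 / L / m * (y i - u (∑ j, coeff u (1 / L) y K t j * K i j))| ≤ 1 / L / m * 1 := by
      rw [abs_mul, abs_of_nonneg (by positivity : 0 ≤ 1 / L / (m : ℝ))]
      gcongr
    calc _ ≤ t / (L * m) + 1 / L / m * 1 := add_le_add ih h2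
      _ = _ := by push_cast; rw [mul_one, div_div, ← add_div]

/-- The approximate kernel values change the value of the linear functional only slightly. -/
theorem abs_sum_coeff_sub_le (hL : 0 < L) (hu : ∀ s, u s ∈ Set.Icc (0 : ℝ) 1)
    (hy : ∀ i, y i ∈ Set.Icc (0 : ℝ) 1) {T t : ℕ} (ht : t ≤ T) {θ : ℝ} (hθ : 0 ≤ θ)
    {φ : E} {k : Fin m → ℝ} (hk : ∀ j, |k j - inner ℝ φ (ψ j)| ≤ L * θ / T) :
    |∑ j, coeff u (1 / L) y K t j * k j - inner ℝ (combination ψ (coeff u (1 / L) y K t)) φ| ≤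
      θ := by
  set α := coeff u (1 / L) y K t with hα
  have h1 : ∑ j, α j * k j - inner ℝ (combination ψ α) φ =
      ∑ j, α j * (k j - inner ℝ φ (ψ j)) := by
    rw [combination, sum_inner, ← Finset.sum_sub_distrib]
    refine Finset.sum_congr rfl fun j _ => ?_
    rw [real_inner_smul_left, real_inner_comm φ, mul_sub]
  have htT : (t : ℝ) / T ≤ 1 := div_le_one_of_le₀ (by exact_mod_cast ht) (Nat.cast_nonneg _)
  rw [h1]
  calc _ ≤ ∑ j : Fin m, |α j * (k j - inner ℝ φ (ψ j))| := Finset.abs_sum_le_sum_abs _ _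
    _ ≤ ∑ j : Fin m, t / (L * m) * (L * θ / T) := by
        refine Finset.sum_le_sum fun j _ => ?_
        rw [abs_mul]
        exact mul_le_mul (abs_coeff_le hL hu hy t j) (hk j) (abs_nonneg _) (by positivity)
    _ = (m / m) * (t / T * θ) := by
        rw [Finset.sum_const, Finset.card_univ, Fintype.card_fin, nsmul_eq_mul]
        field_simp
    _ ≤ 1 * (1 * θ) := by
        gcongr
        exact div_self_le_one _
    _ = θ := by ring

/-- Both differences have the same sign, and `|s - t| ≥ |u s - u t| / L`. This inequality makes the
update point towards `v`. -/
theorem mul_self_le_of_lipschitz_monotone {s t : ℝ} (hL : 0 < L)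
    (hlip : ∀ s t, |u s - u t| ≤ L * |s - t|) (hmono : Monotone u) :
    (u s - u t) ^ 2 / L ≤ (u s - u t) * (s - t) := by
  rw [div_le_iff₀ hL]
  rcases le_total s t with h | h
  · have h1 := hmono h
    have h2 := hlip s t
    rw [abs_of_nonpos (sub_nonpos.2 h1), abs_of_nonpos (sub_nonpos.2 h)] at h2
    nlinarith
  · have h1 := hmono h
    have h2 := hlip s t
    rw [abs_of_nonneg (sub_nonneg.2 h1), abs_of_nonneg (sub_nonneg.2 h)] at h2
    nlinarith

/-- One step of the training loop decreases the distance to `v`. -/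
theorem norm_step_sq_le {B θ η : ℝ} {v w : E} {ξ s : Fin m → ℝ} (hm : 0 < m) (hL : 0 < L)
    (hu : ∀ s, u s ∈ Set.Icc (0 : ℝ) 1)
    (hlip : ∀ s t, |u s - u t| ≤ L * |s - t|) (hmono : Monotone u)
    (hψ : ∀ i, ‖ψ i‖ ≤ 1) (hw : ‖w - v‖ ≤ B)
    (hs : ∀ i, |s i - inner ℝ w (ψ i)| ≤ θ)
    (hη : ‖∑ i, (y i - u (inner ℝ v (ψ i) + ξ i)) • ψ i‖ ≤ m * η) :
    ‖w + (1 / L) • ((1 / (m : ℝ)) • ∑ i, (y i - u (s i)) • ψ i) - v‖ ^ 2 ≤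
      ‖w - v‖ ^ 2 - 1 / L ^ 2 * ((∑ i, (u (inner ℝ v (ψ i) + ξ i) - u (s i)) ^ 2) / m / 2 -
        (2 * L * (η * B + θ + (∑ i, |ξ i|) / m) + 3 * η ^ 2)) := by
  have hm' : (0 : ℝ) < m := by exact_mod_cast hm
  set c : Fin m → ℝ := fun i => u (inner ℝ v (ψ i) + ξ i) with hc
  set M := (∑ i, (c i - u (s i)) ^ 2) / m with hM
  set X := (∑ i, |ξ i|) / m with hX
  set Δ := (1 / (m : ℝ)) • ∑ i, (y i - c i) • ψ i with hΔ
  set H := (1 / (m : ℝ)) • ∑ i, (c i - u (s i)) • ψ i with hH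
  have hM0 : 0 ≤ M := by positivity
  have hΔη : ‖Δ‖ ≤ η := by
    rw [hΔ, norm_smul, Real.norm_of_nonneg (by positivity), one_div, inv_mul_le_iff₀ hm']
    exact hη
  have hη0 : 0 ≤ η := (norm_nonneg _).trans hΔη
  have hG : (1 / (m : ℝ)) • ∑ i, (y i - u (s i)) • ψ i = Δ + H := by
    rw [hΔ, hH, ← smul_add, ← Finset.sum_add_distrib]
    congr 1
    refine Finset.sum_congr rfl fun i _ => ?_
    rw [← add_smul]; congr 1; ring
  have habs : ∀ i, |c i - u (s i)| ≤ 1 := fun i => by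
    rw [abs_le]
    constructor <;> linarith [(hu (s i)).1, (hu (s i)).2, (hu (inner ℝ v (ψ i) + ξ i)).1,
      (hu (inner ℝ v (ψ i) + ξ i)).2]
  have hHn : ‖H‖ ^ 2 ≤ M := by
    have h1 : ‖H‖ ≤ (∑ i, |c i - u (s i)|) / m := by
      rw [hH, norm_smul, Real.norm_of_nonneg (by positivity), one_div, inv_mul_eq_div]
      gcongr
      refine (norm_sum_le _ _).trans (Finset.sum_le_sum fun i _ => ?_)
      rw [norm_smul, Real.norm_eq_abs]
      exact mul_le_of_le_one_right (abs_nonneg _) (hψ i)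
    have h2 : (∑ i, |c i - u (s i)|) ^ 2 ≤ m * ∑ i, (c i - u (s i)) ^ 2 := by
      have := sq_sum_le_card_mul_sum_sq (s := Finset.univ) (f := fun i => |c i - u (s i)|)
      simpa [sq_abs] using this
    calc ‖H‖ ^ 2 ≤ ((∑ i, |c i - u (s i)|) / m) ^ 2 := by gcongr
      _ ≤ (m * ∑ i, (c i - u (s i)) ^ 2) / m ^ 2 := by rw [div_pow]; gcongr
      _ = M := by rw [hM]; field_simp
  -- The cross term is split by `2 η h ≤ 2 η² + h² / 2`. The factor `3 / 2` stays below the `2`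
  -- gained from the inner product and leaves `M / 2`.
  have hGn : ‖Δ + H‖ ^ 2 ≤ 3 * η ^ 2 + 3 / 2 * M := by
    have h1 : ‖Δ + H‖ ≤ η + ‖H‖ := (norm_add_le _ _).trans (by gcongr)
    have h2 : ‖Δ + H‖ ^ 2 ≤ (η + ‖H‖) ^ 2 := by gcongr
    nlinarith [sq_nonneg (2 * η - ‖H‖)]
  have hin1 : -(η * B) ≤ inner ℝ Δ (v - w) := by
    have h1 := (abs_le.1 (abs_real_inner_le_norm Δ (v - w))).1
    have h2 : ‖Δ‖ * ‖v - w‖ ≤ η * B := by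
      rw [norm_sub_rev]; gcongr
    linarith
  -- The inner product differences are the differences of the arguments of `u` up to the kernel
  -- error and `ξ i`, whose factors are at most `1`.
  have hin2 : M / L - θ - X ≤ inner ℝ H (v - w) := by
    have h1 : inner ℝ H (v - w) =
        (∑ i, (c i - u (s i)) * (inner ℝ v (ψ i) - inner ℝ w (ψ i))) / m := by
      rw [hH, real_inner_smul_left, sum_inner, one_div, inv_mul_eq_div]
      congr 1
      refine Finset.sum_congr rfl fun i _ => ?_
      rw [real_inner_smul_left, inner_sub_right, real_inner_comm v, real_inner_comm w]
    have h2 : ∑ i, ((c i - u (s i)) ^ 2 / L - θ - |ξ i|) ≤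
        ∑ i, (c i - u (s i)) * (inner ℝ v (ψ i) - inner ℝ w (ψ i)) := by
      refine Finset.sum_le_sum fun i _ => ?_
      have h3 := mul_self_le_of_lipschitz_monotone (s := inner ℝ v (ψ i) + ξ i) (t := s i)
        hL hlip hmono
      have h4 : |(c i - u (s i)) * (s i - inner ℝ w (ψ i) - ξ i)| ≤ 1 * (θ + |ξ i|) := by
        rw [abs_mul]
        gcongr
        · exact habs i
        · exact (abs_sub _ _).trans (by gcongr; exact hs i)
      have h5 := (abs_le.1 h4).1
      have h6 : (c i - u (s i)) * (inner ℝ v (ψ i) - inner ℝ w (ψ i)) =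
          (c i - u (s i)) * (inner ℝ v (ψ i) + ξ i - s i) +
            (c i - u (s i)) * (s i - inner ℝ w (ψ i) - ξ i) := by ring
      rw [h6]
      simp only [hc] at h5 ⊢
      linarith
    rw [h1, le_div_iff₀ hm']
    refine le_trans (le_of_eq ?_) h2
    simp only [Finset.sum_sub_distrib, ← Finset.sum_div, Finset.sum_const, Finset.card_univ,
      Fintype.card_fin, nsmul_eq_mul, hM, hX]
    field_simp
  rw [hG]
  have hexp : ‖w + (1 / L) • (Δ + H) - v‖ ^ 2 = ‖w - v‖ ^ 2 -
      2 / L * (inner ℝ Δ (v - w) + inner ℝ H (v - w)) + 1 / L ^ 2 * ‖Δ + H‖ ^ 2 := by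
    have e : w + (1 / L) • (Δ + H) - v = (w - v) + (1 / L) • (Δ + H) := by abel
    rw [e, norm_add_sq_real, norm_smul, mul_pow, inner_smul_right, ← inner_add_left,
      Real.norm_of_nonneg (by positivity), ← neg_sub w v, inner_neg_right,
      real_inner_comm (w - v)]
    ring
  have h7 : 2 / L * (M / L - θ - X - η * B) ≤
      2 / L * (inner ℝ Δ (v - w) + inner ℝ H (v - w)) := by gcongr; linarith
  have h8 : 1 / L ^ 2 * ‖Δ + H‖ ^ 2 ≤ 1 / L ^ 2 * (3 * η ^ 2 + 3 / 2 * M) := by gcongr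
  have h9 : ‖w - v‖ ^ 2 - 1 / L ^ 2 * (M / 2 - (2 * L * (η * B + θ + X) + 3 * η ^ 2)) =
      ‖w - v‖ ^ 2 - 2 / L * (M / L - θ - X - η * B) + 1 / L ^ 2 * (3 * η ^ 2 + 3 / 2 * M) := by
    field_simp; ring
  rw [hexp, h9]
  linarith

/-- Some vector of the training loop has a small error on the training set. -/
theorem exists_training_error_le {B θ η : ℝ} {v : E} {ξ : Fin m → ℝ} {T : ℕ} (hm : 0 < m)
    (hL : 0 < L) (hu : ∀ s, u s ∈ Set.Icc (0 : ℝ) 1)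
    (hlip : ∀ s t, |u s - u t| ≤ L * |s - t|) (hmono : Monotone u)
    (hy : ∀ i, y i ∈ Set.Icc (0 : ℝ) 1) (hψ : ∀ i, ‖ψ i‖ ≤ 1) (hv : ‖v‖ ≤ B) (hB : 0 < B)
    (hT : 0 < T) (hθ : 0 ≤ θ) (hLθ : L * θ ≤ 1)
    (hK : ∀ i j, |K i j - inner ℝ (ψ i) (ψ j)| ≤ L * θ / T)
    (hη : ‖∑ i, (y i - u (inner ℝ v (ψ i) + ξ i)) • ψ i‖ ≤ m * η) :
    ∃ t < T, ‖combination ψ (coeff u (1 / L) y K t) - v‖ ≤ B ∧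
      (∑ i, (u (inner ℝ (combination ψ (coeff u (1 / L) y K t)) (ψ i)) - u (inner ℝ v (ψ i))) ^ 2)
        / m ≤ 3 * (L * θ + L * ((∑ i, |ξ i|) / m) + 2 * (2 * L * (η * B + θ + (∑ i, |ξ i|) / m) +
          3 * η ^ 2) + 2 * (B ^ 2 * L ^ 2 / T)) := by
  have hm' : (0 : ℝ) < m := by exact_mod_cast hm
  have hT' : (0 : ℝ) < T := by exact_mod_cast hT
  set α := coeff u (1 / L) y K with hα
  set w : ℕ → E := fun t => combination ψ (α t) with hw
  set s : ℕ → Fin m → ℝ := fun t i => ∑ j, α t j * K i j with hs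
  set X := (∑ i, |ξ i|) / m with hX
  set Γ := 2 * L * (η * B + θ + X) + 3 * η ^ 2 with hΓ
  set M : ℕ → ℝ := fun t => (∑ i, (u (inner ℝ v (ψ i) + ξ i) - u (s t i)) ^ 2) / m with hM
  have hsw : ∀ t ≤ T, ∀ i, |s t i - inner ℝ (w t) (ψ i)| ≤ θ := fun t ht i =>
    abs_sum_coeff_sub_le hL hu hy ht hθ (hK i)
  have hw0 : w 0 = 0 := by simp [hw, hα, coeff_zero, combination]
  have hws : ∀ t, w (t + 1) = w t + (1 / L) • ((1 / (m : ℝ)) • ∑ i, (y i - u (s t i)) • ψ i) := by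
    intro t
    simp only [hw, hα, coeff_succ, combination, updateValue, add_smul, Finset.sum_add_distrib]
    congr 1
    simp only [Finset.smul_sum, smul_smul]
    refine Finset.sum_congr rfl fun i _ => ?_
    congr 1
    simp only [hs, hα]
    field_simp
  have hstep : ∀ t < T, ‖w t - v‖ ≤ B →
      ‖w (t + 1) - v‖ ^ 2 ≤ ‖w t - v‖ ^ 2 - 1 / L ^ 2 * (M t / 2 - Γ) := fun t ht hB' => by
    rw [hws]
    exact norm_step_sq_le hm hL hu hlip hmono hψ hB' (hsw t ht.le) hη
  -- Otherwise each of the `T` steps would decrease the squared distance by more than `B ^ 2 / T`,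
  -- from at most `B ^ 2` to a negative number.
  have hex : ∃ t < T, ‖w t - v‖ ≤ B ∧ M t ≤ 2 * Γ + 2 * (B ^ 2 * L ^ 2 / T) := by
    by_contra hcon
    push Not at hcon
    have hdec : ∀ t < T, ‖w t - v‖ ≤ B → ‖w (t + 1) - v‖ ^ 2 < ‖w t - v‖ ^ 2 - B ^ 2 / T := by
      intro t ht hB'
      have h1 := hstep t ht hB'
      have h2 := hcon t ht hB'
      have h3 : B ^ 2 / T < 1 / L ^ 2 * (M t / 2 - Γ) := by
        rw [one_div_mul_eq_div, lt_div_iff₀ (by positivity)]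
        have : B ^ 2 / T * L ^ 2 = B ^ 2 * L ^ 2 / T := by ring
        linarith
      linarith
    have hle : ∀ t ≤ T, ‖w t - v‖ ^ 2 ≤ B ^ 2 - t * (B ^ 2 / T) := by
      intro t
      induction t with
      | zero => intro _; rw [hw0, zero_sub, norm_neg]; simp; gcongr
      | succ t ih =>
        intro ht
        have h1 := ih (by omega)
        have h2 : ‖w t - v‖ ≤ B := by
          refine (sq_le_sq₀ (norm_nonneg _) hB.le).1 (h1.trans ?_)
          have : 0 ≤ (t : ℝ) * (B ^ 2 / T) := by positivity
          linarith
        have h3 := hdec t (by omega) h2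
        push_cast
        linarith
    obtain ⟨T', rfl⟩ := Nat.exists_eq_succ_of_ne_zero hT.ne'
    have h1 := hle T' (by omega)
    have h2 : ‖w T' - v‖ ≤ B := by
      refine (sq_le_sq₀ (norm_nonneg _) hB.le).1 (h1.trans ?_)
      have : 0 ≤ (T' : ℝ) * (B ^ 2 / (T' + 1 : ℕ)) := by positivity
      linarith
    have h3 := hdec T' (by omega) h2
    have h4 : ((T' + 1 : ℕ) : ℝ) * (B ^ 2 / ((T' + 1 : ℕ) : ℝ)) = B ^ 2 :=
      mul_div_cancel₀ _ hT'.ne'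
    have h5 := sq_nonneg ‖w (T' + 1) - v‖
    push_cast at *
    linarith
  obtain ⟨t, ht, htB, htM⟩ := hex
  refine ⟨t, ht, htB, ?_⟩
  -- The exact iterate is compared with the approximate one, that with the noisy target, and that
  -- with the noiseless one. In the first and last difference, being at most `1`, the square is
  -- bounded by the first power.
  have hpt : ∀ i, (u (inner ℝ (w t) (ψ i)) - u (inner ℝ v (ψ i))) ^ 2 ≤
      3 * (L * θ + (u (inner ℝ v (ψ i) + ξ i) - u (s t i)) ^ 2 + L * |ξ i|) := by
    intro i
    have h1 : |u (inner ℝ (w t) (ψ i)) - u (s t i)| ≤ L * θ := by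
      refine (hlip _ _).trans ?_
      rw [abs_sub_comm]
      gcongr
      exact hsw t ht.le i
    have h2 : |u (inner ℝ v (ψ i) + ξ i) - u (inner ℝ v (ψ i))| ≤ L * |ξ i| := by
      simpa using hlip (inner ℝ v (ψ i) + ξ i) (inner ℝ v (ψ i))
    have h3 : |u (inner ℝ v (ψ i) + ξ i) - u (inner ℝ v (ψ i))| ≤ 1 := by
      rw [abs_le]
      constructor <;> linarith [(hu (inner ℝ v (ψ i))).1, (hu (inner ℝ v (ψ i))).2,
        (hu (inner ℝ v (ψ i) + ξ i)).1, (hu (inner ℝ v (ψ i) + ξ i)).2]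
    have h4 : (u (inner ℝ (w t) (ψ i)) - u (s t i)) ^ 2 ≤ L * θ := by
      rw [← sq_abs]; nlinarith [abs_nonneg (u (inner ℝ (w t) (ψ i)) - u (s t i))]
    have h5 : (u (inner ℝ v (ψ i) + ξ i) - u (inner ℝ v (ψ i))) ^ 2 ≤ L * |ξ i| := by
      rw [← sq_abs]; nlinarith [abs_nonneg (u (inner ℝ v (ψ i) + ξ i) - u (inner ℝ v (ψ i)))]
    set p := u (inner ℝ (w t) (ψ i)) - u (s t i)
    set q := u (inner ℝ v (ψ i) + ξ i) - u (s t i)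
    set r := u (inner ℝ v (ψ i) + ξ i) - u (inner ℝ v (ψ i))
    have h6 : u (inner ℝ (w t) (ψ i)) - u (inner ℝ v (ψ i)) = p - q + r := by ring
    rw [h6]
    nlinarith [sq_nonneg (p + q), sq_nonneg (q + r), sq_nonneg (p - r)]
  calc _ ≤ (∑ i, 3 * (L * θ + (u (inner ℝ v (ψ i) + ξ i) - u (s t i)) ^ 2 + L * |ξ i|)) / (m : ℝ) := by
        gcongr with i
        exact hpt i
    _ = 3 * (L * θ + M t + L * X) := by
        simp only [← Finset.mul_sum, Finset.sum_add_distrib, Finset.sum_const, Finset.card_univ,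
          Fintype.card_fin, nsmul_eq_mul, hM, hX]
        field_simp
    _ ≤ _ := by linarith

end Training

end

end Alphatron

namespace Alphatron

open scoped ENNReal

noncomputable section

/-! ### Fast rates for the validation of finitely many hypotheses -/

section Validation

variable {Ω : Type*} [MeasurableSpace Ω]

theorem integrable_of_abs_le (D : Measure Ω) [IsProbabilityMeasure D] {Z : Ω → ℝ}
    (hZ : Measurable Z) {c : ℝ} (hc : ∀ p, |Z p| ≤ c) : Integrable Z D :=
  Integrable.of_bound hZ.aestronglyMeasurable c (Filter.Eventually.of_forall hc)

theorem lintegral_pi_prod (D : Measure Ω) [IsProbabilityMeasure D] {m : ℕ} {f : Ω → ℝ≥0∞}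
    (hf : Measurable f) :
    ∫⁻ x, ∏ i, f (x i) ∂(Measure.pi fun _ : Fin m => D) = (∫⁻ p, f p ∂D) ^ m := by
  induction m with
  | zero => simp
  | succ m ih =>
    have hm : ∀ k : ℕ, Measurable fun x : Fin k → Ω => ∏ i, f (x i) := fun k => by fun_prop
    rw [lintegral_pi_succ D (hm _)]
    simp only [Fin.prod_univ_succ, Fin.cons_zero, Fin.cons_succ]
    have : ∀ a, ∫⁻ x : Fin m → Ω, f a * ∏ i, f (x i) ∂(Measure.pi fun _ => D) =
        f a * (∫⁻ p, f p ∂D) ^ m := fun a => by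
      rw [lintegral_const_mul _ (hm _), ih]
    simp only [this]
    rw [lintegral_mul_const _ hf, pow_succ']

/-- Bernstein's inequality for variables whose second moment is bounded by `4 σ`. -/
theorem measure_sum_gt_le (D : Measure Ω) [IsProbabilityMeasure D] {m : ℕ} {Z : Ω → ℝ}
    (hZ : Measurable Z) (hZ1 : ∀ p, |Z p| ≤ 1) {σ : ℝ} (hσ : ∫ p, Z p ^ 2 ∂D ≤ 4 * σ) (r : ℝ) :
    (Measure.pi fun _ : Fin m => D) {S | m * (∫ p, Z p ∂D + σ / 2) + r < ∑ i, Z (S i)} ≤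
      ENNReal.ofReal (Real.exp (-(r / 8))) := by
  set μ := ∫ p, Z p ∂D with hμ
  set f : Ω → ℝ≥0∞ := fun p => ENNReal.ofReal (Real.exp (1 / 8 * (Z p - (μ + σ / 2)))) with hf
  have hfm : Measurable f := by fun_prop
  have hint : Integrable Z D := integrable_of_abs_le D hZ hZ1
  have hint2 : Integrable (fun p => Z p ^ 2) D :=
    integrable_of_abs_le D (hZ.pow_const 2) (c := 1) fun p => by
      rw [abs_pow]; exact pow_le_one₀ (abs_nonneg _) (hZ1 p)
  have h1 : ∫⁻ p, f p ∂D ≤ 1 := by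
    have hE : Integrable (fun p => Real.exp (1 / 8 * Z p)) D :=
      integrable_of_abs_le D (by fun_prop) (c := Real.exp (1 / 8)) fun p => by
        rw [Real.abs_exp]
        exact Real.exp_le_exp.2 (by linarith [(abs_le.1 (hZ1 p)).2])
    -- `exp x ≤ 1 + x + x²` for `|x| ≤ 1`. At the parameter `1 / 8` the quadratic term is at most `4
    -- σ / 64 = (1 / 8)(σ / 2)`, which fits into the allowance `σ / 2`.
    have h2 : ∫ p, Real.exp (1 / 8 * Z p) ∂D ≤ Real.exp (1 / 8 * (μ + σ / 2)) := by
      calc _ ≤ ∫ p, (1 + 1 / 8 * Z p + 1 / 64 * Z p ^ 2) ∂D := by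
            refine integral_mono hE ?_ fun p => ?_
            · exact ((integrable_const _).add (hint.const_mul _)).add (hint2.const_mul _)
            · have := (abs_le.1 (Real.abs_exp_sub_one_sub_id_le (x := 1 / 8 * Z p) (by
                rw [abs_mul, abs_of_pos (by norm_num : (0 : ℝ) < 1 / 8)]
                linarith [hZ1 p]))).2
              simp only
              linarith
        _ = 1 + 1 / 8 * μ + 1 / 64 * ∫ p, Z p ^ 2 ∂D := by
            have hi : Integrable (fun p => 1 + 1 / 8 * Z p) D :=
              (integrable_const _).add (hint.const_mul _)
            rw [integral_add hi (hint2.const_mul _),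
              integral_add (integrable_const _) (hint.const_mul _), integral_const_mul,
              integral_const_mul]
            simp [hμ]
        _ ≤ 1 / 8 * (μ + σ / 2) + 1 := by linarith
        _ ≤ _ := Real.add_one_le_exp _
    rw [hf, ← ofReal_integral_eq_lintegral_ofReal]
    · rw [← ENNReal.ofReal_one]
      refine ENNReal.ofReal_le_ofReal ?_
      simp only [mul_sub, Real.exp_sub, integral_div]
      exact div_le_one_of_le₀ h2 (Real.exp_pos _).le
    · simp only [mul_sub, Real.exp_sub]
      exact hE.div_const _
    · exact Filter.Eventually.of_forall fun p => (Real.exp_pos _).le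
  have h3 : {S : Fin m → Ω | m * (μ + σ / 2) + r < ∑ i, Z (S i)} ⊆
      {S | ENNReal.ofReal (Real.exp (r / 8)) ≤ ∏ i, f (S i)} := by
    intro S hS
    simp only [Set.mem_ofPred_eq, hf] at hS ⊢
    rw [← ENNReal.ofReal_prod_of_nonneg fun i _ => (Real.exp_pos _).le, ← Real.exp_sum]
    refine ENNReal.ofReal_le_ofReal (Real.exp_le_exp.2 ?_)
    rw [← Finset.mul_sum, Finset.sum_sub_distrib, Finset.sum_const, Finset.card_univ,
      Fintype.card_fin, nsmul_eq_mul]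
    linarith
  refine (measure_mono h3).trans ?_
  have h4 := meas_ge_le_lintegral_div (μ := Measure.pi fun _ : Fin m => D)
    (f := fun S => ∏ i, f (S i)) (Finset.univ.measurable_fun_prod fun i _ =>
      hfm.comp (measurable_pi_apply i)).aemeasurable
    (ε := ENNReal.ofReal (Real.exp (r / 8))) (by simp [Real.exp_pos]) ENNReal.ofReal_ne_top
  refine h4.trans ?_
  rw [lintegral_pi_prod D hfm, Real.exp_neg, ENNReal.ofReal_inv_of_pos (Real.exp_pos _)]
  rw [ENNReal.div_eq_inv_mul]
  exact mul_le_of_le_one_right' (pow_le_one' h1 m)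

/-- The excess empirical loss of finitely many functions is comparable with their mean squared
distance from the regression function `c`. -/
theorem measure_excess_loss_le (D : Measure Ω) [IsProbabilityMeasure D] {m T : ℕ} {c y : Ω → ℝ}
    {h : ℕ → Ω → ℝ} (hc : Measurable c) (hy : Measurable y) (hh : ∀ t, Measurable (h t))
    (hc1 : ∀ p, c p ∈ Set.Icc (0 : ℝ) 1) (hy1 : ∀ p, y p ∈ Set.Icc (0 : ℝ) 1)
    (hh1 : ∀ t p, h t p ∈ Set.Icc (0 : ℝ) 1)
    (hreg : ∀ t, ∫ p, (h t p - c p) * (y p - c p) ∂D = 0) (r : ℝ) :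
    (Measure.pi fun _ : Fin m => D) {V | ∃ t < T,
      ∑ i, ((h t (V i) - y (V i)) ^ 2 - (c (V i) - y (V i)) ^ 2) <
          m * ((∫ p, (h t p - c p) ^ 2 ∂D) / 2) - r ∨
        m * (3 / 2 * ∫ p, (h t p - c p) ^ 2 ∂D) + r <
          ∑ i, ((h t (V i) - y (V i)) ^ 2 - (c (V i) - y (V i)) ^ 2)} ≤
      ENNReal.ofReal (2 * T * Real.exp (-(r / 8))) := by
  set Y : ℕ → Ω → ℝ := fun t p => (h t p - y p) ^ 2 - (c p - y p) ^ 2 with hY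
  have hYm : ∀ t, Measurable (Y t) := fun t =>
    (((hh t).sub hy).pow_const 2).sub ((hc.sub hy).pow_const 2)
  have hY1 : ∀ t p, |Y t p| ≤ 1 := fun t p => by
    have a1 := hc1 p; have a2 := hy1 p; have a3 := hh1 t p
    have b1 : (h t p - y p) ^ 2 ≤ 1 := by
      rw [sq_le_one_iff_abs_le_one, abs_le]; constructor <;> linarith [a2.1, a2.2, a3.1, a3.2]
    have b2 : (c p - y p) ^ 2 ≤ 1 := by
      rw [sq_le_one_iff_abs_le_one, abs_le]; constructor <;> linarith [a2.1, a2.2, a1.1, a1.2]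
    rw [abs_le]
    constructor <;> simp only [hY] <;> linarith [sq_nonneg (h t p - y p), sq_nonneg (c p - y p)]
  have hd1 : ∀ t p, |h t p - c p| ≤ 1 := fun t p => by
    rw [abs_le]; constructor <;> linarith [(hc1 p).1, (hc1 p).2, (hh1 t p).1, (hh1 t p).2]
  have hi1 : ∀ t, Integrable (fun p => (h t p - c p) ^ 2) D := fun t =>
    integrable_of_abs_le D (((hh t).sub hc).pow_const 2) (c := 1) fun p => by
      rw [abs_pow]; exact pow_le_one₀ (abs_nonneg _) (hd1 t p)
  have hi2 : ∀ t, Integrable (fun p => (h t p - c p) * (y p - c p)) D := fun t =>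
    integrable_of_abs_le D (((hh t).sub hc).mul (hy.sub hc)) (c := 1) fun p => by
      rw [abs_mul]
      refine mul_le_one₀ (hd1 t p) (abs_nonneg _) ?_
      rw [abs_le]; constructor <;> linarith [(hc1 p).1, (hc1 p).2, (hy1 p).1, (hy1 p).2]
  -- The cross term vanishes since `c` is the regression function.
  have hYi : ∀ t, ∫ p, Y t p ∂D = ∫ p, (h t p - c p) ^ 2 ∂D := fun t => by
    have e : ∀ p, Y t p = (h t p - c p) ^ 2 - 2 * ((h t p - c p) * (y p - c p)) := fun p => by
      simp only [hY]; ring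
    simp only [e]
    rw [integral_sub (hi1 t) ((hi2 t).const_mul 2), integral_const_mul, hreg]
    ring
  -- `Y = (h - c)(h + c - 2 y)` with second factor at most `2` in absolute value. That the second
  -- moment is bounded by a multiple of the mean is the source of the fast rate.
  have hY2 : ∀ t, ∫ p, Y t p ^ 2 ∂D ≤ 4 * ∫ p, (h t p - c p) ^ 2 ∂D := fun t => by
    rw [← integral_const_mul]
    refine integral_mono (integrable_of_abs_le D ((hYm t).pow_const 2) (c := 1) fun p => by
      rw [abs_pow]; exact pow_le_one₀ (abs_nonneg _) (hY1 t p)) ((hi1 t).const_mul 4) fun p => ?_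
    have e : Y t p = (h t p - c p) * (h t p + c p - 2 * y p) := by simp only [hY]; ring
    have a1 := hc1 p; have a2 := hy1 p; have a3 := hh1 t p
    have b : (h t p + c p - 2 * y p) ^ 2 ≤ 4 := by
      have : |h t p + c p - 2 * y p| ≤ 2 := by
        rw [abs_le]; constructor <;> linarith [a1.1, a1.2, a2.1, a2.2, a3.1, a3.2]
      calc _ = |h t p + c p - 2 * y p| ^ 2 := (sq_abs _).symm
        _ ≤ 2 ^ 2 := by gcongr
        _ = 4 := by norm_num
    simp only [e, mul_pow]
    nlinarith [sq_nonneg (h t p - c p)]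
  have hsub : {V : Fin m → Ω | ∃ t < T, ∑ i, Y t (V i) <
          m * ((∫ p, (h t p - c p) ^ 2 ∂D) / 2) - r ∨
        m * (3 / 2 * ∫ p, (h t p - c p) ^ 2 ∂D) + r < ∑ i, Y t (V i)} ⊆
      ⋃ t ∈ Finset.range T,
        ({V | m * (∫ p, -Y t p ∂D + (∫ p, (h t p - c p) ^ 2 ∂D) / 2) + r < ∑ i, -Y t (V i)} ∪
        {V | m * (∫ p, Y t p ∂D + (∫ p, (h t p - c p) ^ 2 ∂D) / 2) + r < ∑ i, Y t (V i)}) := by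
    rintro V ⟨t, ht, hV⟩
    simp only [Set.mem_iUnion, Finset.mem_range]
    refine ⟨t, ht, ?_⟩
    rcases hV with hV | hV
    · left
      simp only [Set.mem_ofPred_eq, integral_neg, hYi, Finset.sum_neg_distrib]
      linarith
    · right
      simp only [Set.mem_ofPred_eq, hYi]
      linarith
  refine (measure_mono hsub).trans ((measure_biUnion_finset_le _ _).trans ?_)
  calc _ ≤ ∑ t ∈ Finset.range T, ENNReal.ofReal (2 * Real.exp (-(r / 8))) := by
        refine Finset.sum_le_sum fun t _ => (measure_union_le _ _).trans ?_
        rw [two_mul, ENNReal.ofReal_add (Real.exp_pos _).le (Real.exp_pos _).le]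
        refine add_le_add ?_ ?_
        · exact measure_sum_gt_le D (hYm t).neg (fun p => (abs_neg _).trans_le (hY1 t p))
            (by simpa using hY2 t) r
        · exact measure_sum_gt_le D (hYm t) (hY1 t) (hY2 t) r
    _ = _ := by
        rw [Finset.sum_const, Finset.card_range, nsmul_eq_mul, ← ENNReal.ofReal_natCast,
          ← ENNReal.ofReal_mul (Nat.cast_nonneg _)]
        congr 1; ring

end Validation

/-! ### The regression function -/

/-- A bounded function of the point can be taken out of the conditional expectation given the point.
-/
theorem integral_mul_sub_concept_eq_zero {n : ℕ} (D : Measure (Example n)) [IsProbabilityMeasure D]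
    {c : EuclideanSpace ℝ (Fin n) → ℝ} (hc : Measurable c) (hc1 : ∀ x, c x ∈ Set.Icc (0 : ℝ) 1)
    (hreg : D[fun p => (p.2 : ℝ) | MeasurableSpace.comap Prod.fst inferInstance]
      =ᵐ[D] fun p => c p.1) {g : EuclideanSpace ℝ (Fin n) → ℝ} (hg : Measurable g) {k : ℝ}
    (hgk : ∀ p : Example n, |g p.1| ≤ k) :
    ∫ p : Example n, g p.1 * ((p.2 : ℝ) - c p.1) ∂D = 0 := by
  have hm : MeasurableSpace.comap (Prod.fst : Example n → _) inferInstance ≤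
      (inferInstance : MeasurableSpace (Example n)) := measurable_fst.comap_le
  have hcoe : Measurable fun p : Example n => (p.1 : EuclideanSpace ℝ (Fin n)) :=
    measurable_subtype_coe.comp measurable_fst
  have hgm : Measurable fun p : Example n => g p.1 := hg.comp hcoe
  have hcm : Measurable fun p : Example n => c p.1 := hc.comp hcoe
  have hy : Measurable fun p : Example n => (p.2 : ℝ) := measurable_subtype_coe.comp measurable_snd
  have hy1 : ∀ p : Example n, |(p.2 : ℝ)| ≤ 1 := fun p => by
    rw [abs_of_nonneg p.2.2.1]; exact p.2.2.2
  have hyi : Integrable (fun p : Example n => (p.2 : ℝ)) D := integrable_of_abs_le D hy hy1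
  have hk : 0 ≤ k := by
    obtain ⟨p⟩ : Nonempty (Example n) := ⟨⟨⟨0, by simp⟩, 0⟩⟩
    exact (abs_nonneg _).trans (hgk p)
  have hgy : Integrable (fun p : Example n => g p.1 * (p.2 : ℝ)) D :=
    integrable_of_abs_le D (hgm.mul hy) (c := k * 1) fun p => by
      rw [abs_mul]; exact mul_le_mul (hgk p) (hy1 p) (abs_nonneg _) hk
  have hgc : Integrable (fun p : Example n => g p.1 * c p.1) D :=
    integrable_of_abs_le D (hgm.mul hcm) (c := k * 1) fun p => by
      rw [abs_mul]
      refine mul_le_mul (hgk p) ?_ (abs_nonneg _) hk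
      rw [abs_of_nonneg (hc1 _).1]; exact (hc1 _).2
  have hgs : StronglyMeasurable[MeasurableSpace.comap (Prod.fst : Example n → _) inferInstance]
      fun p : Example n => g p.1 := by
    refine Measurable.stronglyMeasurable ?_
    exact (hg.comp measurable_subtype_coe).comp (comap_measurable _)
  have h1 := condExp_mul_of_stronglyMeasurable_left (μ := D) hgs hgy hyi
  have h2 := integral_condExp hm (μ := D) (f := fun p : Example n => g p.1 * (p.2 : ℝ))
  have h3 : ∫ p, g p.1 * (p.2 : ℝ) ∂D = ∫ p, g p.1 * c p.1 ∂D := by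
    rw [← h2]
    refine integral_congr_ae (h1.trans ?_)
    filter_upwards [hreg] with p hp
    simp only [Pi.mul_apply, hp]
  simp only [mul_sub]
  rw [integral_sub hgy hgc, h3, sub_self]

end

end Alphatron

namespace Alphatron

open scoped ENNReal

noncomputable section

/-! ### The feature map -/

section Features

variable {n : ℕ}

theorem measurable_featureMap (d : ℕ) :
    Measurable (featureMap d : EuclideanSpace ℝ (Fin n) → _) := by
  have : Continuous (featureMap d : EuclideanSpace ℝ (Fin n) → _) := by
    unfold featureMap
    refine (PiLp.continuous_toLp 2 _).comp ?_
    fun_prop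
  exact this.measurable

/-- Summing `∏ x_{k_j} y_{k_j}` over all tuples of length `i` expands the power `⟨x, y⟩ ^ i`. -/
theorem kernel_eq_kernelValue (d : ℕ) (x y : EuclideanSpace ℝ (Fin n)) :
    kernel d x y = kernelValue d (∑ l, x l * y l) := by
  have hd : (0 : ℝ) < (d : ℝ) + 1 := by positivity
  have h1 : ∀ k : Σ i : Fin (d + 1), (Fin (i : ℕ) → Fin n),
      inner ℝ ((featureMap d x) k) ((featureMap d y) k) =
        (∏ j, x (k.2 j) * y (k.2 j)) / (d + 1) := fun k => by
    have h2 : (1 / √((d : ℝ) + 1)) * (1 / √((d : ℝ) + 1)) = 1 / (d + 1) := by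
      rw [div_mul_div_comm, one_mul, Real.mul_self_sqrt hd.le]
    simp only [featureMap, Finset.prod_mul_distrib, RCLike.inner_apply, conj_trivial]
    calc _ = ((1 / √((d : ℝ) + 1)) * (1 / √((d : ℝ) + 1))) *
          ((∏ j, x (k.2 j)) * ∏ j, y (k.2 j)) := by ring
      _ = _ := by rw [h2]; ring
  unfold kernel kernelValue
  rw [PiLp.inner_apply]
  simp only [h1]
  rw [← Finset.sum_div, Fintype.sum_sigma, Finset.sum_range]
  congr 1
  refine Finset.sum_congr rfl fun i _ => ?_
  rw [Fintype.sum_pow]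

theorem sum_sq_le_one {x : EuclideanSpace ℝ (Fin n)} (hx : ‖x‖ ≤ 1) : ∑ l, x l ^ 2 ≤ 1 := by
  rw [← EuclideanSpace.real_norm_sq_eq]
  exact pow_le_one₀ (norm_nonneg _) hx

theorem norm_featureMap_le (d : ℕ) {x : EuclideanSpace ℝ (Fin n)} (hx : ‖x‖ ≤ 1) :
    ‖featureMap d x‖ ≤ 1 := by
  rw [← sq_le_one_iff₀ (norm_nonneg _), ← real_inner_self_eq_norm_sq]
  change kernel d x x ≤ 1
  rw [kernel_eq_kernelValue, kernelValue, div_le_one (by positivity)]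
  have h0 : 0 ≤ ∑ l, x l * x l := Finset.sum_nonneg fun l _ => mul_self_nonneg _
  have h1 : ∑ l, x l * x l ≤ 1 := by simpa only [sq] using sum_sq_le_one hx
  calc ∑ k ∈ Finset.range (d + 1), (∑ l, x l * x l) ^ k ≤ ∑ k ∈ Finset.range (d + 1), (1 : ℝ) :=
        Finset.sum_le_sum fun k _ => pow_le_one₀ h0 h1
    _ = _ := by simp

theorem norm_example_le (p : Example n) : ‖(p.1 : EuclideanSpace ℝ (Fin n))‖ ≤ 1 :=
  mem_closedBall_zero_iff.1 p.1.2

theorem measurable_point : Measurable fun p : Example n => (p.1 : EuclideanSpace ℝ (Fin n)) :=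
  measurable_subtype_coe.comp measurable_fst

theorem measurable_label : Measurable fun p : Example n => (p.2 : ℝ) :=
  measurable_subtype_coe.comp measurable_snd

end Features

/-! ### Good training sets -/

section Training

variable {n d : ℕ} {B L ζ ε : ℝ} {u : ℝ → ℝ}
  {v : EuclideanSpace ℝ (Σ i : Fin (d + 1), (Fin (i : ℕ) → Fin n))}
  {ξ : EuclideanSpace ℝ (Fin n) → ℝ} {D : Measure (Example n)}

theorem InConceptClass.measurable_concept (h : InConceptClass B L ζ ε u v ξ D) :
    Measurable (concept u v ξ) := by
  refine h.monotone_u.measurable.comp (Measurable.add ?_ h.measurable_noise)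
  exact (continuous_const.inner continuous_id).measurable.comp (measurable_featureMap d)

/-- The properties of a training set that are used in the analysis of the training loop, with
`s = √(log (1 / δ) / m)`. -/
structure GoodTraining (B L ζ ε s : ℝ) (u : ℝ → ℝ)
    (v : EuclideanSpace ℝ (Σ i : Fin (d + 1), (Fin (i : ℕ) → Fin n)))
    (ξ : EuclideanSpace ℝ (Fin n) → ℝ) (D : Measure (Example n)) {m : ℕ}
    (S : Fin m → Example n) : Prop where
  gradient : ‖∑ i, (((S i).2 : ℝ) - concept u v ξ (S i).1) • featureMap d (S i).1.1‖ ≤ m * (3 * s)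
  noise : ∑ i, ξ (S i).1 ^ 2 ≤ m * (ε + ζ ^ 2 * (3 * s))
  uniform : ∀ w, ‖w - v‖ ≤ B →
    ∫ p, (u (inner ℝ w (featureMap d p.1.1)) - u (inner ℝ v (featureMap d p.1.1))) ^ 2 ∂D ≤
      (∑ i, (u (inner ℝ w (featureMap d (S i).1.1)) -
        u (inner ℝ v (featureMap d (S i).1.1))) ^ 2) / m + 20 * (B * L * s)

variable [IsProbabilityMeasure D]

/-- Each property fails with probability at most `δ / 3`: vector concentration for the gradient, the
same in dimension one for `ξ²`, and uniform convergence over the ball for the squared errors. -/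
theorem InConceptClass.measure_not_goodTraining_le (h : InConceptClass B L ζ ε u v ξ D) (hB : 0 < B)
    (hL : 0 < L) (hζ : 0 < ζ) {m : ℕ} (hm : 1 ≤ m) {δ : ℝ} (hδ : 0 < δ) (hδ' : δ < 1 / 3) :
    Measure.pi (fun _ : Fin m => D)
      {S | ¬ GoodTraining B L ζ ε √(Real.log (1 / δ) / m) u v ξ D S} ≤ ENNReal.ofReal δ := by
  have hm' : (0 : ℝ) < m := by exact_mod_cast hm
  set ℓ := Real.log (1 / δ) with hℓ
  set s := √(ℓ / m) with hs
  have hℓ1 : 1 ≤ ℓ := one_le_log (by rw [le_div_iff₀ hδ]; linarith)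
  -- The left side is `log 6 + ℓ`, and `log 6 ≤ 2 ≤ 2 ℓ`.
  have hlog : Real.log (2 / (δ / 3)) ≤ 3 * ℓ := by
    have e : 2 / (δ / 3) = 6 * (1 / δ) := by field_simp; norm_num
    rw [e, Real.log_mul (by norm_num) (by positivity)]
    have h6 : Real.log 6 ≤ 2 := by
      rw [Real.log_le_iff_le_exp (by norm_num)]
      have h1 := Real.exp_one_gt_d9
      have h2 : Real.exp 2 = Real.exp 1 * Real.exp 1 := by rw [← Real.exp_add]; norm_num
      nlinarith
    linarith
  have hsq : m * m * s ^ 2 = m * ℓ := by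
    rw [hs, Real.sq_sqrt (by positivity)]; field_simp
  have hs0 : 0 ≤ s := Real.sqrt_nonneg _
  -- Since `m² s² = m ℓ`, the constants `3` here and `5` below come from `2 · 3 ≤ 3²` and `8 · 3 ≤
  -- 5²`.
  have hr1 : √(2 * m * Real.log (2 / (δ / 3))) ≤ m * (3 * s) := by
    rw [Real.sqrt_le_left (by positivity)]
    have : 2 * m * Real.log (2 / (δ / 3)) ≤ 2 * m * (3 * ℓ) := by gcongr
    nlinarith
  have hr2 : √(8 * m * Real.log (2 / (δ / 3))) ≤ m * (5 * s) := by
    rw [Real.sqrt_le_left (by positivity)]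
    have : 8 * m * Real.log (2 / (δ / 3)) ≤ 8 * m * (3 * ℓ) := by gcongr
    nlinarith
  have hum := h.monotone_u.measurable
  have hcm := h.measurable_concept
  have hψ : Measurable fun p : Example n => featureMap d p.1.1 :=
    (measurable_featureMap d).comp measurable_point
  have hψ1 : ∀ p : Example n, ‖featureMap d p.1.1‖ ≤ 1 := fun p =>
    norm_featureMap_le d (norm_example_le p)
  have hlin : ∀ w, Measurable fun p : Example n => u (inner ℝ w (featureMap d p.1.1)) := fun w =>
    hum.comp ((continuous_const.inner continuous_id).measurable.comp hψ)
  have hu1 : ∀ s t, |u s - u t| ≤ 1 := fun s t => by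
    rw [abs_le]
    constructor <;> linarith [(h.range_u s).1, (h.range_u s).2, (h.range_u t).1, (h.range_u t).2]
  have hb1 : Measure.pi (fun _ : Fin m => D) {S | 1 * √(2 * m * Real.log (2 / (δ / 3))) <
      ‖∑ i, (((S i).2 : ℝ) - concept u v ξ (S i).1) • featureMap d (S i).1.1‖} ≤
      ENNReal.ofReal (δ / 3) := by
    refine measure_norm_sum_gt_le D
      (Z := fun p => ((p.2 : ℝ) - concept u v ξ p.1) • featureMap d p.1.1)
      ((measurable_label.sub (hcm.comp measurable_point)).smul hψ) one_pos (fun p => ?_)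
      (fun x => ?_) hm (by positivity) (by linarith)
    · rw [norm_smul]
      refine mul_le_one₀ ?_ (norm_nonneg _) (hψ1 p)
      have h1 : concept u v ξ p.1 ∈ Set.Icc (0 : ℝ) 1 := h.range_u _
      rw [Real.norm_eq_abs, abs_le]
      constructor <;> linarith [p.2.2.1, p.2.2.2, h1.1, h1.2]
    · have h1 := integral_mul_sub_concept_eq_zero D hcm (fun x => h.range_u _) h.regression
        (g := fun z => inner ℝ x (featureMap d z))
        ((continuous_const.inner continuous_id).measurable.comp (measurable_featureMap d))
        (k := ‖x‖) fun p => (abs_real_inner_le_norm _ _).trans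
          (mul_le_of_le_one_right (norm_nonneg _) (hψ1 p))
      rw [← h1]
      refine integral_congr_ae (Filter.Eventually.of_forall fun p => ?_)
      simp only [real_inner_smul_right]
      ring
  have hξ2 : ∀ x, ξ x ^ 2 ≤ ζ ^ 2 := fun x => sq_le_sq' (h.noise_range x).1 (h.noise_range x).2
  have hξm : Measurable fun p : Example n => ξ p.1 ^ 2 :=
    (h.measurable_noise.comp measurable_point).pow_const 2
  have hξi : Integrable (fun p : Example n => ξ p.1 ^ 2) D :=
    integrable_of_abs_le D hξm (c := ζ ^ 2) fun p => by
      rw [abs_of_nonneg (sq_nonneg _)]; exact hξ2 _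
  set μ := ∫ p, ξ p.1 ^ 2 ∂D with hμ
  have hμ0 : 0 ≤ μ := integral_nonneg fun p => sq_nonneg _
  have hμ1 : μ ≤ ζ ^ 2 := by
    calc μ ≤ ∫ p, ζ ^ 2 ∂D := integral_mono hξi (integrable_const _) fun p => hξ2 _
      _ = ζ ^ 2 := by simp
  -- The squares of the noise are concentrated, since their mean is what `ε` controls. The later
  -- square root turns `ζ² s` into `ζ √s`, the fourth root in `A₂`.
  have hb2 : Measure.pi (fun _ : Fin m => D) {S | ζ ^ 2 * √(2 * m * Real.log (2 / (δ / 3))) <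
      ‖∑ i, (ξ (S i).1 ^ 2 - μ)‖} ≤ ENNReal.ofReal (δ / 3) := by
    refine measure_norm_sum_gt_le D (Z := fun p => ξ p.1 ^ 2 - μ) (hξm.sub_const μ)
      (by positivity) (fun p => ?_) (fun x => ?_) hm (by positivity) (by linarith)
    · rw [Real.norm_eq_abs, abs_le]
      constructor <;> linarith [hξ2 p.1, sq_nonneg (ξ p.1)]
    · have e : ∀ p : Example n, inner ℝ x (ξ p.1 ^ 2 - μ) = (ξ p.1 ^ 2 - μ) * x := fun p => by
        simp [RCLike.inner_apply]
      simp only [e]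
      rw [integral_mul_const, integral_sub hξi (integrable_const _)]
      simp [hμ]
  set g : EuclideanSpace ℝ (Σ i : Fin (d + 1), (Fin (i : ℕ) → Fin n)) → Example n → ℝ :=
    fun w p => (u (inner ℝ w (featureMap d p.1.1)) - u (inner ℝ v (featureMap d p.1.1))) ^ 2
    with hg
  have hgm : ∀ w, Measurable (g w) := fun w => ((hlin w).sub (hlin v)).pow_const 2
  have hg1 : ∀ w p, |g w p| ≤ 1 := fun w p => by
    rw [hg, abs_pow]; exact pow_le_one₀ (abs_nonneg _) (hu1 _ _)
  -- The Lipschitz constant is `2 L`: a difference of squares of numbers in `[-1, 1]` has a factor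
  -- at most `2`.
  have hb3 : Measure.pi (fun _ : Fin m => D) {S | ∃ w ∈ Metric.closedBall v B,
      2 * (2 * L * B * √(8 * m * Real.log (2 / (δ / 3)))) <
        ∑ i, (∫ x, g w x ∂D - g w (S i))} ≤ ENNReal.ofReal (δ / 3) := by
    refine measure_exists_deviation_le D hB hψ hψ1 hgm hg1 (by positivity) (fun w w' p => ?_)
      (fun p => by simp [hg]) hm (by positivity) (by linarith)
    set a := u (inner ℝ w (featureMap d p.1.1))
    set a' := u (inner ℝ w' (featureMap d p.1.1))
    set a₀ := u (inner ℝ v (featureMap d p.1.1))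
    have h1 : |a - a'| ≤ L * |inner ℝ (w - w') (featureMap d p.1.1)| := by
      rw [inner_sub_left]; exact h.lipschitz_u _ _
    have h2 : |a - a₀ + (a' - a₀)| ≤ 2 := by
      refine (abs_add_le _ _).trans ?_
      linarith [hu1 (inner ℝ w (featureMap d p.1.1)) (inner ℝ v (featureMap d p.1.1)),
        hu1 (inner ℝ w' (featureMap d p.1.1)) (inner ℝ v (featureMap d p.1.1))]
    have e : (a - a₀) ^ 2 - (a' - a₀) ^ 2 = (a - a₀ + (a' - a₀)) * (a - a') := by ring
    change |(a - a₀) ^ 2 - (a' - a₀) ^ 2| ≤ _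
    rw [e, abs_mul, mul_assoc]
    exact mul_le_mul h2 h1 (abs_nonneg _) (by norm_num)
  refine (measure_mono (t := {S | 1 * √(2 * m * Real.log (2 / (δ / 3))) <
      ‖∑ i, (((S i).2 : ℝ) - concept u v ξ (S i).1) • featureMap d (S i).1.1‖} ∪
    ({S | ζ ^ 2 * √(2 * m * Real.log (2 / (δ / 3))) < ‖∑ i, (ξ (S i).1 ^ 2 - μ)‖} ∪
      {S | ∃ w ∈ Metric.closedBall v B, 2 * (2 * L * B * √(8 * m * Real.log (2 / (δ / 3)))) <
        ∑ i, (∫ x, g w x ∂D - g w (S i))})) ?_).trans ?_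
  · intro S hS
    by_contra hcon
    simp only [Set.mem_union, Set.mem_ofPred_eq, not_or, not_lt, not_exists, not_and] at hcon
    obtain ⟨c1, c2, c3⟩ := hcon
    refine hS ⟨?_, ?_, fun w hw => ?_⟩
    · rw [one_mul] at c1
      exact c1.trans hr1
    · have h1 := (le_abs_self _).trans c2
      rw [Finset.sum_sub_distrib, Finset.sum_const, Finset.card_univ, Fintype.card_fin,
        nsmul_eq_mul] at h1
      have h2 : ζ ^ 2 * √(2 * m * Real.log (2 / (δ / 3))) ≤ ζ ^ 2 * (m * (3 * s)) := by gcongr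
      have h3 : m * μ ≤ m * ε := by gcongr; exact h.noise_sq
      linarith
    · have h1 := c3 w (by rwa [Metric.mem_closedBall, dist_eq_norm])
      rw [Finset.sum_sub_distrib, Finset.sum_const, Finset.card_univ, Fintype.card_fin,
        nsmul_eq_mul] at h1
      have h2 : 2 * (2 * L * B * √(8 * m * Real.log (2 / (δ / 3)))) ≤
          2 * (2 * L * B * (m * (5 * s))) := by gcongr
      change ∫ p, g w p ∂D ≤ (∑ i, g w (S i)) / m + _
      rw [← sub_le_iff_le_add', ← mul_le_mul_iff_right₀ hm', mul_sub, mul_div_cancel₀ _ hm'.ne']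
      linarith
  · refine (measure_union_le _ _).trans ((add_le_add_right (measure_union_le _ _) _).trans ?_)
    calc _ ≤ ENNReal.ofReal (δ / 3) + (ENNReal.ofReal (δ / 3) + ENNReal.ofReal (δ / 3)) :=
          add_le_add hb1 (add_le_add hb2 hb3)
      _ = ENNReal.ofReal δ := by
          rw [← ENNReal.ofReal_add (by positivity) (by positivity),
            ← ENNReal.ofReal_add (by positivity) (by positivity)]
          congr 1; ring

end Training

end

end Alphatron

namespace Alphatron

open Prog
open scoped ENNReal

noncomputable section

/-! ### The run of the algorithm -/

section Run

variable {n d m₁ m₂ T : ℕ} {u : ℝ → ℝ}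

/-- The coordinates of the points of a sample. -/
def points {m : ℕ} (S : Fin m → Example n) : Fin m → Fin n → ℝ := fun i k => (S i).1.1 k

theorem measurable_points {m : ℕ} : Measurable (points : (Fin m → Example n) → _) := by
  refine measurable_pi_lambda _ fun i => measurable_pi_lambda _ fun k => ?_
  have h : Measurable fun x : EuclideanSpace ℝ (Fin n) => x k := by fun_prop
  exact h.comp (measurable_point.comp (measurable_pi_apply i))

/-- The two matrices of approximate kernel values. -/
def grams (N k d : ℕ) (S : Fin m₁ → Example n) (V : Fin m₂ → Example n) :
    Prog ((Fin m₁ → Fin m₁ → ℝ) × (Fin m₂ → Fin m₁ → ℝ)) :=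
  gram N k d (points S) (points S) >>= fun K =>
    gram N k d (points V) (points S) >>= fun K' => pure (K, K')

/-- The result of a run in terms of the approximate kernel values. -/
theorem runApproxPre_spec (hT : 0 < T) (lam εK δK : ℝ) (S : Fin m₁ → Example n)
    (V : Fin m₂ → Example n) (ω : ℕ → unitInterval) {N k : ℕ} (hN : meanSize (εK / (3 * d)) = N)
    (hk : numMeans (δK / (m₁ ^ 2 + m₁ * m₂)) = k) {K : Fin m₁ → Fin m₁ → ℝ}
    {K' : Fin m₂ → Fin m₁ → ℝ} (hK : (exec u (grams N k d S V) ω).value = (K, K')) :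
    ∃ t < T, (runApproxPre u d T lam εK δK S V ω).value =
        coeff u lam (fun i => ((S i).2 : ℝ)) K t ∧
      ∀ s < T, validationValue u (fun i => ((V i).2 : ℝ)) K'
          (coeff u lam (fun i => ((S i).2 : ℝ)) K t) ≤
        validationValue u (fun i => ((V i).2 : ℝ)) K'
          (coeff u lam (fun i => ((S i).2 : ℝ)) K s) := by
  obtain ⟨t, ht, h1, h2⟩ := alphatronWithKernel_spec (u := u) hT lam (fun i => ((S i).2 : ℝ))
    (fun i => ((V i).2 : ℝ)) K K'
  refine ⟨t, ht, ?_, h2⟩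
  unfold runApproxPre
  rw [alphatronWithApproxPre_eq, hN, hk]
  unfold grams at hK
  simp only [exec_bind] at hK ⊢
  obtain ⟨rfl, rfl⟩ := Prod.mk.inj hK
  exact (h1.value_tape _).1

/-- The training matrix is computed before the validation points are used, so the iterates do not
depend on them. -/
theorem exec_grams_fst (N k : ℕ) (S : Fin m₁ → Example n) (V : Fin m₂ → Example n)
    (ω : ℕ → unitInterval) : (exec u (grams N k d S V) ω).value.1 =
      (exec u (gram N k d (points S) (points S)) ω).value := by
  unfold grams
  simp only [exec_bind]
  rfl

theorem measurableProg_grams (N k : ℕ) :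
    MeasurableProg u fun q : (Fin m₁ → Example n) × (Fin m₂ → Example n) =>
      grams N k d q.1 q.2 := by
  refine .bind (measurableProg_gram (measurable_points.comp measurable_fst)
    (measurable_points.comp measurable_fst) N k d) (.bind (measurableProg_gram
      (measurable_points.comp (measurable_snd.comp measurable_fst))
      (measurable_points.comp (measurable_fst.comp measurable_fst)) N k d)
      (.of_returns (fun _ => rfl) ?_))
  exact (measurable_snd.comp measurable_fst).prodMk measurable_snd

/-- The matrices of approximate kernel values are accurate. -/
def Accurate (εK : ℝ) (d : ℕ) (S : Fin m₁ → Example n) (V : Fin m₂ → Example n)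
    (q : (Fin m₁ → Fin m₁ → ℝ) × (Fin m₂ → Fin m₁ → ℝ)) : Prop :=
  (∀ i j, |q.1 i j - kernel d (S i).1.1 (S j).1.1| ≤ εK) ∧
    ∀ i j, |q.2 i j - kernel d (V i).1.1 (S j).1.1| ≤ εK

theorem measurable_kernel_comp {X : Type*} [MeasurableSpace X] {a b : X → Example n}
    (ha : Measurable a) (hb : Measurable b) :
    Measurable fun x => kernel d (a x).1.1 (b x).1.1 := by
  have hψ : Measurable fun p : Example n => featureMap d p.1.1 :=
    (measurable_featureMap d).comp measurable_point
  exact continuous_inner.measurable.comp ((hψ.comp ha).prodMk (hψ.comp hb))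

theorem measurable_grams (N k : ℕ) : Measurable
    fun q : (Fin m₁ → Example n) × (Fin m₂ → Example n) × (ℕ → unitInterval) =>
      (exec u (grams N k d q.1 q.2.1) q.2.2).value :=
  (measurable_fst.comp (measurableProg_grams (u := u) (d := d) N k)).comp
    ((measurable_fst.prodMk (measurable_fst.comp measurable_snd)).prodMk
      (measurable_snd.comp measurable_snd))

theorem measurableSet_accurate (εK : ℝ) {X : Type*} [MeasurableSpace X]
    {S : X → Fin m₁ → Example n} {V : X → Fin m₂ → Example n}
    {K : X → (Fin m₁ → Fin m₁ → ℝ) × (Fin m₂ → Fin m₁ → ℝ)} (hS : Measurable S)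
    (hV : Measurable V) (hK : Measurable K) :
    MeasurableSet {x | Accurate εK d (S x) (V x) (K x)} := by
  have hSi : ∀ i, Measurable fun x => S x i := fun i => (measurable_pi_apply i).comp hS
  have hVi : ∀ i, Measurable fun x => V x i := fun i => (measurable_pi_apply i).comp hV
  have h1 : ∀ i j, Measurable fun x => (K x).1 i j := fun i j =>
    (measurable_pi_apply j).comp ((measurable_pi_apply i).comp hK.fst)
  have h2 : ∀ i j, Measurable fun x => (K x).2 i j := fun i j =>
    (measurable_pi_apply j).comp ((measurable_pi_apply i).comp hK.snd)
  simp only [Accurate, Set.ofPred_and, Set.ofPred_forall]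
  refine MeasurableSet.inter ?_ ?_
  · refine .iInter fun i => .iInter fun j => measurableSet_le ?_ measurable_const
    exact ((h1 i j).sub (measurable_kernel_comp (hSi i) (hSi j))).abs
  · refine .iInter fun i => .iInter fun j => measurableSet_le ?_ measurable_const
    exact ((h2 i j).sub (measurable_kernel_comp (hVi i) (hSi j))).abs

/-- The probability of an inaccurate entry is at most the expected number of such entries, `m₁ (m₁ +
m₂)` times the failure probability `q` of one entry. -/
theorem tapeLaw_grams_le (S : Fin m₁ → Example n) (V : Fin m₂ → Example n)
    (hd : 1 ≤ d) (hm₁ : 1 ≤ m₁) {εK δ : ℝ} (hε : 0 < εK) (hε1 : εK ≤ 1) (hδ : 0 < δ) (hδ1 : δ < 1) :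
    tapeLaw {ω | ¬ Accurate εK d S V (exec u (grams (meanSize (εK / (3 * d)))
      (numMeans (δ / (m₁ ^ 2 + m₁ * m₂))) d S V) ω).value} ≤ ENNReal.ofReal δ := by
  have hd' : (0 : ℝ) < d := by exact_mod_cast hd
  have hm' : (1 : ℝ) ≤ m₁ := by exact_mod_cast hm₁
  set e := εK / (3 * d) with he
  have he0 : 0 < e := by positivity
  have hde : 3 * d * e = εK := by rw [he]; field_simp
  set q := δ / (m₁ ^ 2 + m₁ * m₂ : ℝ) with hq
  have hmm : (1 : ℝ) ≤ m₁ ^ 2 + m₁ * m₂ := by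
    have : (0 : ℝ) ≤ m₁ * m₂ := by positivity
    nlinarith
  have hq0 : 0 < q := by positivity
  have hq1 : q < 1 := by rw [hq, div_lt_one (by linarith)]; linarith
  have hS : ∀ i, ∑ l, points S i l ^ 2 ≤ 1 := fun i => sum_sq_le_one (norm_example_le _)
  have hV : ∀ i, ∑ l, points V i l ^ 2 ≤ 1 := fun i => sum_sq_le_one (norm_example_le _)
  have h1 := wp_gram_le (u := u) d hS hS he0 (hde.trans_le hε1) hq0 hq1
  have h2 := wp_gram_le (u := u) d hV hS he0 (hde.trans_le hε1) hq0 hq1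
  set F : (Fin m₁ → Fin m₁ → ℝ) → ℝ≥0∞ := fun K => ∑ i, ∑ j,
    {z | 3 * d * e < |z - kernelValue d (∑ l, points S i l * points S j l)|}.indicator 1 (K i j)
    with hF
  set F' : (Fin m₂ → Fin m₁ → ℝ) → ℝ≥0∞ := fun K => ∑ i, ∑ j,
    {z | 3 * d * e < |z - kernelValue d (∑ l, points V i l * points S j l)|}.indicator 1 (K i j)
    with hF'
  have hpt : ∀ r : (Fin m₁ → Fin m₁ → ℝ) × (Fin m₂ → Fin m₁ → ℝ),
      {q | ¬ Accurate εK d S V q}.indicator 1 r ≤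
        F r.1 + F' r.2 := fun r => by
    by_cases hr : Accurate εK d S V r
    · rw [Set.indicator_of_notMem (not_not.2 hr)]
      exact bot_le
    rw [Set.indicator_of_mem (show r ∈ {q | ¬ Accurate εK d S V q} from hr)]
    simp only [Accurate, not_and_or, not_forall, not_le] at hr
    rcases hr with ⟨i, j, hij⟩ | ⟨i, j, hij⟩
    · refine le_trans ?_ le_self_add
      rw [hF]
      refine le_trans ?_ (Finset.single_le_sum (fun _ _ => bot_le) (Finset.mem_univ i))
      refine le_trans ?_ (Finset.single_le_sum (fun _ _ => bot_le) (Finset.mem_univ j))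
      rw [kernel_eq_kernelValue] at hij
      rw [Set.indicator_of_mem (by rw [hde]; exact hij)]
      rfl
    · refine le_trans ?_ le_add_self
      rw [hF']
      refine le_trans ?_ (Finset.single_le_sum (fun _ _ => bot_le) (Finset.mem_univ i))
      refine le_trans ?_ (Finset.single_le_sum (fun _ _ => bot_le) (Finset.mem_univ j))
      rw [kernel_eq_kernelValue] at hij
      rw [Set.indicator_of_mem (by rw [hde]; exact hij)]
      rfl
  have hmeas : MeasurableSet {ω | (exec u (grams (meanSize e) (numMeans q) d S V) ω).value ∈
      {q | ¬ Accurate εK d S V q}} :=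
    (measurableSet_accurate εK measurable_const measurable_const
      ((measurable_grams (d := d) (meanSize e) (numMeans q)).comp
        (measurable_prodMk_left.comp measurable_prodMk_left))).compl
  refine (tapeLaw_exec _ {q | ¬ Accurate εK d S V q} hmeas).trans_le ?_
  refine (wp_mono _ hpt).trans ?_
  unfold grams
  simp only [wp_bind, wp_pure]
  calc _ ≤ wp u (gram (meanSize e) (numMeans q) d (points S) (points S)) (fun K =>
        F K + m₂ * m₁ * ENNReal.ofReal q) := wp_mono _ fun K => by
          simp only [add_comm (F K)]
          rw [wp_add_const]
          gcongr
    _ ≤ m₁ * m₁ * ENNReal.ofReal q + m₂ * m₁ * ENNReal.ofReal q := by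
          rw [wp_add_const]
          gcongr
    _ = ENNReal.ofReal δ := by
          rw [← add_mul, ← ENNReal.ofReal_natCast, ← ENNReal.ofReal_natCast,
            ← ENNReal.ofReal_mul (by positivity), ← ENNReal.ofReal_mul (by positivity),
            ← ENNReal.ofReal_add (by positivity) (by positivity),
            ← ENNReal.ofReal_mul (by positivity)]
          congr 1
          rw [hq]
          field_simp

end Run

end

end Alphatron

namespace Alphatron

open Prog
open scoped ENNReal

noncomputable section

/-! ### Exceptional events -/

section Events

variable {n d m₁ m₂ T : ℕ} {u : ℝ → ℝ} {D : Measure (Example n)} [IsProbabilityMeasure D]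

theorem sampleLaw_training (A : Set (Fin m₁ → Example n)) :
    sampleLaw D m₁ m₂ {q | q.1 ∈ A} = Measure.pi (fun _ => D) A := by
  have h : {q : (Fin m₁ → Example n) × (Fin m₂ → Example n) × (ℕ → unitInterval) | q.1 ∈ A} =
      A ×ˢ Set.univ := by ext; simp
  rw [h, sampleLaw, Measure.prod_prod, measure_univ, mul_one]

theorem sampleLaw_le_of_tape
    {A : Set ((Fin m₁ → Example n) × (Fin m₂ → Example n) × (ℕ → unitInterval))}
    (hA : MeasurableSet A) {c : ℝ≥0∞} (h : ∀ S V, tapeLaw {ω | (S, V, ω) ∈ A} ≤ c) :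
    sampleLaw D m₁ m₂ A ≤ c := by
  rw [sampleLaw, Measure.prod_apply hA]
  refine (lintegral_mono fun S => ?_).trans_eq (b := ∫⁻ _, c ∂_) (by simp)
  rw [Measure.prod_apply (measurable_prodMk_left hA)]
  exact (lintegral_mono fun V => h S V).trans_eq (by simp)

/-- Integrates over the validation set first. With training set and tape fixed, the iterates are
fixed and the validation examples are still independent. -/
theorem sampleLaw_le_of_validation
    {A : Set ((Fin m₁ → Example n) × (Fin m₂ → Example n) × (ℕ → unitInterval))}
    (hA : MeasurableSet A) {c : ℝ≥0∞}
    (h : ∀ S ω, Measure.pi (fun _ => D) {V | (S, V, ω) ∈ A} ≤ c) :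
    sampleLaw D m₁ m₂ A ≤ c := by
  rw [sampleLaw, Measure.prod_apply hA]
  refine (lintegral_mono fun S => ?_).trans_eq (b := ∫⁻ _, c ∂_) (by simp)
  rw [Measure.prod_apply_symm (measurable_prodMk_left hA)]
  exact (lintegral_mono fun ω => h S ω).trans_eq (by simp)

theorem sampleLaw_not_accurate_le (hd : 1 ≤ d) (hm₁ : 1 ≤ m₁) {εK δ : ℝ} (hε : 0 < εK)
    (hε1 : εK ≤ 1) (hδ : 0 < δ) (hδ1 : δ < 1) :
    sampleLaw D m₁ m₂ {q | ¬ Accurate εK d q.1 q.2.1 (exec u (grams (meanSize (εK / (3 * d)))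
      (numMeans (δ / (m₁ ^ 2 + m₁ * m₂))) d q.1 q.2.1) q.2.2).value} ≤ ENNReal.ofReal δ :=
  sampleLaw_le_of_tape (measurableSet_accurate εK measurable_fst
      (measurable_fst.comp measurable_snd) (measurable_grams _ _)).compl
    fun S V => tapeLaw_grams_le S V hd hm₁ hε hε1 hδ hδ1

/-- The vectors of the training loop as a function of the training set and the tape. -/
def iterateCoeff (u : ℝ → ℝ) (lam : ℝ) (N k d : ℕ) (t : ℕ)
    (q : (Fin m₁ → Example n) × (ℕ → unitInterval)) : Fin m₁ → ℝ :=
  coeff u lam (fun i => ((q.1 i).2 : ℝ)) (exec u (gram N k d (points q.1) (points q.1)) q.2).value t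

theorem measurable_iterateCoeff (hu : Measurable u) (lam : ℝ) (N k d t : ℕ) :
    Measurable (iterateCoeff (n := n) (m₁ := m₁) u lam N k d t) := by
  have hK : Measurable fun q : (Fin m₁ → Example n) × (ℕ → unitInterval) =>
      (exec u (gram N k d (points q.1) (points q.1)) q.2).value :=
    measurable_fst.comp (measurableProg_gram measurable_points measurable_points N k d)
  have hy : ∀ i, Measurable fun q : (Fin m₁ → Example n) × (ℕ → unitInterval) =>
      ((q.1 i).2 : ℝ) := fun i =>
    measurable_label.comp ((measurable_pi_apply i).comp measurable_fst)
  induction t with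
  | zero => exact measurable_const
  | succ t ih =>
    unfold iterateCoeff at ih ⊢
    simp only [coeff_succ]
    refine measurable_pi_lambda _ fun i => ?_
    have h1 : ∀ j, Measurable fun q : (Fin m₁ → Example n) × (ℕ → unitInterval) =>
        coeff u lam (fun i => ((q.1 i).2 : ℝ))
          (exec u (gram N k d (points q.1) (points q.1)) q.2).value t j := fun j =>
      (measurable_pi_apply j).comp ih
    have h2 : ∀ j, Measurable fun q : (Fin m₁ → Example n) × (ℕ → unitInterval) =>
        (exec u (gram N k d (points q.1) (points q.1)) q.2).value i j := fun j =>
      (measurable_pi_apply j).comp ((measurable_pi_apply i).comp hK)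
    exact (h1 i).add (((hy i).sub (hu.comp (Finset.univ.measurable_sum fun j _ =>
      (h1 j).mul (h2 j)))).const_mul _)

/-- The excess loss on the validation set of the hypotheses of the training loop is comparable with
their generalization error. -/
def GoodValidation (u : ℝ → ℝ) (D : Measure (Example n)) (c : EuclideanSpace ℝ (Fin n) → ℝ)
    (d T : ℕ) (r : ℝ) (S : Fin m₁ → Example n) (V : Fin m₂ → Example n)
    (α : ℕ → Fin m₁ → ℝ) : Prop :=
  ∀ t < T, m₂ * (generalizationError D c (hypothesis u d S (α t)) / 2) - r ≤
      ∑ i, ((hypothesis u d S (α t) (V i).1 - (V i).2) ^ 2 - (c (V i).1 - (V i).2) ^ 2) ∧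
    ∑ i, ((hypothesis u d S (α t) (V i).1 - (V i).2) ^ 2 - (c (V i).1 - (V i).2) ^ 2) ≤
      m₂ * (3 / 2 * generalizationError D c (hypothesis u d S (α t))) + r

theorem measurable_hypothesis (hu : Measurable u) {X : Type*} [MeasurableSpace X]
    {S : X → Fin m₁ → Example n} {α : X → Fin m₁ → ℝ} {x : X → EuclideanSpace ℝ (Fin n)}
    (hS : Measurable S) (hα : Measurable α) (hx : Measurable x) :
    Measurable fun q => hypothesis u d (S q) (α q) (x q) := by
  refine hu.comp (Finset.univ.measurable_sum fun j _ => ?_)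
  refine ((measurable_pi_apply j).comp hα).mul (continuous_inner.measurable.comp
    (((measurable_featureMap d).comp hx).prodMk ((measurable_featureMap d).comp ?_)))
  exact measurable_point.comp ((measurable_pi_apply j).comp hS)

theorem measurableSet_goodValidation (hu : Measurable u) {c : EuclideanSpace ℝ (Fin n) → ℝ}
    (hc : Measurable c) (r : ℝ) {X : Type*} [MeasurableSpace X] {S : X → Fin m₁ → Example n}
    {V : X → Fin m₂ → Example n} {α : X → ℕ → Fin m₁ → ℝ} (hS : Measurable S) (hV : Measurable V)
    (hα : ∀ t, Measurable fun x => α x t) :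
    MeasurableSet {x | GoodValidation u D c d T r (S x) (V x) (α x)} := by
  have h1 : ∀ t, Measurable fun x => generalizationError D c (hypothesis u d (S x) (α x t)) :=
      fun t => by
    have : Measurable fun q : X × Example n =>
        (hypothesis u d (S q.1) (α q.1 t) q.2.1 - c q.2.1) ^ 2 :=
      ((measurable_hypothesis hu (hS.comp measurable_fst) ((hα t).comp measurable_fst)
        (measurable_point.comp measurable_snd)).sub
        (hc.comp (measurable_point.comp measurable_snd))).pow_const 2
    exact (this.stronglyMeasurable.integral_prod_right' (ν := D)).measurable
  have hVi : ∀ i, Measurable fun x => V x i := fun i => (measurable_pi_apply i).comp hV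
  have h2 : ∀ t, Measurable fun x => ∑ i, ((hypothesis u d (S x) (α x t) (V x i).1 -
      (V x i).2) ^ 2 - (c (V x i).1 - (V x i).2) ^ 2) := fun t => by
    refine Finset.univ.measurable_sum fun i _ => Measurable.sub ?_ ?_
    · exact ((measurable_hypothesis hu hS (hα t) (measurable_point.comp (hVi i))).sub
        (measurable_label.comp (hVi i))).pow_const 2
    · exact ((hc.comp (measurable_point.comp (hVi i))).sub
        (measurable_label.comp (hVi i))).pow_const 2
  simp only [GoodValidation, Set.ofPred_forall, Set.ofPred_and]
  refine .iInter fun t => .iInter fun _ => .inter (measurableSet_le ?_ (h2 t))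
    (measurableSet_le (h2 t) ?_)
  · exact (((h1 t).div_const 2).const_mul _).sub_const _
  · exact (((h1 t).const_mul _).const_mul _).add_const _

theorem pi_not_goodValidation_le (hu : Measurable u) (hu1 : ∀ s, u s ∈ Set.Icc (0 : ℝ) 1)
    {c : EuclideanSpace ℝ (Fin n) → ℝ} (hc : Measurable c) (hc1 : ∀ x, c x ∈ Set.Icc (0 : ℝ) 1)
    (hreg : D[fun p => (p.2 : ℝ) | MeasurableSpace.comap Prod.fst inferInstance]
      =ᵐ[D] fun p => c p.1) (hT : 0 < T) {δ : ℝ} (hδ : 0 < δ) (S : Fin m₁ → Example n)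
    (α : ℕ → Fin m₁ → ℝ) :
    Measure.pi (fun _ : Fin m₂ => D)
      {V | ¬ GoodValidation u D c d T (8 * Real.log (2 * T / δ)) S V α} ≤ ENNReal.ofReal δ := by
  have hT' : (0 : ℝ) < T := by exact_mod_cast hT
  have hh : ∀ t, Measurable fun x => hypothesis u d S (α t) x := fun t =>
    measurable_hypothesis hu measurable_const measurable_const measurable_id
  have h := measure_excess_loss_le D (m := m₂) (T := T) (c := fun p => c p.1)
    (y := fun p => (p.2 : ℝ)) (h := fun t p => hypothesis u d S (α t) p.1)
    (hc.comp measurable_point) measurable_label (fun t => (hh t).comp measurable_point)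
    (fun p => hc1 _) (fun p => p.2.2) (fun t p => hu1 _)
    (fun t => integral_mul_sub_concept_eq_zero D hc hc1 hreg
      (g := fun x => hypothesis u d S (α t) x - c x) ((hh t).sub hc) (k := 1) fun p => by
        have h1 : hypothesis u d S (α t) p.1 ∈ Set.Icc (0 : ℝ) 1 := hu1 _
        rw [abs_le]
        constructor <;> linarith [h1.1, h1.2, (hc1 p.1).1, (hc1 p.1).2])
    (8 * Real.log (2 * T / δ))
  -- The choice `r = 8 log(2 T / δ)` makes the union bound over `T` iterates and two tails equal to
  -- `δ`.
  have e : 2 * T * Real.exp (-(8 * Real.log (2 * T / δ) / 8)) = δ := by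
    rw [mul_div_cancel_left₀ _ (by norm_num), Real.exp_neg, Real.exp_log (by positivity)]
    field_simp
  rw [e] at h
  refine (measure_mono fun V hV => ?_).trans h
  simp only [GoodValidation, Set.mem_ofPred_eq, not_forall, not_and_or, not_le] at hV
  obtain ⟨t, ht, hV⟩ := hV
  exact ⟨t, ht, hV⟩

theorem sampleLaw_not_goodValidation_le (hu : Measurable u) (hu1 : ∀ s, u s ∈ Set.Icc (0 : ℝ) 1)
    {c : EuclideanSpace ℝ (Fin n) → ℝ} (hc : Measurable c) (hc1 : ∀ x, c x ∈ Set.Icc (0 : ℝ) 1)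
    (hreg : D[fun p => (p.2 : ℝ) | MeasurableSpace.comap Prod.fst inferInstance]
      =ᵐ[D] fun p => c p.1) (hT : 0 < T) {δ : ℝ} (hδ : 0 < δ)
    {α : ℕ → (Fin m₁ → Example n) × (ℕ → unitInterval) → Fin m₁ → ℝ}
    (hα : ∀ t, Measurable (α t)) :
    sampleLaw D m₁ m₂ {q | ¬ GoodValidation u D c d T (8 * Real.log (2 * T / δ)) q.1 q.2.1
      fun t => α t (q.1, q.2.2)} ≤ ENNReal.ofReal δ := by
  have hα' : ∀ t, Measurable fun q : (Fin m₁ → Example n) × (Fin m₂ → Example n) ×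
      (ℕ → unitInterval) => α t (q.1, q.2.2) := fun t =>
    (hα t).comp (measurable_fst.prodMk (measurable_snd.comp measurable_snd))
  have hA := (measurableSet_goodValidation (D := D) (d := d) (T := T) hu hc
    (8 * Real.log (2 * T / δ))
    (X := (Fin m₁ → Example n) × (Fin m₂ → Example n) × (ℕ → unitInterval))
    (S := fun q => q.1) (V := fun q => q.2.1)
    (α := fun q t => α t (q.1, q.2.2)) measurable_fst
    (measurable_fst.comp measurable_snd) hα').compl
  refine sampleLaw_le_of_validation hA fun S ω => ?_
  exact pi_not_goodValidation_le hu hu1 hc hc1 hreg hT hδ S fun t => α t (S, ω)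

end Events

end

end Alphatron

namespace Alphatron

open Prog

noncomputable section

/-! ### The error of the output -/

section Output

variable {n d m₁ m₂ T : ℕ} {B L ζ ε : ℝ} {u : ℝ → ℝ}
  {v : EuclideanSpace ℝ (Σ i : Fin (d + 1), (Fin (i : ℕ) → Fin n))}
  {ξ : EuclideanSpace ℝ (Fin n) → ℝ} {D : Measure (Example n)}

theorem hypothesis_eq (S : Fin m₁ → Example n) (α : Fin m₁ → ℝ) (x : EuclideanSpace ℝ (Fin n)) :
    hypothesis u d S α x =
      u (inner ℝ (combination (fun i => featureMap d (S i).1.1) α) (featureMap d x)) := by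
  rw [hypothesis, combination, sum_inner]
  congr 1
  refine Finset.sum_congr rfl fun i _ => ?_
  rw [real_inner_smul_left, real_inner_comm]
  rfl

theorem abs_sq_sub_sq_le {a a' b e : ℝ} (ha : a ∈ Set.Icc (0 : ℝ) 1) (ha' : a' ∈ Set.Icc (0 : ℝ) 1)
    (hb : b ∈ Set.Icc (0 : ℝ) 1) (h : |a - a'| ≤ e) : |(a - b) ^ 2 - (a' - b) ^ 2| ≤ 2 * e := by
  have e1 : (a - b) ^ 2 - (a' - b) ^ 2 = (a + a' - 2 * b) * (a - a') := by ring
  rw [e1, abs_mul]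
  refine mul_le_mul ?_ h (abs_nonneg _) (by norm_num)
  rw [abs_le]
  constructor <;> linarith [ha.1, ha.2, ha'.1, ha'.2, hb.1, hb.2]

/-- The selected hypothesis is about as good as each of the others. -/
theorem GoodValidation.generalizationError_le {r : ℝ} {S : Fin m₁ → Example n}
    {V : Fin m₂ → Example n} {c : EuclideanSpace ℝ (Fin n) → ℝ} {y : Fin m₁ → ℝ}
    {K : Fin m₁ → Fin m₁ → ℝ} {K' : Fin m₂ → Fin m₁ → ℝ}
    (hV : GoodValidation u D c d T r S V (coeff u (1 / L) y K)) (hL : 0 < L)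
    (hu : ∀ s, u s ∈ Set.Icc (0 : ℝ) 1) (hlip : ∀ s t, |u s - u t| ≤ L * |s - t|)
    (hy : ∀ i, y i ∈ Set.Icc (0 : ℝ) 1) (hm₂ : 0 < m₂)
    (hK' : ∀ i j, |K' i j - kernel d (V i).1.1 (S j).1.1| ≤ L * √ε / T) {t s : ℕ} (ht : t < T)
    (hs : s < T) (hmin : validationValue u (fun i => ((V i).2 : ℝ)) K' (coeff u (1 / L) y K t) ≤
      validationValue u (fun i => ((V i).2 : ℝ)) K' (coeff u (1 / L) y K s)) :
    generalizationError D c (hypothesis u d S (coeff u (1 / L) y K t)) ≤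
      3 * generalizationError D c (hypothesis u d S (coeff u (1 / L) y K s)) + 4 * r / m₂ +
        8 * (L * √ε) := by
  have hm' : (0 : ℝ) < m₂ := by exact_mod_cast hm₂
  -- The algorithm validates with approximate kernel values; this costs at most `2 L √ε` per
  -- example.
  have hval : ∀ t < T, |m₂ * validationValue u (fun i => ((V i).2 : ℝ)) K' (coeff u (1 / L) y K t) -
      ∑ i, (hypothesis u d S (coeff u (1 / L) y K t) (V i).1 - (V i).2) ^ 2| ≤
        m₂ * (2 * (L * √ε)) := fun t ht => by
    rw [validationValue, mul_div_cancel₀ _ hm'.ne', ← Finset.sum_sub_distrib]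
    refine (Finset.abs_sum_le_sum_abs _ _).trans ?_
    calc _ ≤ ∑ i : Fin m₂, 2 * (L * √ε) := Finset.sum_le_sum fun i _ => by
          rw [← sq]
          refine abs_sq_sub_sq_le (hu _) (hu _) (V i).2.2 ?_
          rw [hypothesis_eq]
          refine (hlip _ _).trans ?_
          gcongr
          exact abs_sum_coeff_sub_le hL hu hy ht.le (Real.sqrt_nonneg ε) (hK' i)
      _ = _ := by rw [Finset.sum_const, Finset.card_univ, Fintype.card_fin, nsmul_eq_mul]
  have h1 := (abs_le.1 (hval t ht)).1
  have h2 := (abs_le.1 (hval s hs)).2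
  have h3 := (hV t ht).1
  have h4 := (hV s hs).2
  have h5 := mul_le_mul_of_nonneg_left hmin hm'.le
  rw [Finset.sum_sub_distrib] at h3 h4
  have h6 : 4 * r / m₂ * m₂ = 4 * r := div_mul_cancel₀ _ hm'.ne'
  rw [← mul_le_mul_iff_left₀ hm']
  -- Per example, half the error of `t` is at most `3 / 2` of that of `s`, plus `2 r / m₂`, plus `4
  -- L √ε` from the two uses of `hval`; doubling gives the claim.
  linarith

variable [IsProbabilityMeasure D]

/-- Dropping `ξ` from the target costs `L² ξ²` pointwise, and `(p + q)² ≤ 2 p² + 2 q²`. -/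
theorem InConceptClass.generalizationError_le (h : InConceptClass B L ζ ε u v ξ D)
    (w : EuclideanSpace ℝ (Σ i : Fin (d + 1), (Fin (i : ℕ) → Fin n))) :
    generalizationError D (concept u v ξ) (fun x => u (inner ℝ w (featureMap d x))) ≤
      2 * ∫ p, (u (inner ℝ w (featureMap d p.1.1)) - u (inner ℝ v (featureMap d p.1.1))) ^ 2 ∂D +
        2 * (L ^ 2 * ε) := by
  have hψ : Measurable fun p : Example n => featureMap d p.1.1 :=
    (measurable_featureMap d).comp measurable_point
  have hlin : ∀ w, Measurable fun p : Example n => u (inner ℝ w (featureMap d p.1.1)) := fun w =>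
    h.monotone_u.measurable.comp ((continuous_const.inner continuous_id).measurable.comp hψ)
  have hu1 : ∀ s t, |u s - u t| ≤ 1 := fun s t => by
    rw [abs_le]
    constructor <;> linarith [(h.range_u s).1, (h.range_u s).2, (h.range_u t).1, (h.range_u t).2]
  have hsq : ∀ s t, |(u s - u t) ^ 2| ≤ 1 := fun s t => by
    rw [abs_pow]; exact pow_le_one₀ (abs_nonneg _) (hu1 _ _)
  have hi1 : Integrable (fun p : Example n => (u (inner ℝ w (featureMap d p.1.1)) -
      u (inner ℝ v (featureMap d p.1.1))) ^ 2) D :=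
    integrable_of_abs_le D (((hlin w).sub (hlin v)).pow_const 2) fun p => hsq _ _
  have hi2 : Integrable (fun p : Example n => ξ p.1 ^ 2) D :=
    integrable_of_abs_le D ((h.measurable_noise.comp measurable_point).pow_const 2) (c := ζ ^ 2)
      fun p => by
        rw [abs_of_nonneg (sq_nonneg _)]
        exact sq_le_sq' (h.noise_range _).1 (h.noise_range _).2
  have hi3 : Integrable (fun p : Example n => (u (inner ℝ w (featureMap d p.1.1)) -
      concept u v ξ p.1) ^ 2) D :=
    integrable_of_abs_le D (((hlin w).sub (h.measurable_concept.comp measurable_point)).pow_const 2)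
      fun p => hsq _ _
  calc _ ≤ ∫ p : Example n, (2 * (u (inner ℝ w (featureMap d p.1.1)) -
        u (inner ℝ v (featureMap d p.1.1))) ^ 2 + 2 * L ^ 2 * ξ p.1 ^ 2) ∂D := by
        refine integral_mono hi3 ((hi1.const_mul 2).add (hi2.const_mul (2 * L ^ 2))) fun p => ?_
        simp only
        have h1 := h.lipschitz_u (inner ℝ v (featureMap d p.1.1) + ξ p.1)
          (inner ℝ v (featureMap d p.1.1))
        rw [add_sub_cancel_left] at h1
        have h2 : (u (inner ℝ v (featureMap d p.1.1) + ξ p.1) -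
            u (inner ℝ v (featureMap d p.1.1))) ^ 2 ≤ L ^ 2 * ξ p.1 ^ 2 := by
          rw [← sq_abs, ← sq_abs (ξ p.1), ← mul_pow]
          gcongr
        unfold concept
        set a := u (inner ℝ w (featureMap d p.1.1))
        set b := u (inner ℝ v (featureMap d p.1.1))
        set c := u (inner ℝ v (featureMap d p.1.1) + ξ p.1)
        nlinarith [sq_nonneg (a - b + (c - b))]
    _ = 2 * ∫ p, (u (inner ℝ w (featureMap d p.1.1)) -
          u (inner ℝ v (featureMap d p.1.1))) ^ 2 ∂D + 2 * L ^ 2 * ∫ p, ξ p.1 ^ 2 ∂D := by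
        rw [integral_add (hi1.const_mul 2) (hi2.const_mul (2 * L ^ 2)), integral_const_mul,
          integral_const_mul]
    _ ≤ _ := by
        have := mul_le_mul_of_nonneg_left h.noise_sq (by positivity : 0 ≤ 2 * L ^ 2)
        linarith

/-- Without training, the hypothesis is constant. -/
theorem InConceptClass.generalizationError_zero_le (h : InConceptClass B L ζ ε u v ξ D)
    (hB : 0 < B) (hL : 0 < L) (S : Fin m₁ → Example n) :
    generalizationError D (concept u v ξ) (hypothesis u d S 0) ≤
      2 * (B * L) ^ 2 + 2 * (L ^ 2 * ε) := by
  have h0 : hypothesis u d S 0 = fun x => u (inner ℝ (0 : EuclideanSpace ℝ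
      (Σ i : Fin (d + 1), (Fin (i : ℕ) → Fin n))) (featureMap d x)) := by
    ext x; simp [hypothesis]
  rw [h0]
  refine (h.generalizationError_le 0).trans ?_
  gcongr
  have h1 : ∀ p : Example n, ‖(u (inner ℝ (0 : EuclideanSpace ℝ
      (Σ i : Fin (d + 1), (Fin (i : ℕ) → Fin n))) (featureMap d p.1.1)) -
        u (inner ℝ v (featureMap d p.1.1))) ^ 2‖ ≤ (B * L) ^ 2 := fun p => by
    rw [Real.norm_eq_abs, abs_pow]
    gcongr
    refine (h.lipschitz_u _ _).trans ?_
    rw [inner_zero_left, zero_sub, abs_neg, mul_comm]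
    gcongr
    refine (abs_real_inner_le_norm _ _).trans ?_
    calc _ ≤ B * 1 := by
          gcongr
          · exact h.norm_v
          · exact norm_featureMap_le d (norm_example_le p)
      _ = B := mul_one B
  exact (le_abs_self _).trans ((norm_integral_le_of_norm_le_const
    (Filter.Eventually.of_forall h1)).trans_eq (by simp))

/-- Some vector of the training loop has a small generalization error. -/
theorem GoodTraining.exists_generalizationError_le {s : ℝ} {S : Fin m₁ → Example n}
    (hS : GoodTraining B L ζ ε s u v ξ D S) (h : InConceptClass B L ζ ε u v ξ D) (hB : 0 < B)
    (hL : 0 < L) (hζ : 0 < ζ) (hε : 0 < ε) (hs : 0 ≤ s) (hm₁ : 0 < m₁) (hT : 0 < T)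
    (hLε : L * √ε ≤ 1) {K : Fin m₁ → Fin m₁ → ℝ}
    (hK : ∀ i j, |K i j - kernel d (S i).1.1 (S j).1.1| ≤ L * √ε / T) :
    ∃ t < T, generalizationError D (concept u v ξ)
        (hypothesis u d S (coeff u (1 / L) (fun i => ((S i).2 : ℝ)) K t)) ≤
      62 * (L * √ε) + 60 * (L * ζ * √s) + 112 * (B * L * s) + 324 * s ^ 2 +
        12 * (B ^ 2 * L ^ 2 / T) := by
  have hm' : (0 : ℝ) < m₁ := by exact_mod_cast hm₁
  obtain ⟨t, ht, h1, h2⟩ := exists_training_error_le (y := fun i => ((S i).2 : ℝ))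
    (ψ := fun i => featureMap d (S i).1.1) (ξ := fun i => ξ (S i).1) (η := 3 * s) hm₁ hL h.range_u
    h.lipschitz_u h.monotone_u (fun i => (S i).2.2)
    (fun i => norm_featureMap_le d (norm_example_le _)) h.norm_v hB hT (Real.sqrt_nonneg ε) hLε hK
    hS.gradient
  refine ⟨t, ht, ?_⟩
  set α := coeff u (1 / L) (fun i => ((S i).2 : ℝ)) K t with hα
  set w := combination (fun i => featureMap d (S i).1.1) α with hw
  have hh : hypothesis u d S α = fun x => u (inner ℝ w (featureMap d x)) := by
    ext x; exact hypothesis_eq S α x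
  rw [hh]
  have h3 := h.generalizationError_le w
  have h4 := hS.uniform w h1
  set X := (∑ i, |ξ (S i).1|) / m₁ with hX
  -- Cauchy–Schwarz bounds the mean of `|ξ|` by `√(ε + 3 ζ² s)`.
  have hXle : X ≤ √ε + 2 * (ζ * √s) := by
    have e1 : (∑ i, |ξ (S i).1|) ^ 2 ≤ m₁ * ∑ i, ξ (S i).1 ^ 2 := by
      have := sq_sum_le_card_mul_sum_sq (s := Finset.univ) (f := fun i => |ξ (S i).1|)
      simpa [sq_abs] using this
    have e2 : X ^ 2 ≤ ε + ζ ^ 2 * (3 * s) := by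
      rw [hX, div_pow, div_le_iff₀ (by positivity)]
      have := mul_le_mul_of_nonneg_left hS.noise hm'.le
      linarith
    refine (sq_le_sq₀ (by positivity) (by positivity)).1 (e2.trans ?_)
    have e3 : (√ε + 2 * (ζ * √s)) ^ 2 = √ε ^ 2 + 4 * (√ε * (ζ * √s)) + 4 * (ζ ^ 2 * √s ^ 2) := by
      ring
    rw [e3, Real.sq_sqrt hε.le, Real.sq_sqrt hs]
    have e4 : 0 ≤ √ε * (ζ * √s) := by positivity
    have e5 : 0 ≤ ζ ^ 2 * s := by positivity
    linarith
  have hLX : L * X ≤ L * √ε + 2 * (L * ζ * √s) := by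
    have := mul_le_mul_of_nonneg_left hXle hL.le
    linarith
  have hLL : L ^ 2 * ε ≤ L * √ε := by
    have e1 : L ^ 2 * ε = (L * √ε) * (L * √ε) := by
      have := Real.mul_self_sqrt hε.le
      calc _ = L ^ 2 * (√ε * √ε) := by rw [this]
        _ = _ := by ring
    rw [e1]
    exact mul_le_of_le_one_right (by positivity) hLε
  have h5 : 2 * L * (3 * s * B + √ε + X) = 6 * (B * L * s) + 2 * (L * √ε) + 2 * (L * X) := by ring
  rw [h5] at h2
  have h6 : 3 * (3 * s) ^ 2 = 27 * s ^ 2 := by ring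
  rw [h6] at h2
  -- The empirical error is at most `30 L√ε + 30 Lζ√s + 36 BLs + 162 s² + 6 B²L²/T`. Adding `20 BLs`
  -- for uniform convergence, doubling, and adding `2 L²ε ≤ 2 L√ε` gives the constants.
  linarith

end Output

end

end Alphatron

namespace Alphatron

open Prog

noncomputable section

/-! ### The error bound -/

section ErrorBound

variable {n d m₁ m₂ T : ℕ} {B L ζ ε δ : ℝ} {u : ℝ → ℝ}
  {v : EuclideanSpace ℝ (Σ i : Fin (d + 1), (Fin (i : ℕ) → Fin n))}
  {ξ : EuclideanSpace ℝ (Fin n) → ℝ} {D : Measure (Example n)} [IsProbabilityMeasure D]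

theorem errorBound_eq (hδ : 0 < δ) (hδ' : δ < 1 / 3) :
    errorBound B L ζ ε δ m₁ = L * √ε + L * ζ * √√(Real.log (1 / δ) / m₁) +
      B * L * √(Real.log (1 / δ) / m₁) := by
  have hℓ : 1 ≤ Real.log (1 / δ) := one_le_log (by rw [le_div_iff₀ hδ]; linarith)
  have : (Real.log (1 / δ) / m₁) ^ (1 / 4 : ℝ) = √√(Real.log (1 / δ) / m₁) := by
    rw [Real.sqrt_eq_rpow, Real.sqrt_eq_rpow, ← Real.rpow_mul (by positivity)]
    norm_num
  rw [errorBound, this]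

/-- On the intersection of the good events, the output has a small error. -/
theorem GoodTraining.generalizationError_output_le {C C' s : ℝ} {S : Fin m₁ → Example n}
    {V : Fin m₂ → Example n} (hC : 1 ≤ C) (hC' : 1 ≤ C') (hm₁ : 1 ≤ m₁) (hB : 0 < B) (hL : 0 < L)
    (hζ : 0 < ζ) (hε : 0 < ε) (hδ : 0 < δ) (hδ' : δ < 1 / 3)
    (h : InConceptClass B L ζ ε u v ξ D)
    (hT : T = ⌈C * B * L * √(m₁ / Real.log (1 / δ))⌉₊)
    (hm₂ : m₂ = ⌈C' * m₁ * Real.log (T / δ)⌉₊) (hLε : L * √ε ≤ 1)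
    (hs : s = √(Real.log (1 / δ) / m₁)) (hS : GoodTraining B L ζ ε s u v ξ D S)
    {K : Fin m₁ → Fin m₁ → ℝ} {K' : Fin m₂ → Fin m₁ → ℝ}
    (hK : Accurate (L * √ε / T) d S V (K, K'))
    (hV : GoodValidation u D (concept u v ξ) d T (8 * Real.log (2 * T / δ)) S V
      (coeff u (1 / L) (fun i => ((S i).2 : ℝ)) K)) {t : ℕ} (ht : t < T)
    (hmin : ∀ r < T, validationValue u (fun i => ((V i).2 : ℝ)) K'
        (coeff u (1 / L) (fun i => ((S i).2 : ℝ)) K t) ≤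
      validationValue u (fun i => ((V i).2 : ℝ)) K'
        (coeff u (1 / L) (fun i => ((S i).2 : ℝ)) K r)) :
    generalizationError D (concept u v ξ)
      (hypothesis u d S (coeff u (1 / L) (fun i => ((S i).2 : ℝ)) K t)) ≤
        2000 * C * (L * √ε + L * ζ * √s + B * L * s) := by
  have hm' : (0 : ℝ) < m₁ := by exact_mod_cast hm₁
  have hT0 : 0 < T := ht.pos
  have hT' : (1 : ℝ) ≤ T := by exact_mod_cast hT0
  set ℓ := Real.log (1 / δ) with hℓ
  have hℓ1 : 1 ≤ ℓ := one_le_log (by rw [le_div_iff₀ hδ]; linarith)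
  have hs0 : 0 < s := by rw [hs]; positivity
  have hs2 : s ^ 2 = ℓ / m₁ := by rw [hs, Real.sq_sqrt (by positivity)]
  have hinv : √(m₁ / ℓ) = 1 / s := by
    rw [hs, one_div, ← Real.sqrt_inv, inv_div]
  rw [hinv] at hT
  have ha1 : 0 ≤ L * √ε := by positivity
  have ha2 : 0 ≤ L * ζ * √s := by positivity
  have ha3 : 0 ≤ B * L * s := by positivity
  have hCa1 : L * √ε ≤ C * (L * √ε) := le_mul_of_one_le_left ha1 hC
  have hCa2 : L * ζ * √s ≤ C * (L * ζ * √s) := le_mul_of_one_le_left ha2 hC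
  have hCa3 : B * L * s ≤ C * (B * L * s) := le_mul_of_one_le_left ha3 hC
  have hTge : C * (B * L) ≤ T * s := by
    have h1 := Nat.le_ceil (C * B * L * (1 / s))
    rw [← hT, mul_one_div, div_le_iff₀ hs0] at h1
    linarith
  have hBL : B * L ≤ C * (B * L) := le_mul_of_one_le_left (by positivity) hC
  -- If the ceiling `T` exceeds `1`, then `C B L / s > 1`, and the terms `s²` are absorbed by `C B L
  -- s`.
  rcases Nat.lt_or_ge 1 T with hT2 | hT1
  · have hsC : s < C * (B * L) := by
      have h1 : 1 < C * B * L * (1 / s) := by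
        rw [hT, Nat.lt_ceil] at hT2
        exact_mod_cast hT2
      rw [mul_one_div, one_lt_div hs0] at h1
      linarith
    have hs2C : s ^ 2 ≤ C * (B * L * s) := by
      have := mul_le_mul_of_nonneg_right hsC.le hs0.le
      linarith [sq s]
    obtain ⟨t', ht', h1⟩ := hS.exists_generalizationError_le h hB hL hζ hε hs0.le hm₁ hT0 hLε hK.1
    have hTm : (3 : ℝ) ≤ T / δ := by rw [le_div_iff₀ hδ]; linarith
    have hlog1 : 1 ≤ Real.log (T / δ) := one_le_log hTm
    have hm₂' : C' * m₁ * Real.log (T / δ) ≤ m₂ := by rw [hm₂]; exact Nat.le_ceil _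
    have hm₂0 : (0 : ℝ) < m₂ := lt_of_lt_of_le (by positivity) hm₂'
    have h2 := hV.generalizationError_le hL h.range_u h.lipschitz_u (fun i => (S i).2.2)
      (by exact_mod_cast hm₂0) hK.2 ht ht' (hmin t' ht')
    have h3 : B ^ 2 * L ^ 2 / T ≤ B * L * s := by
      rw [div_le_iff₀ (by positivity)]
      have := mul_le_mul_of_nonneg_left (hBL.trans hTge) (by positivity : 0 ≤ B * L)
      linarith [mul_pow B L 2, sq (B * L)]
    -- `log(2 T / δ) ≤ 2 log(T / δ)` and `m₂ ≥ m₁ log(T / δ)` give `64 / m₁`, and `ℓ ≥ 1`.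
    have h4 : 4 * (8 * Real.log (2 * T / δ)) / m₂ ≤ 64 * s ^ 2 := by
      have h5 : Real.log (2 * T / δ) ≤ 2 * Real.log (T / δ) := by
        rw [mul_div_assoc, Real.log_mul (by norm_num) (by positivity), two_mul]
        gcongr
        linarith
      have h6 : m₁ * Real.log (T / δ) ≤ m₂ := by
        refine le_trans ?_ hm₂'
        rw [mul_assoc]
        exact le_mul_of_one_le_left (by positivity) hC'
      rw [div_le_iff₀ hm₂0, hs2]
      calc 4 * (8 * Real.log (2 * T / δ)) ≤ 64 * (1 / m₁) * (m₁ * Real.log (T / δ)) := by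
            field_simp; linarith
        _ ≤ 64 * (ℓ / m₁) * m₂ := by gcongr
    linarith
  -- If `T = 1`, only the initial vector is available, but `B L ≤ s` makes its error `2 (B L)²` at
  -- most `2 B L s`.
  · have ht0 : t = 0 := by omega
    subst ht0
    have h1 := h.generalizationError_zero_le hB hL S
    have hTe : (T : ℝ) = 1 := le_antisymm (by exact_mod_cast hT1) hT'
    rw [hTe, one_mul] at hTge
    have h2 : (B * L) ^ 2 ≤ B * L * s := by
      rw [sq]; exact mul_le_mul_of_nonneg_left (hBL.trans hTge) (by positivity)
    have h3 : L ^ 2 * ε ≤ L * √ε := by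
      have e1 : L ^ 2 * ε = (L * √ε) * (L * √ε) := by
        have := Real.mul_self_sqrt hε.le
        calc _ = L ^ 2 * (√ε * √ε) := by rw [this]
          _ = _ := by ring
      rw [e1]
      exact mul_le_of_le_one_right ha1 hLε
    rw [coeff_zero]
    linarith

/-- The event of a large error lies in the union of three bad events of probability at most `δ`
each; only an inclusion is used, so this event need not be measurable. -/
theorem sampleLaw_error_le {C C' : ℝ} (hC : 1 ≤ C) (hC' : 1 ≤ C') (hd : 1 ≤ d) (hm₁ : 1 ≤ m₁)
    (hB : 0 < B) (hL : 0 < L) (hζ : 0 < ζ) (hε : 0 < ε) (hδ : 0 < δ) (hδ' : δ < 1 / 3)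
    (h : InConceptClass B L ζ ε u v ξ D) (hT : T = ⌈C * B * L * √(m₁ / Real.log (1 / δ))⌉₊)
    (hm₂ : m₂ = ⌈C' * m₁ * Real.log (T / δ)⌉₊) (hLε : L * √ε ≤ 1) :
    sampleLaw D m₁ m₂ {ω | 2000 * C * errorBound B L ζ ε δ m₁ <
        generalizationError D (concept u v ξ) (hypothesis u d ω.1
          (runApproxPre u d T (1 / L) (L * √ε / T) δ ω.1 ω.2.1 ω.2.2).value)} ≤
      ENNReal.ofReal (3 * δ) := by
  have hm' : (0 : ℝ) < m₁ := by exact_mod_cast hm₁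
  have hℓ1 : 1 ≤ Real.log (1 / δ) := one_le_log (by rw [le_div_iff₀ hδ]; linarith)
  have hT0 : 0 < T := by
    rw [hT, Nat.ceil_pos]; positivity
  have hT' : (1 : ℝ) ≤ T := by exact_mod_cast hT0
  have hu := h.monotone_u.measurable
  set N := meanSize (L * √ε / T / (3 * d)) with hN
  set k := numMeans (δ / (m₁ ^ 2 + m₁ * m₂ : ℝ)) with hk
  have hεK1 : L * √ε / T ≤ 1 := div_le_one_of_le₀ (hLε.trans hT') (by positivity)
  have b1 : sampleLaw D m₁ m₂ {q | q.1 ∈ {S : Fin m₁ → Example n |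
      ¬ GoodTraining B L ζ ε √(Real.log (1 / δ) / m₁) u v ξ D S}} ≤ ENNReal.ofReal δ := by
    rw [sampleLaw_training]
    exact h.measure_not_goodTraining_le hB hL hζ hm₁ hδ hδ'
  have b2 : sampleLaw D m₁ m₂ {q | ¬ Accurate (L * √ε / T) d q.1 q.2.1
      (exec u (grams N k d q.1 q.2.1) q.2.2).value} ≤ ENNReal.ofReal δ :=
    sampleLaw_not_accurate_le hd hm₁ (by positivity) hεK1 hδ (by linarith)
  obtain ⟨α, hα, hαm⟩ : ∃ α : ℕ → (Fin m₁ → Example n) × (ℕ → unitInterval) → Fin m₁ → ℝ,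
      (∀ t q, α t q = coeff u (1 / L) (fun i => ((q.1 i).2 : ℝ))
        (exec u (gram N k d (points q.1) (points q.1)) q.2).value t) ∧ ∀ t, Measurable (α t) :=
    ⟨fun t => iterateCoeff u (1 / L) N k d t, fun _ _ => rfl, measurable_iterateCoeff hu _ _ _ _⟩
  have b3 := sampleLaw_not_goodValidation_le (D := D) (d := d) (m₂ := m₂) hu h.range_u
    h.measurable_concept (fun x => h.range_u _) h.regression hT0 hδ hαm
  refine (measure_mono (t := {q | q.1 ∈ {S : Fin m₁ → Example n |
      ¬ GoodTraining B L ζ ε √(Real.log (1 / δ) / m₁) u v ξ D S}} ∪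
    ({q | ¬ Accurate (L * √ε / T) d q.1 q.2.1 (exec u (grams N k d q.1 q.2.1) q.2.2).value} ∪
      {q | ¬ GoodValidation u D (concept u v ξ) d T (8 * Real.log (2 * T / δ)) q.1 q.2.1
        fun t => α t (q.1, q.2.2)})) ?_).trans ?_
  · rintro ⟨S, V, ω⟩ hbad
    by_contra hcon
    simp only [Set.mem_union, Set.mem_ofPred_eq, not_or, not_not] at hcon hbad
    obtain ⟨c1, c2, c3⟩ := hcon
    obtain ⟨⟨K, K'⟩, hKK⟩ : ∃ q, (exec u (grams N k d S V) ω).value = q := ⟨_, rfl⟩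
    rw [hKK] at c2
    have hK := exec_grams_fst (u := u) (d := d) N k S V ω
    rw [hKK] at hK
    have hα' : (fun t => α t (S, ω)) = coeff u (1 / L) (fun i => ((S i).2 : ℝ)) K := by
      funext t
      rw [hα, ← hK]
    rw [hα'] at c3
    obtain ⟨t, ht, h1, h2⟩ := runApproxPre_spec (u := u) hT0 (1 / L) (L * √ε / T) δ S V ω hN.symm
      hk.symm hKK
    rw [h1, errorBound_eq hδ hδ'] at hbad
    exact not_le.2 hbad (c1.generalizationError_output_le hC hC' hm₁ hB hL hζ hε hδ hδ' h hT hm₂ hLε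
      rfl c2 c3 ht h2)
  · refine (measure_union_le _ _).trans ((add_le_add_right (measure_union_le _ _) _).trans ?_)
    calc _ ≤ ENNReal.ofReal δ + (ENNReal.ofReal δ + ENNReal.ofReal δ) :=
          add_le_add b1 (add_le_add b2 b3)
      _ = ENNReal.ofReal (3 * δ) := by
          rw [← ENNReal.ofReal_add hδ.le hδ.le, ← ENNReal.ofReal_add hδ.le (by positivity)]
          congr 1; ring

end ErrorBound

end

end Alphatron

/-! ### The main theorem -/

theorem mainTheorem5 :
    ∃ C₀ > (0 : ℝ), ∃ C₀' > (0 : ℝ), ∃ c > (0 : ℝ), ∃ κ : ℕ,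
      ∀ C ≥ C₀, ∀ C' ≥ C₀', ∃ C'' > (0 : ℝ),
        ∀ (n d m₁ m₂ T : ℕ) (B L ζ ε δ : ℝ) (u : ℝ → ℝ)
          (v : EuclideanSpace ℝ (Σ i : Fin (d + 1), (Fin (i : ℕ) → Fin n)))
          (ξ : EuclideanSpace ℝ (Fin n) → ℝ)
          (D : MeasureTheory.Measure (Example n)) [MeasureTheory.IsProbabilityMeasure D],
          1 ≤ d → 1 ≤ m₁ → 0 < B → 0 < L → 0 < ζ → 0 < ε → 0 < δ → δ < 1 / 3 →
          InConceptClass B L ζ ε u v ξ D →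
          T = ⌈C * B * L * √(m₁ / Real.log (1 / δ))⌉₊ →
          m₂ = ⌈C' * m₁ * Real.log (T / δ)⌉₊ →
          L * √ε ≤ 1 →
          -- the error exceeds `C'' A₂` with probability at most `3 δ`
          sampleLaw D m₁ m₂ {ω | C'' * errorBound B L ζ ε δ m₁ <
              generalizationError D (concept u v ξ)
                (hypothesis u d ω.1
                  (runApproxPre u d T (1 / L) (L * √ε / T) δ ω.1 ω.2.1 ω.2.2).value)}
            ≤ ENNReal.ofReal (3 * δ) ∧
          -- every run takes `O(g (log g)^κ)` steps
          ∀ (S : Fin m₁ → Example n) (V : Fin m₂ → Example n) (ω : ℕ → unitInterval),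
            ((runApproxPre u d T (1 / L) (L * √ε / T) δ S V ω).steps : ℝ) ≤
              c * costBound (m₁ + m₂) n d T L ε δ *
                Real.log (2 + costBound (m₁ + m₂) n d T L ε δ) ^ κ := by
  -- The constant `C'' = 2000 C` grows with `C` because `s² ≤ C B L s` is used for `T > 1`.
  refine ⟨1, one_pos, 1, one_pos, 10500, by norm_num, 2, fun C hC C' hC' =>
    ⟨2000 * C, by linarith, ?_⟩⟩
  intro n d m₁ m₂ T B L ζ ε δ u v ξ D _ hd hm₁ hB hL hζ hε hδ hδ' h hT hm₂ hLε
  have hT0 : 1 ≤ T := by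
    have hm' : (0 : ℝ) < m₁ := by exact_mod_cast hm₁
    have hℓ : 1 ≤ Real.log (1 / δ) := one_le_log (by rw [le_div_iff₀ hδ]; linarith)
    rw [hT, Nat.one_le_ceil_iff]
    positivity
  exact ⟨sampleLaw_error_le hC hC' hd hm₁ hB hL hζ hε hδ hδ' h hT hm₂ hLε,
    fun S V ω => steps_le d T L ε δ _ _ _ _ hd hm₁ hT0 hL hε hδ hδ' hLε ω⟩
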